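/- Let $T>0$, let $\mathcal D\subset\mathbb R^2$ be a convex, bounded polygonal domain, and let $g\in C^\infty(\overline{\mathcal D})$ satisfy $\int_{\mathcal D} g\,dx=0$ and $\partial_n g=0$ on $\partial\mathcal D$. Write $(\cdot,\cdot)$ and $\|\cdot\|$ for the inner product and norm of $L^2(\mathcal D)$, and set $f(u)=u^3-u$, $F(u)=\tfrac14(u^2-1)^2$ and $$\mathcal E(u)=\int_{\mathcal D}\Big(\frac{\varepsilon}{2}|\nabla u|^2+\frac1\varepsilon F(u)\Big)\,dx .$$ Let $W=\{W(t);\,0\le t\le T\}$ be a real-valued Wiener process on a filtered probability space $(\Omega,\mathcal F,\{\mathcal F_t\}_t,\mathbb P)$. For $J\in\mathbb N$, $J\ge1$, let $k=T/J$, $t_j=jk$ and $\Delta_jW=W(t_j)-W(t_{j-1})$. Let $u_0\in H^1(\mathcal D)$ be deterministic (it may depend on $\varepsilon$) with $\int_{\mathcal D}u_0\,dx=0$. Let $(X^j,w^j)$, $1\le j\le J$, be $[H^1(\mathcal D)]^2$-valued random variables which, with $X^0=u_0$, satisfy $\mathbb P$-almost surely, for every $1\le j\le J$, $$(X^j-X^{j-1},\varphi)+k(\nabla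 w^j,\nabla\varphi)=\varepsilon^\gamma(g,\varphi)\,\Delta_jW\qquad\forall\,\varphi\in H^1(\mathcal D),$$ $$\varepsilon(\nabla X^j,\nabla\psi)+\frac1\varepsilon(f(X^j),\psi)=(w^j,\psi)\qquad\forall\,\psi\in H^1(\mathcal D).$$ Fix $\varepsilon_0\in(0,1]$, and let $\gamma>\tfrac32$, $\varepsilon\in(0,\varepsilon_0)$ and $k\le\varepsilon^3$. Then mass is conserved along every path that satisfies the scheme, hence $\mathbb P$-almost surely: $\int_{\mathcal D}X^j\,dx=\int_{\mathcal D}u_0\,dx$ for all $0\le j\le J$. Moreover, there is a constant $C>0$, which depends only on $T$, $\mathcal D$, $g$ and $\varepsilon_0$ (and not on $\varepsilon$, $\gamma$, $J$, $u_0$ or the probability space), such that all expectations below are finite and i) $\displaystyle \max_{1\le j\le J}\mathbb E\big[\mathcal E(X^j)\big]+\frac k2\sum_{i=1}^J\mathbb E\big[\|\nabla w^i\|^2\big]\le C\big(\mathcal E(u_0)+1\big)$, ii) $\displaystyle \mathbb E\Big[\max_{1\le j\le J}\mathcal E(X^j)\Big]\le C\big(\mathcal E(u_0)+1\big)$. For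 every $p=2^r$, $r\in\mathbb N$, there is a constant $C_p>0$, which depends only on $p$, $T$, $\mathcal D$, $g$ and $\varepsilon_0$, such that, again with finite expectations, iii) $\displaystyle \max_{1\le j\le J}\mathbb E\big[|\mathcal E(X^j)|^p\big]\le C_p\big(|\mathcal E(u_0)|^p+1\big)$, iv) $\displaystyle \mathbb E\Big[\max_{1\le j\le J}|\mathcal E(X^j)|^p\Big]\le C_p\big(|\mathcal E(u_0)|^p+1\big)$. -/

import Mathlib

open MeasureTheory ProbabilityTheory

universe u

namespace StochCH

/-- The Euclidean plane. -/
abbrev Plane : Type := EuclideanSpace ℝ (Fin 2)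

/-- Bounded convex polygonal domains: non-empty interiors of convex hulls of finite sets. -/
def IsConvexPolygonalDomain (D : Set Plane) : Prop :=
  D.Nonempty ∧ ∃ V : Set Plane, V.Finite ∧ D = interior (convexHull ℝ V)

/-- Test functions: smooth functions with compact support contained in `D`. -/
structure IsTestFunction (D : Set Plane) (φ : Plane → ℝ) : Prop where
  smooth : ContDiff ℝ (⊤ : ℕ∞) φ
  compact : HasCompactSupport φ
  supp : tsupport φ ⊆ D

/-- The partial derivative `∂φ/∂xᵢ`. -/
noncomputable def partialDeriv (i : Fin 2) (φ : Plane → ℝ) (x : Plane) : ℝ :=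
  fderiv ℝ φ x (EuclideanSpace.single i 1)

theorem IsTestFunction.memLp {D : Set Plane} {φ : Plane → ℝ} (h : IsTestFunction D φ) :
    MemLp φ 2 (volume.restrict D) :=
  (h.smooth.continuous.memLp_of_hasCompactSupport h.compact).restrict D

theorem IsTestFunction.memLp_partialDeriv {D : Set Plane} {φ : Plane → ℝ}
    (h : IsTestFunction D φ) (i : Fin 2) :
    MemLp (partialDeriv i φ) 2 (volume.restrict D) := by
  have hc : Continuous (partialDeriv i φ) :=
    (h.smooth.continuous_fderiv (by simp)).clm_apply continuous_const
  have hs : HasCompactSupport (partialDeriv i φ) := h.compact.fderiv_apply (𝕜 := ℝ) _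
  exact (hc.memLp_of_hasCompactSupport hs).restrict D

/-- The space `L²(D)`. -/
abbrev L2 (D : Set Plane) : Type := Lp ℝ 2 (volume.restrict D)

/-- The space `L²(D; ℝ²)`. -/
abbrev L2Vec (D : Set Plane) : Type := Lp Plane 2 (volume.restrict D)

/-- `v` is the weak gradient of `u` on `D`. -/
def IsWeakGradient (D : Set Plane) (u : L2 D) (v : L2Vec D) : Prop :=
  ∀ φ : Plane → ℝ, IsTestFunction D φ → ∀ i : Fin 2,
    ∫ x in D, u x * partialDeriv i φ x = - ∫ x in D, (v x) i * φ x

theorem memLp_coord {D : Set Plane} (v : L2Vec D) (i : Fin 2) :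
    MemLp (fun x => (v x) i) 2 (volume.restrict D) :=
  (Lp.memLp v).continuousLinearMap_comp (EuclideanSpace.proj (𝕜 := ℝ) i)

/-- The Sobolev space `H¹(D)`: pairs of a function in `L²(D)` and its weak gradient in
`L²(D; ℝ²)`, with the Hilbert norm `(‖u‖² + ‖∇u‖²)^(1/2)` inherited from the `ℓ²`-product. -/
noncomputable def H1Submodule (D : Set Plane) : Submodule ℝ (WithLp 2 (L2 D × L2Vec D)) where
  carrier := {p | IsWeakGradient D p.fst p.snd}
  zero_mem' := by
    intro φ _ i
    have h1 : ∀ᵐ x ∂(volume.restrict D),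
        ((0 : L2 D) : Plane → ℝ) x * partialDeriv i φ x = 0 := by
      filter_upwards [Lp.coeFn_zero ℝ 2 (volume.restrict D)] with x hx
      rw [hx]; simp
    have h2 : ∀ᵐ x ∂(volume.restrict D),
        (((0 : L2Vec D) : Plane → Plane) x) i * φ x = 0 := by
      filter_upwards [Lp.coeFn_zero Plane 2 (volume.restrict D)] with x hx
      rw [hx]; simp
    change ∫ x in D, ((0 : L2 D) : Plane → ℝ) x * partialDeriv i φ x
      = - ∫ x in D, (((0 : L2Vec D) : Plane → Plane) x) i * φ x
    rw [integral_congr_ae h1, integral_congr_ae h2]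
    simp
  add_mem' := by
    intro p q hp hq φ hφ i
    have e1 : (fun x => ((p.fst + q.fst : L2 D) : Plane → ℝ) x * partialDeriv i φ x)
        =ᵐ[volume.restrict D] fun x => p.fst x * partialDeriv i φ x
          + q.fst x * partialDeriv i φ x := by
      filter_upwards [Lp.coeFn_add p.fst q.fst] with x hx
      rw [hx]; simp [add_mul]
    have e2 : (fun x => (((p.snd + q.snd : L2Vec D) : Plane → Plane) x) i * φ x)
        =ᵐ[volume.restrict D] fun x => (p.snd x) i * φ x + (q.snd x) i * φ x := by
      filter_upwards [Lp.coeFn_add p.snd q.snd] with x hx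
      rw [hx]; simp [add_mul]
    change ∫ x in D, ((p.fst + q.fst : L2 D) : Plane → ℝ) x * partialDeriv i φ x
      = - ∫ x in D, (((p.snd + q.snd : L2Vec D) : Plane → Plane) x) i * φ x
    rw [integral_congr_ae e1, integral_congr_ae e2, integral_add, integral_add,
      hp φ hφ i, hq φ hφ i, neg_add]
    · exact (memLp_coord p.snd i).integrable_mul hφ.memLp
    · exact (memLp_coord q.snd i).integrable_mul hφ.memLp
    · exact (Lp.memLp p.fst).integrable_mul (hφ.memLp_partialDeriv i)
    · exact (Lp.memLp q.fst).integrable_mul (hφ.memLp_partialDeriv i)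
  smul_mem' := by
    intro c p hp φ hφ i
    have e1 : (fun x => ((c • p.fst : L2 D) : Plane → ℝ) x * partialDeriv i φ x)
        =ᵐ[volume.restrict D] fun x => c * (p.fst x * partialDeriv i φ x) := by
      filter_upwards [Lp.coeFn_smul c p.fst] with x hx
      rw [hx]; simp [mul_assoc]
    have e2 : (fun x => (((c • p.snd : L2Vec D) : Plane → Plane) x) i * φ x)
        =ᵐ[volume.restrict D] fun x => c * ((p.snd x) i * φ x) := by
      filter_upwards [Lp.coeFn_smul c p.snd] with x hx
      rw [hx]; simp [mul_assoc]
    change ∫ x in D, ((c • p.fst : L2 D) : Plane → ℝ) x * partialDeriv i φ x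
      = - ∫ x in D, (((c • p.snd : L2Vec D) : Plane → Plane) x) i * φ x
    rw [integral_congr_ae e1, integral_congr_ae e2, integral_const_mul, integral_const_mul,
      hp φ hφ i, mul_neg]

/-- The Sobolev space `H¹(D)` as a type. -/
abbrev H1 (D : Set Plane) : Type := ↥(H1Submodule D)

/-- The function underlying an element of `H¹(D)`. -/
noncomputable def H1.fn {D : Set Plane} (u : H1 D) : L2 D := u.1.fst

/-- The weak gradient of an element of `H¹(D)`. -/
noncomputable def H1.grad {D : Set Plane} (u : H1 D) : L2Vec D := u.1.snd

/-- The mass `∫_D u dx`. -/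
noncomputable def H1.mass {D : Set Plane} (u : H1 D) : ℝ := ∫ x in D, u.fn x

/-- The double-well potential `F(s) = (s² - 1)² / 4`. -/
noncomputable def doubleWell (s : ℝ) : ℝ := (1 / 4) * (s ^ 2 - 1) ^ 2

/-- The nonlinearity `f(s) = F'(s) = s³ - s`. -/
def nonlin (s : ℝ) : ℝ := s ^ 3 - s

/-- The Ginzburg-Landau free energy `∫_D ((ε/2) |∇u|² + (1/ε) F(u)) dx`. -/
noncomputable def energy {D : Set Plane} (ε : ℝ) (u : H1 D) : ℝ :=
  ∫ x in D, (ε / 2 * ‖u.grad x‖ ^ 2 + 1 / ε * doubleWell (u.fn x))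

/-- `n` is an outer unit normal to the convex set `D` at its boundary point `x`. -/
def IsOuterUnitNormal (D : Set Plane) (x n : Plane) : Prop :=
  ‖n‖ = 1 ∧ ∀ y ∈ D, inner ℝ n (y - x) ≤ 0

/-- The spatial noise profile: smooth up to the boundary, with vanishing integral and with
vanishing normal derivative on the boundary. -/
structure IsNoiseProfile (D : Set Plane) (g : Plane → ℝ) : Prop where
  smooth : ContDiffOn ℝ (⊤ : ℕ∞) g (closure D)
  mean_zero : ∫ x in D, g x = 0
  neumann : ∀ x ∈ frontier D, ∀ n : Plane, IsOuterUnitNormal D x n →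
    fderivWithin ℝ g (closure D) x n = 0

/-- `W` is a real-valued Wiener process on the time interval `[0,T]`, relative to the
filtration `𝓕`. -/
structure IsWienerProcess {Ω : Type u} {mΩ : MeasurableSpace Ω} (T : ℝ) (𝓕 : Filtration ℝ mΩ)
    (P : Measure Ω) (W : ℝ → Ω → ℝ) : Prop where
  adapted : ∀ t ∈ Set.Icc 0 T, Measurable[𝓕 t] (W t)
  start : ∀ᵐ ω ∂P, W 0 ω = 0
  gaussian : ∀ s t : ℝ, 0 ≤ s → s ≤ t → t ≤ T →
    P.map (fun ω => W t ω - W s ω) = gaussianReal 0 (t - s).toNNReal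
  indep : ∀ s t : ℝ, 0 ≤ s → s ≤ t → t ≤ T →
    Indep (MeasurableSpace.comap (fun ω => W t ω - W s ω) (borel ℝ)) (𝓕 s) P
  cont : ∀ᵐ ω ∂P, ContinuousOn (fun t => W t ω) (Set.Icc 0 T)

/-- The equations of the implicit Euler scheme along one path: `k` is the step size, `J` the
number of steps, `s` the noise strength, `ΔW j` the increment driving the step from `X j` to
`X (j+1)`. Only `X 0, …, X J` and `w 1, …, w J` occur. -/
def SolvesSchemeAlong {D : Set Plane} (g : Plane → ℝ) (s ε k : ℝ) (J : ℕ) (u₀ : H1 D)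
    (ΔW : ℕ → ℝ) (X w : ℕ → H1 D) : Prop :=
  X 0 = u₀ ∧ ∀ j < J,
    (∀ φ : H1 D,
      (∫ x in D, ((X (j + 1)).fn x - (X j).fn x) * φ.fn x)
        + k * (∫ x in D, inner ℝ ((w (j + 1)).grad x) (φ.grad x))
        = s * (∫ x in D, g x * φ.fn x) * ΔW j) ∧
    (∀ ψ : H1 D,
      ε * (∫ x in D, inner ℝ ((X (j + 1)).grad x) (ψ.grad x))
        + 1 / ε * (∫ x in D, nonlin ((X (j + 1)).fn x) * ψ.fn x)
        = ∫ x in D, (w (j + 1)).fn x * ψ.fn x)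

/-- The increment of the path `t ↦ W t ω` over the step from `t_j` to `t_{j+1}` of the
equidistant grid `t_j = j k`. -/
def increment {Ω : Type u} (W : ℝ → Ω → ℝ) (k : ℝ) (ω : Ω) (j : ℕ) : ℝ :=
  W (((j + 1 : ℕ) : ℝ) * k) ω - W ((j : ℝ) * k) ω

/-- `(X^j, w^j)`, `1 ≤ j ≤ J`, are `[H¹(D)]²`-valued random variables which solve the scheme
almost surely, with step size `k = T / J` and initial value `X⁰ = u₀`. -/
structure IsSchemeSolution {Ω : Type u} [MeasurableSpace Ω] (P : Measure Ω) {D : Set Plane}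
    (g : Plane → ℝ) (T γ ε : ℝ) (J : ℕ) (u₀ : H1 D) (W : ℝ → Ω → ℝ)
    (X w : ℕ → Ω → H1 D) : Prop where
  measurable_X : ∀ j ∈ Finset.Icc 1 J, @Measurable Ω (H1 D) _ (borel (H1 D)) (X j)
  measurable_w : ∀ j ∈ Finset.Icc 1 J, @Measurable Ω (H1 D) _ (borel (H1 D)) (w j)
  solves : ∀ᵐ ω ∂P, SolvesSchemeAlong g (ε ^ γ) ε (T / J) J u₀ (increment W (T / J) ω)
    (fun j => X j ω) (fun j => w j ω)

end StochCH

namespace StochCH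

open scoped ENNReal NNReal Topology
open Filter

/-! ### The Gagliardo inequality on plane convex sets -/

/-! One step of the scheme is a deterministic implicit step started from the shifted value `X j + (ε
^ γ * ΔW j) • g`, so the shift by the noise and the implicit step can be estimated separately.

The implicit step does not increase the energy (`EmbedsL4.energy_step_le`): `F(s) + s²/2` is convex,
and `k ≤ ε³` lets the concave defect be absorbed by the dissipation while `k/2 ‖∇w‖²` survives. The
shift moves along a fixed direction, in which the energy is a polynomial of degree four, so its
Taylor expansion is exact. The integrands in its coefficients are dominated by `1 + F`, and `ε ^ γ ≤
ε` cancels the factor `1/ε`; hence all orders are bounded by a multiple of `energy + 1`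
(`EmbedsL4.energy_noise_le`). The first-order term is kept exactly, since it is an adapted quantity
times an independent centred increment.

Together, `Y = energy + 1` satisfies `Y (j+1) + k/2 ‖∇w‖² ≤ Y j * (1 + μ Δ + C (Δ² + Δ⁴))` with `μ`
adapted and bounded and `C` free of `ε`. This is `GaussianGrowth`; what remains is probability with
constants depending on `C`, `T`, `p` only. A `p`-th power of the growth factor is `1 + p μ Δ` plus a
remainder of mean `O(k)`, so a discrete Gronwall argument bounds moments. Doob's inequality for the
martingale of first-order terms, fed with moments of order `2p`, bounds maxima. Telescoping bounds
the dissipation.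

Two analytic facts support this. The energy is finite and continuous on `H¹` because `H¹(D)` embeds
in `L⁴(D)`; this is Gagliardo's argument on convex sets, transferred to weak gradients by mollifying
on inner parallel sets. The independence of `X j` and the next increment needs adaptedness, while
the iterates are only assumed measurable. It follows because the implicit step has at most one
solution, depending locally Lipschitz continuously on the data, hence given by a Borel map
(`EmbedsL4.exists_measurable_solutionMap`). -/

theorem sq_le_integral_of_contDiff {v : ℝ → ℝ} (hv : ContDiff ℝ 1 v) :
    v 0 ^ 2 ≤ ∫ τ in (0 : ℝ)..1, (v τ ^ 2 + 2 * |v τ * deriv v τ|) := by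
  have hd : Continuous (deriv v) := hv.continuous_deriv le_rfl
  have hc : Continuous v := hv.continuous
  have h1 : Continuous fun τ => 2 * |v τ * deriv v τ| := by fun_prop
  have h2 : Continuous fun τ => v τ ^ 2 := by fun_prop
  -- The fundamental theorem of calculus for `v²` between `0` and `τ`; averaging over `τ` in the
  -- unit interval then removes the endpoint value.
  have key : ∀ τ ∈ Set.Icc (0 : ℝ) 1,
      v 0 ^ 2 ≤ v τ ^ 2 + ∫ σ in (0 : ℝ)..1, 2 * |v σ * deriv v σ| := by
    intro τ hτ
    have hftc : ∫ σ in (0 : ℝ)..τ, 2 * v σ * deriv v σ = v τ ^ 2 - v 0 ^ 2 := by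
      apply intervalIntegral.integral_eq_sub_of_hasDerivAt
      · intro x _
        have := ((hv.differentiable (by simp)) x).hasDerivAt.fun_pow 2
        simpa using this
      · exact (by fun_prop : Continuous fun σ => 2 * v σ * deriv v σ).intervalIntegrable _ _
    have h3 : -(∫ σ in (0 : ℝ)..τ, 2 * v σ * deriv v σ)
        ≤ ∫ σ in (0 : ℝ)..τ, 2 * |v σ * deriv v σ| := by
      rw [← intervalIntegral.integral_neg]
      apply intervalIntegral.integral_mono_on hτ.1
      · exact (by fun_prop : Continuous fun σ => -(2 * v σ * deriv v σ)).intervalIntegrable _ _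
      · exact h1.intervalIntegrable _ _
      · intro x _
        have := neg_abs_le (v x * deriv v x)
        nlinarith
    have h4 : ∫ σ in (0 : ℝ)..τ, 2 * |v σ * deriv v σ|
        ≤ ∫ σ in (0 : ℝ)..1, 2 * |v σ * deriv v σ| := by
      apply intervalIntegral.integral_mono_interval le_rfl hτ.1 hτ.2
      · exact Filter.Eventually.of_forall fun x => by positivity
      · exact h1.intervalIntegrable _ _
    linarith
  have hI := intervalIntegral.integral_mono_on (μ := volume) (a := (0 : ℝ)) (b := 1) zero_le_one
    (f := fun _ => v 0 ^ 2)
    (g := fun τ => v τ ^ 2 + ∫ σ in (0 : ℝ)..1, 2 * |v σ * deriv v σ|)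
    (continuous_const.intervalIntegrable _ _)
    ((h2.add continuous_const).intervalIntegrable _ _) key
  rw [intervalIntegral.integral_add (h2.intervalIntegrable _ _) (by simp)] at hI
  rw [intervalIntegral.integral_add (h2.intervalIntegrable _ _) (h1.intervalIntegrable _ _)]
  simpa using hI

/-- The one-dimensional estimate on the segment from `x` to `x + e`. The directional derivative
costs a factor `‖e‖`, and Young's inequality splits the product of `v` and its gradient. -/
theorem ofReal_sq_le_lintegral_segment {v : Plane → ℝ} (hv : ContDiff ℝ 1 v) (x e : Plane) :
    ENNReal.ofReal (v x ^ 2) ≤ ENNReal.ofReal (1 + ‖e‖) *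
      ∫⁻ τ in Set.Icc (0 : ℝ) 1, ENNReal.ofReal (v (x + τ • e) ^ 2 + ‖fderiv ℝ v (x + τ • e)‖ ^ 2) := by
  have hline : ContDiff ℝ 1 fun τ : ℝ => x + τ • e := by fun_prop
  have hcv : Continuous v := hv.continuous
  have hcd : Continuous (fderiv ℝ v) := hv.continuous_fderiv (by simp)
  have hder : ∀ τ : ℝ, deriv (fun τ : ℝ => v (x + τ • e)) τ = fderiv ℝ v (x + τ • e) e := by
    intro τ
    have h1 : HasDerivAt (fun τ : ℝ => x + τ • e) e τ := by
      simpa using ((hasDerivAt_id τ).smul_const e).const_add x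
    exact (((hv.differentiable (by simp)) _).hasFDerivAt.comp_hasDerivAt τ h1).deriv
  have h := sq_le_integral_of_contDiff (hv.comp hline)
  simp only [Function.comp_def, zero_smul, add_zero, hder] at h
  have hcont : Continuous fun τ : ℝ => v (x + τ • e) ^ 2 + ‖fderiv ℝ v (x + τ • e)‖ ^ 2 := by
    fun_prop
  have h' : ∫ τ in (0 : ℝ)..1, (v (x + τ • e) ^ 2 + 2 * |v (x + τ • e) * fderiv ℝ v (x + τ • e) e|)
      ≤ ∫ τ in (0 : ℝ)..1, (1 + ‖e‖) * (v (x + τ • e) ^ 2 + ‖fderiv ℝ v (x + τ • e)‖ ^ 2) := by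
    apply intervalIntegral.integral_mono_on zero_le_one
    · exact (by fun_prop : Continuous fun τ : ℝ => v (x + τ • e) ^ 2
        + 2 * |v (x + τ • e) * fderiv ℝ v (x + τ • e) e|).intervalIntegrable _ _
    · exact (continuous_const.mul hcont).intervalIntegrable _ _
    · intro τ _
      have h1 := (fderiv ℝ v (x + τ • e)).le_opNorm e
      rw [Real.norm_eq_abs] at h1
      rw [abs_mul]
      have h2 : |v (x + τ • e)| * |fderiv ℝ v (x + τ • e) e|
          ≤ |v (x + τ • e)| * (‖fderiv ℝ v (x + τ • e)‖ * ‖e‖) := by gcongr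
      have h3 : 2 * (|v (x + τ • e)| * ‖fderiv ℝ v (x + τ • e)‖)
          ≤ v (x + τ • e) ^ 2 + ‖fderiv ℝ v (x + τ • e)‖ ^ 2 := by
        rw [← sq_abs (v (x + τ • e))]
        nlinarith [sq_nonneg (|v (x + τ • e)| - ‖fderiv ℝ v (x + τ • e)‖)]
      have h4 := mul_le_mul_of_nonneg_right h3 (norm_nonneg e)
      nlinarith [sq_nonneg ‖fderiv ℝ v (x + τ • e)‖]
  refine (ENNReal.ofReal_le_ofReal (h.trans h')).trans ?_
  rw [intervalIntegral.integral_const_mul, ENNReal.ofReal_mul (by positivity),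
    intervalIntegral.integral_of_le zero_le_one, ← integral_Icc_eq_integral_Ioc,
    ofReal_integral_eq_lintegral_ofReal]
  · exact hcont.continuousOn.integrableOn_compact isCompact_Icc
  · exact Filter.Eventually.of_forall fun τ => by positivity

/-- The linear isomorphism `(s, t) ↦ s e₁ + t e₂`. -/
theorem exists_linearEquiv_of_det_ne_zero {e₁ e₂ : Plane}
    (h : e₁ 0 * e₂ 1 - e₁ 1 * e₂ 0 ≠ 0) :
    ∃ L : (ℝ × ℝ) ≃L[ℝ] Plane, ∀ p, L p = p.1 • e₁ + p.2 • e₂ := by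
  let l : (ℝ × ℝ) →ₗ[ℝ] Plane :=
    (LinearMap.toSpanSingleton ℝ Plane e₁).coprod (LinearMap.toSpanSingleton ℝ Plane e₂)
  have hl : ∀ p, l p = p.1 • e₁ + p.2 • e₂ := fun p => by simp [l]
  have hinj : Function.Injective l := by
    rw [injective_iff_map_eq_zero]
    rintro ⟨s, t⟩ hst
    rw [hl] at hst
    have h0 := congrArg (fun z : Plane => z 0) hst
    have h1 := congrArg (fun z : Plane => z 1) hst
    simp at h0 h1
    have hs : s * (e₁ 0 * e₂ 1 - e₁ 1 * e₂ 0) = 0 := by linear_combination e₂ 1 * h0 - e₂ 0 * h1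
    have ht : t * (e₁ 0 * e₂ 1 - e₁ 1 * e₂ 0) = 0 := by linear_combination e₁ 0 * h1 - e₁ 1 * h0
    simp [h] at hs ht
    simp [hs, ht]
  have hfr : Module.finrank ℝ (ℝ × ℝ) = Module.finrank ℝ Plane := by simp
  refine ⟨(LinearEquiv.ofInjectiveOfFinrankEq l hinj hfr).toContinuousLinearEquiv, fun p => ?_⟩
  rw [← hl]
  rfl

/-- Gagliardo's trick: write `v⁴ = v² · v²` and bound the two factors by line integrals in different
directions. In coordinates along `e₁`, `e₂` one bound is independent of the first coordinate and the
other of the second, so the integral of the product factorises. The constant depends on the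
directions only, which later allows `D` to vary. -/
theorem gagliardo_of_two_directions {e₁ e₂ : Plane} (h : e₁ 0 * e₂ 1 - e₁ 1 * e₂ 0 ≠ 0) :
    ∃ C : ℝ≥0, ∀ D U : Set Plane, Convex ℝ D → MeasurableSet D → MeasurableSet U →
      (∀ x ∈ U ∩ D, x + e₁ ∈ D ∧ x + e₂ ∈ D) → ∀ v : Plane → ℝ, ContDiff ℝ 1 v →
      ∫⁻ x in U ∩ D, ENNReal.ofReal (v x ^ 4)
        ≤ C * (∫⁻ x in D, ENNReal.ofReal (v x ^ 2 + ‖fderiv ℝ v x‖ ^ 2)) ^ 2 := by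
  obtain ⟨L, hL⟩ := exists_linearEquiv_of_det_ne_zero h
  -- Uniqueness of Haar measure replaces the Jacobian determinant; one factor is needed for each
  -- direction of the change of variables.
  obtain ⟨c, hc⟩ : ∃ c : ℝ≥0, (volume : Measure Plane)
      = c • (volume : Measure (ℝ × ℝ)).map L := ⟨_, Measure.isAddLeftInvariant_eq_smul _ _⟩
  obtain ⟨c', hc'⟩ : ∃ c : ℝ≥0, (volume : Measure (ℝ × ℝ)).map L
      = c • (volume : Measure Plane) := ⟨_, Measure.isAddLeftInvariant_eq_smul _ _⟩
  refine ⟨c * (Real.toNNReal (1 + ‖e₁‖) * Real.toNNReal (1 + ‖e₂‖)) * c' ^ 2, ?_⟩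
  intro D U hD hDm hUm hU v hv
  have hcv : Continuous v := hv.continuous
  have hcd : Continuous (fderiv ℝ v) := hv.continuous_fderiv (by simp)
  set w : Plane → ℝ≥0∞ := fun x => ENNReal.ofReal (v x ^ 2 + ‖fderiv ℝ v x‖ ^ 2) with hw
  have hwm : Measurable w := by
    apply ENNReal.measurable_ofReal.comp
    exact (by fun_prop : Continuous fun x => v x ^ 2 + ‖fderiv ℝ v x‖ ^ 2).measurable
  set W : Plane → ℝ≥0∞ := D.indicator w with hW
  have hWm : Measurable W := hwm.indicator hDm
  have hLm : Measurable L := L.continuous.measurable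
  have hWL : Measurable fun p : ℝ × ℝ => W (L p) := hWm.comp hLm
  set A : ℝ → ℝ≥0∞ := fun t => ∫⁻ τ, W (L (τ, t)) with hA
  set B : ℝ → ℝ≥0∞ := fun s => ∫⁻ τ, W (L (s, τ)) with hB
  have hAm : Measurable A := hWL.lintegral_prod_left'
  have hBm : Measurable B := hWL.lintegral_prod_right'
  have hAint : ∫⁻ t, A t = ∫⁻ p : ℝ × ℝ, W (L p) := by
    rw [Measure.volume_eq_prod, lintegral_prod_symm' _ hWL]
  have hBint : ∫⁻ s, B s = ∫⁻ p : ℝ × ℝ, W (L p) := by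
    rw [Measure.volume_eq_prod, lintegral_prod _ hWL.aemeasurable]
  have hseg : ∀ x ∈ D, ∀ e : Plane, x + e ∈ D →
      ENNReal.ofReal (v x ^ 2) ≤ ENNReal.ofReal (1 + ‖e‖) * ∫⁻ τ : ℝ, W (x + τ • e) := by
    intro x hx e he
    refine (ofReal_sq_le_lintegral_segment hv x e).trans ?_
    refine mul_le_mul_right ?_ _
    rw [← lintegral_indicator measurableSet_Icc]
    apply lintegral_mono
    intro τ
    by_cases hτ : τ ∈ Set.Icc (0 : ℝ) 1
    · have hmem : x + τ • e ∈ D := by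
        have := hD.add_smul_sub_mem hx he hτ
        simpa using this
      rw [Set.indicator_of_mem hτ]
      exact (Set.indicator_of_mem hmem w).ge
    · rw [Set.indicator_of_notMem hτ]; exact zero_le
  have hpt : ∀ p : ℝ × ℝ, (U ∩ D).indicator (fun x => ENNReal.ofReal (v x ^ 4)) (L p)
      ≤ (ENNReal.ofReal (1 + ‖e₁‖) * ENNReal.ofReal (1 + ‖e₂‖)) * (B p.1 * A p.2) := by
    rintro ⟨s, t⟩
    by_cases hx : L (s, t) ∈ U ∩ D
    · rw [Set.indicator_of_mem hx]
      have h1 := hseg _ hx.2 e₁ (hU _ hx).1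
      have h2 := hseg _ hx.2 e₂ (hU _ hx).2
      -- Extending the segment integral to the full line makes it translation invariant, so it no
      -- longer depends on `s`.
      have e1 : ∫⁻ τ : ℝ, W (L (s, t) + τ • e₁) = A t := by
        change _ = ∫⁻ τ, W (L (τ, t))
        rw [← lintegral_add_left_eq_self (fun τ => W (L (τ, t))) s]
        congr 1; ext τ; congr 1; simp only [hL]; rw [add_smul]; abel
      have e2 : ∫⁻ τ : ℝ, W (L (s, t) + τ • e₂) = B s := by
        change _ = ∫⁻ τ, W (L (s, τ))
        rw [← lintegral_add_left_eq_self (fun τ => W (L (s, τ))) t]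
        congr 1; ext τ; congr 1; simp only [hL]; rw [add_smul]; abel
      rw [e1] at h1
      rw [e2] at h2
      have e4 : v (L (s, t)) ^ 4 = v (L (s, t)) ^ 2 * v (L (s, t)) ^ 2 := by ring
      rw [e4, ENNReal.ofReal_mul (sq_nonneg _)]
      refine (mul_le_mul' h1 h2).trans (le_of_eq ?_)
      ring
    · rw [Set.indicator_of_notMem hx]; exact zero_le
  have hvm : Measurable fun x => ENNReal.ofReal (v x ^ 4) :=
    ENNReal.measurable_ofReal.comp (by fun_prop : Continuous fun x => v x ^ 4).measurable
  have hint : ∫⁻ p : ℝ × ℝ, W (L p) = c' * ∫⁻ x in D, w x := by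
    rw [← lintegral_map hWm hLm, hc', lintegral_smul_measure, hW, lintegral_indicator hDm]
    rfl
  calc ∫⁻ x in U ∩ D, ENNReal.ofReal (v x ^ 4)
      = ∫⁻ x, (U ∩ D).indicator (fun x => ENNReal.ofReal (v x ^ 4)) x :=
        (lintegral_indicator (hUm.inter hDm) _).symm
    _ = c * ∫⁻ p : ℝ × ℝ, (U ∩ D).indicator (fun x => ENNReal.ofReal (v x ^ 4)) (L p) := by
        conv_lhs => rw [hc]
        rw [lintegral_smul_measure, lintegral_map (hvm.indicator (hUm.inter hDm)) hLm]
        rfl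
    _ ≤ c * ∫⁻ p : ℝ × ℝ, (ENNReal.ofReal (1 + ‖e₁‖) * ENNReal.ofReal (1 + ‖e₂‖))
          * (B p.1 * A p.2) := by gcongr; exact hpt _
    _ = c * ((ENNReal.ofReal (1 + ‖e₁‖) * ENNReal.ofReal (1 + ‖e₂‖))
          * ((c' * ∫⁻ x in D, w x) * (c' * ∫⁻ x in D, w x))) := by
        rw [lintegral_const_mul _ (by fun_prop : Measurable fun p : ℝ × ℝ => B p.1 * A p.2),
          Measure.volume_eq_prod, lintegral_prod_mul hBm.aemeasurable hAm.aemeasurable,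
          hAint, hBint, hint]
    _ = _ := by
        push_cast
        simp only [ENNReal.ofReal]
        ring

/-- Perturb `x₀ - y` by `σ` times each basis vector. With `d = x₀ - y` the determinant is `σ (d 0 +
d 1) + σ²`, so it suffices to choose the sign of `σ` that makes the first summand nonnegative. -/
theorem exists_independent_directions (y x₀ : Plane) {η : ℝ} (hη : 0 < η) :
    ∃ e₁ e₂ : Plane, e₁ 0 * e₂ 1 - e₁ 1 * e₂ 0 ≠ 0 ∧ ‖y + e₁ - x₀‖ ≤ η ∧ ‖y + e₂ - x₀‖ ≤ η := by
  obtain ⟨σ, hσ, hσa⟩ : ∃ σ : ℝ, |σ| = η ∧ 0 ≤ σ * ((x₀ - y) 0 + (x₀ - y) 1) := by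
    rcases le_total 0 ((x₀ - y) 0 + (x₀ - y) 1) with h | h
    · exact ⟨η, abs_of_pos hη, by positivity⟩
    · exact ⟨-η, by simp [abs_of_pos hη], by nlinarith⟩
  have hσ2 : 0 < σ * σ := by rw [← abs_mul_abs_self, hσ]; positivity
  refine ⟨x₀ - y + EuclideanSpace.single 0 σ, x₀ - y + EuclideanSpace.single 1 σ, ?_, ?_, ?_⟩
  · simp at hσa ⊢
    nlinarith
  · have : y + (x₀ - y + EuclideanSpace.single 0 σ) - x₀ = EuclideanSpace.single (0 : Fin 2) σ := by
      abel
    rw [this]; simp [hσ]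
  · have : y + (x₀ - y + EuclideanSpace.single 1 σ) - x₀ = EuclideanSpace.single (1 : Fin 2) σ := by
      abel
    rw [this]; simp [hσ]

/-- Both translations move the half-radius ball around `y` into the ball around `x₀`, which lies in
`D`; convexity then keeps the connecting segments in `D`. -/
theorem gagliardo_near_point (y x₀ : Plane) {r : ℝ} (hr : 0 < r) :
    ∃ C : ℝ≥0, ∀ D : Set Plane, Convex ℝ D → MeasurableSet D → Metric.ball x₀ r ⊆ D →
      ∀ v : Plane → ℝ, ContDiff ℝ 1 v →
      ∫⁻ x in Metric.ball y (r / 2) ∩ D, ENNReal.ofReal (v x ^ 4)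
        ≤ C * (∫⁻ x in D, ENNReal.ofReal (v x ^ 2 + ‖fderiv ℝ v x‖ ^ 2)) ^ 2 := by
  obtain ⟨e₁, e₂, hdet, h1, h2⟩ := exists_independent_directions y x₀ (η := r / 2) (by positivity)
  obtain ⟨C, hC⟩ := gagliardo_of_two_directions hdet
  refine ⟨C, fun D hD hDm hball v hv => hC D _ hD hDm Metric.isOpen_ball.measurableSet ?_ v hv⟩
  have aux : ∀ x ∈ Metric.ball y (r / 2), ∀ e : Plane, ‖y + e - x₀‖ ≤ r / 2 → x + e ∈ D := by
    intro x hx e he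
    apply hball
    rw [mem_ball_iff_norm] at hx ⊢
    have : x + e - x₀ = (x - y) + (y + e - x₀) := by abel
    rw [this]
    linarith [norm_add_le (x - y) (y + e - x₀)]
  exact fun x hx => ⟨aux x hx.1 e₁ h1, aux x hx.1 e₂ h2⟩

/-- Finitely many of the local estimates cover the compact closure of `B`. The constant is uniform
over all convex `D` squeezed between the ball and `B`, as the exhaustion by inner parallel sets
requires. -/
theorem gagliardo_convex {B : Set Plane} (hB : Bornology.IsBounded B) (x₀ : Plane) {r : ℝ}
    (hr : 0 < r) :
    ∃ C : ℝ≥0, ∀ D ⊆ B, Convex ℝ D → MeasurableSet D → Metric.ball x₀ r ⊆ D →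
      ∀ v : Plane → ℝ, ContDiff ℝ 1 v →
      ∫⁻ x in D, ENNReal.ofReal (v x ^ 4)
        ≤ C * (∫⁻ x in D, ENNReal.ofReal (v x ^ 2 + ‖fderiv ℝ v x‖ ^ 2)) ^ 2 := by
  have hcomp : IsCompact (closure B) := hB.isCompact_closure
  obtain ⟨t, -, ht⟩ := hcomp.elim_nhds_subcover (fun y => Metric.ball y (r / 2))
    fun y _ => Metric.ball_mem_nhds y (by positivity)
  choose C hC using fun y => gagliardo_near_point y x₀ hr
  refine ⟨∑ y ∈ t, C y, fun D hDB hD hDm hball v hv => ?_⟩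
  have hcov : D ⊆ ⋃ y ∈ t, (Metric.ball y (r / 2) ∩ D) := by
    intro x hx
    obtain ⟨y, hy, hxy⟩ := Set.mem_iUnion₂.1 (ht (subset_closure (hDB hx)))
    exact Set.mem_iUnion₂.2 ⟨y, hy, hxy, hx⟩
  calc ∫⁻ x in D, ENNReal.ofReal (v x ^ 4)
      ≤ ∫⁻ x in ⋃ y ∈ t, (Metric.ball y (r / 2) ∩ D), ENNReal.ofReal (v x ^ 4) :=
        lintegral_mono_set hcov
    _ ≤ ∑ y ∈ t, ∫⁻ x in Metric.ball y (r / 2) ∩ D, ENNReal.ofReal (v x ^ 4) := by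
        have hrw : (⋃ y ∈ t, (Metric.ball y (r / 2) ∩ D))
            = ⋃ y : t, (Metric.ball (y : Plane) (r / 2) ∩ D) :=
          Set.biUnion_eq_iUnion (t : Set Plane) fun y _ => Metric.ball y (r / 2) ∩ D
        rw [hrw]
        refine (lintegral_iUnion_le _ _).trans (le_of_eq ?_)
        rw [tsum_fintype]
        exact Finset.sum_coe_sort t fun y =>
          ∫⁻ x in Metric.ball y (r / 2) ∩ D, ENNReal.ofReal (v x ^ 4)
    _ ≤ ∑ y ∈ t, C y * (∫⁻ x in D, ENNReal.ofReal (v x ^ 2 + ‖fderiv ℝ v x‖ ^ 2)) ^ 2 :=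
        Finset.sum_le_sum fun y _ => hC y D hD hDm hball v hv
    _ = _ := by rw [← Finset.sum_mul]; push_cast; rfl

/-! ### The embedding of `H¹(D)` into `L⁴(D)` on convex domains -/

theorem IsConvexPolygonalDomain.isOpen {D : Set Plane} (hD : IsConvexPolygonalDomain D) :
    IsOpen D := by
  obtain ⟨-, V, -, rfl⟩ := hD
  exact isOpen_interior

theorem IsConvexPolygonalDomain.convex {D : Set Plane} (hD : IsConvexPolygonalDomain D) :
    Convex ℝ D := by
  obtain ⟨-, V, -, rfl⟩ := hD
  exact (convex_convexHull ℝ V).interior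

theorem IsConvexPolygonalDomain.isBounded {D : Set Plane} (hD : IsConvexPolygonalDomain D) :
    Bornology.IsBounded D := by
  obtain ⟨-, V, hV, rfl⟩ := hD
  exact (isBounded_convexHull.2 hV.isBounded).subset interior_subset

/-- The inner parallel set of points whose `δ`-ball is contained in `D`. -/
def innerParallel (D : Set Plane) (δ : ℝ) : Set Plane := {x | Metric.ball x δ ⊆ D}

theorem innerParallel_subset (D : Set Plane) {δ : ℝ} (hδ : 0 < δ) : innerParallel D δ ⊆ D :=
  fun _ hx => hx (Metric.mem_ball_self hδ)

theorem innerParallel_antitone (D : Set Plane) : Antitone (innerParallel D) :=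
  fun _ _ h _ hx => (Metric.ball_subset_ball h).trans hx

theorem isClosed_innerParallel (D : Set Plane) (δ : ℝ) : IsClosed (innerParallel D δ) := by
  have : innerParallel D δ = ⋂ y ∈ Dᶜ, {x | δ ≤ dist y x} := by
    ext x
    simp only [innerParallel, Set.mem_ofPred_eq, Set.mem_iInter, Set.subset_def, Metric.mem_ball]
    refine forall_congr' fun y => ?_
    rw [Set.mem_compl_iff, ← not_imp_not, not_lt]
  rw [this]
  exact isClosed_biInter fun y _ => isClosed_le continuous_const (by fun_prop)

theorem convex_innerParallel {D : Set Plane} (hD : Convex ℝ D) (δ : ℝ) :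
    Convex ℝ (innerParallel D δ) := by
  intro x hx y hy a b ha hb hab z hz
  rw [mem_ball_iff_norm] at hz
  have h1 : x + (z - (a • x + b • y)) ∈ D := hx (by simpa [mem_ball_iff_norm] using hz)
  have h2 : y + (z - (a • x + b • y)) ∈ D := hy (by simpa [mem_ball_iff_norm] using hz)
  have h3 := hD h1 h2 ha hb hab
  have h4 : a • (x + (z - (a • x + b • y))) + b • (y + (z - (a • x + b • y)))
      = a • x + b • y + (a + b) • (z - (a • x + b • y)) := by module
  rw [h4, hab] at h3
  simpa using h3

theorem ball_subset_innerParallel {D : Set Plane} {x₀ : Plane} {r δ : ℝ}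
    (h : Metric.ball x₀ r ⊆ D) : Metric.ball x₀ (r - δ) ⊆ innerParallel D δ := by
  intro x hx
  refine (Metric.ball_subset_ball' ?_).trans h
  rw [Metric.mem_ball] at hx
  linarith

theorem iUnion_innerParallel {D : Set Plane} (hD : IsOpen D) :
    ⋃ n : ℕ, innerParallel D (1 / ((n : ℝ) + 1)) = D := by
  apply Set.Subset.antisymm
  · exact Set.iUnion_subset fun n => innerParallel_subset D (by positivity)
  · intro x hx
    obtain ⟨r, hr, hxr⟩ := Metric.isOpen_iff.1 hD x hx
    obtain ⟨n, hn⟩ := exists_nat_one_div_lt hr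
    exact Set.mem_iUnion.2 ⟨n, (Metric.ball_subset_ball hn.le).trans hxr⟩

/-! ### Mollification and the weak gradient -/

/-- Mollification of `f` by the normalised bump function `η`. -/
noncomputable def mollify (η : ContDiffBump (0 : Plane)) (f : Plane → ℝ) (x : Plane) : ℝ :=
  ∫ y, η.normed volume (x - y) * f y

theorem mollify_eq_convolution (η : ContDiffBump (0 : Plane)) (f : Plane → ℝ) :
    mollify η f = convolution f (η.normed volume) (ContinuousLinearMap.lsmul ℝ ℝ) volume := by
  ext x
  simp only [mollify, convolution_def, ContinuousLinearMap.lsmul_apply, smul_eq_mul]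
  exact integral_congr_ae (Eventually.of_forall fun y => mul_comm _ _)

theorem mollify_eq_convolution_swap (η : ContDiffBump (0 : Plane)) (f : Plane → ℝ) :
    mollify η f = convolution (η.normed volume) f (ContinuousLinearMap.lsmul ℝ ℝ) volume := by
  ext x
  simp only [mollify, convolution_eq_swap, ContinuousLinearMap.lsmul_apply, smul_eq_mul]

theorem contDiff_mollify (η : ContDiffBump (0 : Plane)) {f : Plane → ℝ}
    (hf : LocallyIntegrable f) : ContDiff ℝ 1 (mollify η f) := by
  rw [mollify_eq_convolution]
  exact η.hasCompactSupport_normed.contDiff_convolution_right (n := 1) _ hf η.contDiff_normed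

theorem fderiv_mollify (η : ContDiffBump (0 : Plane)) {f : Plane → ℝ}
    (hf : LocallyIntegrable f) (x e : Plane) :
    fderiv ℝ (mollify η f) x e = ∫ y, f y * fderiv ℝ (η.normed volume) (x - y) e := by
  have hs : HasCompactSupport (η.normed (volume : Measure Plane)) := η.hasCompactSupport_normed
  have hc : ContDiff ℝ 1 (η.normed (volume : Measure Plane)) := η.contDiff_normed
  have h := hs.hasFDerivAt_convolution_right (ContinuousLinearMap.lsmul ℝ ℝ) hf hc x
  rw [mollify_eq_convolution, h.fderiv,
    convolution_precompR_apply _ hf (hs.fderiv ℝ) (hc.continuous_fderiv one_ne_zero)]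
  simp [convolution_def]

theorem integrable_normed_mul (η : ContDiffBump (0 : Plane)) {f : Plane → ℝ}
    (hf : Integrable f) (x : Plane) : Integrable fun y => η.normed volume (x - y) * f y := by
  obtain ⟨K, hK⟩ := η.hasCompactSupport_normed.exists_bound_of_continuous
    (f := η.normed (volume : Measure Plane)) η.continuous_normed
  exact hf.bdd_mul ((η.continuous_normed.comp (by fun_prop)).aestronglyMeasurable)
    (Eventually.of_forall fun y => hK (x - y))

theorem integral_normed_sub (η : ContDiffBump (0 : Plane)) (x : Plane) :
    ∫ y, η.normed volume (x - y) = 1 := by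
  rw [integral_sub_left_eq_self (fun y => η.normed volume y) volume x]
  exact η.integral_normed

/-- Jensen's inequality in variance form: the `η`-weighted mean of `(f - m)²` is nonnegative, where
`m` is the weighted mean of `f`. -/
theorem sq_mollify_le (η : ContDiffBump (0 : Plane)) {f : Plane → ℝ} (hf : Integrable f)
    (hf2 : Integrable fun x => f x ^ 2) (x : Plane) :
    mollify η f x ^ 2 ≤ ∫ y, η.normed volume (x - y) * f y ^ 2 := by
  set m := mollify η f x with hm
  have hη : Integrable fun y => η.normed volume (x - y) := by
    by_contra h
    have := integral_normed_sub η x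
    rw [integral_undef h] at this
    exact zero_ne_one this
  have h0 : 0 ≤ ∫ y, (η.normed volume (x - y) * f y ^ 2 - 2 * m * (η.normed volume (x - y) * f y)
      + m ^ 2 * η.normed volume (x - y)) := by
    apply integral_nonneg
    intro y
    have := η.nonneg_normed (μ := volume) (x - y)
    have h2 : η.normed volume (x - y) * f y ^ 2 - 2 * m * (η.normed volume (x - y) * f y)
      + m ^ 2 * η.normed volume (x - y) = η.normed volume (x - y) * (f y - m) ^ 2 := by ring
    change 0 ≤ η.normed volume (x - y) * f y ^ 2 - 2 * m * (η.normed volume (x - y) * f y)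
      + m ^ 2 * η.normed volume (x - y)
    rw [h2]; positivity
  rw [integral_add, integral_sub, integral_const_mul, integral_const_mul,
    integral_normed_sub] at h0
  · have : ∫ y, η.normed volume (x - y) * f y = m := rfl
    rw [this] at h0
    nlinarith
  · exact integrable_normed_mul η hf2 x
  · exact (integrable_normed_mul η hf x).const_mul _
  · exact (integrable_normed_mul η hf2 x).sub ((integrable_normed_mul η hf x).const_mul _)
  · exact hη.const_mul _

theorem lintegral_sq_mollify_le (η : ContDiffBump (0 : Plane)) {f : Plane → ℝ}
    (hfm : Measurable f) (hf : Integrable f) (hf2 : Integrable fun x => f x ^ 2) :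
    ∫⁻ x, ENNReal.ofReal (mollify η f x ^ 2) ≤ ∫⁻ x, ENNReal.ofReal (f x ^ 2) := by
  have hηm : Measurable (η.normed (volume : Measure Plane)) := η.continuous_normed.measurable
  have hnn : ∀ x y : Plane, 0 ≤ η.normed volume (x - y) * f y ^ 2 := fun x y =>
    mul_nonneg (η.nonneg_normed _) (sq_nonneg _)
  calc ∫⁻ x, ENNReal.ofReal (mollify η f x ^ 2)
      ≤ ∫⁻ x, ∫⁻ y, ENNReal.ofReal (η.normed volume (x - y) * f y ^ 2) := by
        apply lintegral_mono
        intro x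
        refine (ENNReal.ofReal_le_ofReal (sq_mollify_le η hf hf2 x)).trans (le_of_eq ?_)
        exact ofReal_integral_eq_lintegral_ofReal (integrable_normed_mul η hf2 x)
          (Eventually.of_forall fun y => hnn x y)
    _ = ∫⁻ y, ∫⁻ x, ENNReal.ofReal (η.normed volume (x - y) * f y ^ 2) := by
        apply lintegral_lintegral_swap
        apply Measurable.aemeasurable
        apply ENNReal.measurable_ofReal.comp
        exact (hηm.comp (measurable_fst.sub measurable_snd)).mul
          ((hfm.comp measurable_snd).pow_const 2)
    _ = ∫⁻ y, ENNReal.ofReal (f y ^ 2) := by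
        congr 1
        ext y
        have : ∀ x, ENNReal.ofReal (η.normed volume (x - y) * f y ^ 2)
            = ENNReal.ofReal (η.normed volume (x - y)) * ENNReal.ofReal (f y ^ 2) := fun x =>
          ENNReal.ofReal_mul (η.nonneg_normed _)
        simp only [this]
        rw [lintegral_mul_const _ (by fun_prop),
          lintegral_sub_right_eq_self (fun x => ENNReal.ofReal (η.normed volume x)) y,
          ← ofReal_integral_eq_lintegral_ofReal η.integrable_normed
            (Eventually.of_forall fun z => η.nonneg_normed z), η.integral_normed]
        simp

theorem sq_norm_le_of_coords (l : Plane →L[ℝ] ℝ) :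
    ‖l‖ ^ 2 ≤ l (EuclideanSpace.single 0 1) ^ 2 + l (EuclideanSpace.single 1 1) ^ 2 := by
  have h : ‖l‖ ≤ √(l (EuclideanSpace.single 0 1) ^ 2 + l (EuclideanSpace.single 1 1) ^ 2) := by
    apply l.opNorm_le_bound (Real.sqrt_nonneg _)
    intro z
    have hz : z = z 0 • EuclideanSpace.single (0 : Fin 2) (1 : ℝ)
        + z 1 • EuclideanSpace.single (1 : Fin 2) (1 : ℝ) := by
      ext i; fin_cases i <;> simp
    conv_lhs => rw [hz]
    rw [map_add, map_smul, map_smul, EuclideanSpace.norm_eq, ← Real.sqrt_mul (by positivity),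
      Real.norm_eq_abs]
    apply Real.abs_le_sqrt
    simp only [smul_eq_mul, Fin.sum_univ_two, Real.norm_eq_abs, sq_abs]
    nlinarith [sq_nonneg (z 0 * l (EuclideanSpace.single 1 1) - z 1 * l (EuclideanSpace.single 0 1))]
  calc ‖l‖ ^ 2 ≤ _ := pow_le_pow_left₀ (norm_nonneg _) h 2
    _ = _ := Real.sq_sqrt (by positivity)

/-- Mollification commutes with the weak gradient at distance from the boundary. -/
theorem fderiv_mollify_eq {D : Set Plane} (hDm : MeasurableSet D) {u : L2 D} {v : L2Vec D}
    (huv : IsWeakGradient D u v) (hu : LocallyIntegrable (D.indicator u))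
    (η : ContDiffBump (0 : Plane)) {δ : ℝ} (hη : η.rOut < δ) {x : Plane}
    (hx : x ∈ innerParallel D δ) (i : Fin 2) :
    fderiv ℝ (mollify η (D.indicator u)) x (EuclideanSpace.single i 1)
      = mollify η (D.indicator fun y => v y i) x := by
  have hs : HasCompactSupport (η.normed (volume : Measure Plane)) := η.hasCompactSupport_normed
  set φ : Plane → ℝ := fun y => η.normed volume (x - y) with hφ
  have hsupp : Function.support φ ⊆ Metric.closedBall x η.rOut := by
    intro y hy
    have : x - y ∈ Function.support (η.normed (volume : Measure Plane)) := hy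
    rw [η.support_normed_eq] at this
    rw [Metric.mem_closedBall, dist_comm, dist_eq_norm]
    simpa using (mem_ball_zero_iff.1 this).le
  have hts : tsupport φ ⊆ Metric.closedBall x η.rOut :=
    closure_minimal hsupp Metric.isClosed_closedBall
  have htest : IsTestFunction D φ :=
    { smooth := η.contDiff_normed.comp (by fun_prop)
      compact := HasCompactSupport.intro (isCompact_closedBall x η.rOut) fun y hy => by
        by_contra h; exact hy (hsupp h)
      supp := hts.trans ((Metric.closedBall_subset_ball hη).trans hx) }
  have hpd : ∀ y, partialDeriv i φ y
      = - fderiv ℝ (η.normed volume) (x - y) (EuclideanSpace.single i 1) := by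
    intro y
    have hd : DifferentiableAt ℝ (η.normed (volume : Measure Plane)) (x - y) :=
      (η.contDiff_normed (n := 1)).differentiable (by simp) _
    have h1 : HasFDerivAt (fun y : Plane => x - y) (-ContinuousLinearMap.id ℝ Plane) y := by
      simpa using (hasFDerivAt_id y).const_sub x
    have h2 := (hd.hasFDerivAt.comp y h1).fderiv
    change fderiv ℝ (η.normed volume ∘ fun y => x - y) y _ = _
    rw [h2]; simp
  have h := huv φ htest i
  rw [fderiv_mollify η hu]
  have e1 : ∫ y, D.indicator u y * fderiv ℝ (η.normed volume) (x - y) (EuclideanSpace.single i 1)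
      = - ∫ y in D, u y * partialDeriv i φ y := by
    rw [← integral_indicator hDm, ← integral_neg]
    congr 1; ext y
    by_cases hy : y ∈ D <;> simp [hy, hpd]
  have e2 : mollify η (D.indicator fun y => v y i) x = ∫ y in D, v y i * φ y := by
    rw [← integral_indicator hDm, mollify]
    congr 1; ext y
    by_cases hy : y ∈ D <;> simp [hy, hφ, mul_comm]
  rw [e1, e2, h, neg_neg]

/-- Bump functions shrinking to the origin with bounded ratio of radii. -/
noncomputable def shrinkingBump (n : ℕ) : ContDiffBump (0 : Plane) where
  rIn := 1 / (2 * ((n : ℝ) + 1))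
  rOut := 1 / ((n : ℝ) + 1)
  rIn_pos := by positivity
  rIn_lt_rOut := by
    apply one_div_lt_one_div_of_lt <;> [positivity; linarith [n.cast_nonneg (α := ℝ)]]

theorem tendsto_shrinkingBump_rOut :
    Tendsto (fun n => (shrinkingBump n).rOut) atTop (𝓝 0) :=
  tendsto_one_div_add_atTop_nhds_zero_nat

theorem ae_tendsto_mollify {f : Plane → ℝ} (hf : LocallyIntegrable f) :
    ∀ᵐ x, Tendsto (fun n => mollify (shrinkingBump n) f x) atTop (𝓝 (f x)) := by
  have h := ContDiffBump.ae_convolution_tendsto_right_of_locallyIntegrable (φ := shrinkingBump)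
    (K := 2) tendsto_shrinkingBump_rOut (Eventually.of_forall fun n => le_of_eq ?_) hf
  · simpa only [← mollify_eq_convolution_swap] using h
  · simp only [shrinkingBump]; field_simp

theorem integrable_indicator_fn {D : Set Plane} (hDm : MeasurableSet D)
    [IsFiniteMeasure (volume.restrict D)] {f : Plane → ℝ} (hf : MemLp f 2 (volume.restrict D)) :
    Integrable (D.indicator f) ∧ Integrable fun x => D.indicator f x ^ 2 := by
  refine ⟨(integrable_indicator_iff hDm).2 (hf.integrable (by norm_num)), ?_⟩
  have h := (integrable_indicator_iff hDm).2 hf.integrable_sq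
  refine h.congr (Eventually.of_forall fun x => ?_)
  by_cases hx : x ∈ D <;> simp [hx]

theorem lintegral_sq_indicator {D : Set Plane} (hDm : MeasurableSet D) (f : Plane → ℝ) :
    ∫⁻ x, ENNReal.ofReal (D.indicator f x ^ 2) = ∫⁻ x in D, ENNReal.ofReal (f x ^ 2) := by
  rw [← lintegral_indicator hDm]
  congr 1; ext x
  by_cases hx : x ∈ D <;> simp [hx]

/-- On an inner parallel set a fine mollification of `u` is smooth and its gradient is the mollified
weak gradient, so the smooth inequality applies with a right-hand side bounded by the norms of `u`
and `v`. Fatou's lemma removes the mollification and monotone convergence exhausts `D`. No extension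
operator is involved. -/
theorem lintegral_pow_four_le {D : Set Plane} (hDo : IsOpen D) (hDc : Convex ℝ D)
    (hDb : Bornology.IsBounded D) (hne : D.Nonempty) :
    ∃ C : ℝ≥0, ∀ (u : L2 D) (v : L2Vec D), IsWeakGradient D u v →
      ∫⁻ x in D, ENNReal.ofReal (u x ^ 4)
        ≤ C * (∫⁻ x in D, ENNReal.ofReal (u x ^ 2 + ‖v x‖ ^ 2)) ^ 2 := by
  obtain ⟨x₀, hx₀⟩ := hne
  obtain ⟨r, hr, hball⟩ := Metric.isOpen_iff.1 hDo x₀ hx₀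
  -- The ball of radius `r / 2` stays inside every inner parallel set of depth at most `r / 2`, so a
  -- single constant serves all of them.
  obtain ⟨C, hC⟩ := gagliardo_convex hDb x₀ (r := r / 2) (by positivity)
  have hDm : MeasurableSet D := hDo.measurableSet
  have : IsFiniteMeasure (volume.restrict D) :=
    ⟨by rw [Measure.restrict_apply_univ]; exact hDb.measure_lt_top⟩
  refine ⟨C, fun u v huv => ?_⟩
  have hum : Measurable (D.indicator u) := (Lp.stronglyMeasurable u).measurable.indicator hDm
  have hvm : ∀ i, Measurable (D.indicator fun y => v y i) := fun i =>
    ((EuclideanSpace.proj (𝕜 := ℝ) i).continuous.measurable.comp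
      (Lp.stronglyMeasurable v).measurable).indicator hDm
  obtain ⟨hu1, hu2⟩ := integrable_indicator_fn hDm (Lp.memLp u)
  have hv12 := fun i => integrable_indicator_fn hDm (memLp_coord v i)
  have hul : LocallyIntegrable (D.indicator u) := hu1.locallyIntegrable
  set R : ℝ≥0∞ := ∫⁻ x in D, ENNReal.ofReal (u x ^ 2 + ‖v x‖ ^ 2) with hR
  have hRsum : ∫⁻ x in D, ENNReal.ofReal (u x ^ 2) + ENNReal.ofReal (v x 0 ^ 2)
      + ENNReal.ofReal (v x 1 ^ 2) = R := by
    apply lintegral_congr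
    intro x
    rw [← ENNReal.ofReal_add (by positivity) (by positivity),
      ← ENNReal.ofReal_add (by positivity) (by positivity), EuclideanSpace.norm_sq_eq]
    simp [Fin.sum_univ_two, add_assoc]
  -- the estimate for mollifications on inner parallel sets
  have hmoll : ∀ δ, 0 < δ → δ ≤ r / 2 → ∀ η : ContDiffBump (0 : Plane), η.rOut < δ →
      ∫⁻ x in innerParallel D δ, ENNReal.ofReal (mollify η (D.indicator u) x ^ 4)
        ≤ C * R ^ 2 := by
    intro δ hδ hδr η hη
    have hball' : Metric.ball x₀ (r / 2) ⊆ innerParallel D δ :=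
      (Metric.ball_subset_ball (by linarith)).trans (ball_subset_innerParallel hball)
    have hIm : MeasurableSet (innerParallel D δ) := (isClosed_innerParallel D δ).measurableSet
    refine (hC _ (innerParallel_subset D hδ) (convex_innerParallel hDc δ) hIm hball' _
      (contDiff_mollify η hul)).trans ?_
    gcongr
    have hcont : ∀ {f : Plane → ℝ}, Integrable f → Measurable fun x =>
        ENNReal.ofReal (mollify η f x ^ 2) := fun hf =>
      ENNReal.measurable_ofReal.comp
        (((contDiff_mollify η hf.locallyIntegrable).continuous.measurable).pow_const 2)
    calc ∫⁻ x in innerParallel D δ, ENNReal.ofReal (mollify η (D.indicator u) x ^ 2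
          + ‖fderiv ℝ (mollify η (D.indicator u)) x‖ ^ 2)
        ≤ ∫⁻ x in innerParallel D δ, (ENNReal.ofReal (mollify η (D.indicator u) x ^ 2)
          + ENNReal.ofReal (mollify η (D.indicator fun y => v y 0) x ^ 2)
          + ENNReal.ofReal (mollify η (D.indicator fun y => v y 1) x ^ 2)) := by
          apply setLIntegral_mono' hIm
          intro x hx
          rw [← ENNReal.ofReal_add (by positivity) (by positivity),
            ← ENNReal.ofReal_add (by positivity) (by positivity), add_assoc]
          apply ENNReal.ofReal_le_ofReal
          gcongr
          rw [← fderiv_mollify_eq hDm huv hul η hη hx 0, ← fderiv_mollify_eq hDm huv hul η hη hx 1]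
          exact sq_norm_le_of_coords _
      _ ≤ ∫⁻ x, (ENNReal.ofReal (mollify η (D.indicator u) x ^ 2)
          + ENNReal.ofReal (mollify η (D.indicator fun y => v y 0) x ^ 2)
          + ENNReal.ofReal (mollify η (D.indicator fun y => v y 1) x ^ 2)) :=
          setLIntegral_le_lintegral _ _
      _ ≤ ∫⁻ x in D, ENNReal.ofReal (u x ^ 2) + ENNReal.ofReal (v x 0 ^ 2)
          + ENNReal.ofReal (v x 1 ^ 2) := by
          have hum' : Measurable fun x => ENNReal.ofReal (u x ^ 2) :=
            ENNReal.measurable_ofReal.comp ((Lp.stronglyMeasurable u).measurable.pow_const 2)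
          have hvm' : ∀ i, Measurable fun x => ENNReal.ofReal (v x i ^ 2) := fun i =>
            ENNReal.measurable_ofReal.comp
              (((EuclideanSpace.proj (𝕜 := ℝ) i).continuous.measurable.comp
                (Lp.stronglyMeasurable v).measurable).pow_const 2)
          rw [lintegral_add_left (by exact (hcont hu1).add (hcont (hv12 0).1)),
            lintegral_add_left (hcont hu1), lintegral_add_left (by exact hum'.add (hvm' 0)),
            lintegral_add_left hum', ← lintegral_sq_indicator hDm u,
            ← lintegral_sq_indicator hDm fun x => v x 0,
            ← lintegral_sq_indicator hDm fun x => v x 1]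
          exact add_le_add (add_le_add (lintegral_sq_mollify_le η hum hu1 hu2)
            (lintegral_sq_mollify_le η (hvm 0) (hv12 0).1 (hv12 0).2))
            (lintegral_sq_mollify_le η (hvm 1) (hv12 1).1 (hv12 1).2)
      _ = R := hRsum
  -- passage to the limit in the mollification
  have hinner : ∀ δ, 0 < δ → δ ≤ r / 2 →
      ∫⁻ x in innerParallel D δ, ENNReal.ofReal (D.indicator u x ^ 4) ≤ C * R ^ 2 := by
    intro δ hδ hδr
    have hlim : ∀ᵐ x ∂(volume.restrict (innerParallel D δ)),
        ENNReal.ofReal (D.indicator u x ^ 4)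
          = liminf (fun n => ENNReal.ofReal (mollify (shrinkingBump n) (D.indicator u) x ^ 4))
            atTop := by
      filter_upwards [ae_restrict_of_ae (ae_tendsto_mollify hul)] with x hx
      exact ((ENNReal.continuous_ofReal.tendsto _).comp (hx.pow 4)).liminf_eq.symm
    rw [lintegral_congr_ae hlim]
    refine (lintegral_liminf_le fun n => ENNReal.measurable_ofReal.comp
      (((contDiff_mollify _ hul).continuous.measurable).pow_const 4)).trans ?_
    have hev : ∀ᶠ n in atTop, ∫⁻ x in innerParallel D δ,
        ENNReal.ofReal (mollify (shrinkingBump n) (D.indicator u) x ^ 4) ≤ C * R ^ 2 := by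
      filter_upwards [tendsto_shrinkingBump_rOut.eventually (gt_mem_nhds hδ)] with n hn
      exact hmoll δ hδ hδr _ hn
    refine (liminf_le_liminf hev).trans (le_of_eq ?_)
    exact liminf_const _
  -- exhaustion of `D`
  have hcongr : ∫⁻ x in D, ENNReal.ofReal (u x ^ 4)
      = ∫⁻ x in D, ENNReal.ofReal (D.indicator u x ^ 4) :=
    setLIntegral_congr_fun hDm fun x hx => by simp [Set.indicator_of_mem hx]
  rw [hcongr]
  have hmono : Monotone fun n : ℕ => innerParallel D (1 / ((n : ℝ) + 1)) := fun m n hmn =>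
    innerParallel_antitone D (one_div_le_one_div_of_le (by positivity)
      (by have : (m : ℝ) ≤ n := by exact_mod_cast hmn
          linarith))
  have hsup := setLIntegral_iUnion_of_directed (μ := volume)
    (fun x => ENNReal.ofReal (D.indicator u x ^ 4)) hmono.directed_le
  rw [iUnion_innerParallel hDo] at hsup
  rw [hsup]
  refine iSup_le fun n => ?_
  -- For small `n` the depth may exceed `r / 2`; truncating it only enlarges the set.
  have hle : innerParallel D (1 / ((n : ℝ) + 1))
      ⊆ innerParallel D (min (1 / ((n : ℝ) + 1)) (r / 2)) :=
    innerParallel_antitone D (min_le_left _ _)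
  exact (lintegral_mono_set hle).trans (hinner _ (by positivity) (min_le_right _ _))

/-! ### Basic facts on `H¹(D)` -/

section Basic

variable {D : Set Plane}

@[simp] theorem H1.fn_add (u v : H1 D) : (u + v).fn = u.fn + v.fn := rfl
@[simp] theorem H1.fn_sub (u v : H1 D) : (u - v).fn = u.fn - v.fn := rfl
@[simp] theorem H1.fn_smul (c : ℝ) (u : H1 D) : (c • u).fn = c • u.fn := rfl
@[simp] theorem H1.grad_add (u v : H1 D) : (u + v).grad = u.grad + v.grad := rfl
@[simp] theorem H1.grad_sub (u v : H1 D) : (u - v).grad = u.grad - v.grad := rfl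
@[simp] theorem H1.grad_smul (c : ℝ) (u : H1 D) : (c • u).grad = c • u.grad := rfl

theorem H1.norm_sq (u : H1 D) : ‖u‖ ^ 2 = ‖u.fn‖ ^ 2 + ‖u.grad‖ ^ 2 :=
  WithLp.prod_norm_sq_eq_of_L2 (u : WithLp 2 (L2 D × L2Vec D))

theorem H1.norm_fn_le (u : H1 D) : ‖u.fn‖ ≤ ‖u‖ := by
  have := u.norm_sq
  exact abs_le_of_sq_le_sq' (by nlinarith [sq_nonneg ‖u.grad‖]) (norm_nonneg _) |>.2

theorem H1.norm_grad_le (u : H1 D) : ‖u.grad‖ ≤ ‖u‖ := by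
  have := u.norm_sq
  exact abs_le_of_sq_le_sq' (by nlinarith [sq_nonneg ‖u.fn‖]) (norm_nonneg _) |>.2

theorem H1.isWeakGradient (u : H1 D) : IsWeakGradient D u.fn u.grad := u.2

theorem H1.continuous_grad : Continuous (H1.grad : H1 D → L2Vec D) :=
  (WithLp.continuous_snd 2 _ _).comp continuous_subtype_val

theorem inner_L2_eq (u v : L2 D) : inner ℝ u v = ∫ x in D, u x * v x := by
  rw [L2.inner_def]
  exact integral_congr_ae (Eventually.of_forall fun x => by simp [mul_comm])

theorem inner_L2Vec_eq (u v : L2Vec D) : inner ℝ u v = ∫ x in D, inner ℝ (u x) (v x) :=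
  L2.inner_def u v

theorem norm_sq_L2_eq (u : L2 D) : ‖u‖ ^ 2 = ∫ x in D, u x ^ 2 := by
  rw [← real_inner_self_eq_norm_sq, inner_L2_eq]
  simp only [sq]

theorem norm_sq_L2Vec_eq (u : L2Vec D) : ‖u‖ ^ 2 = ∫ x in D, ‖u x‖ ^ 2 := by
  rw [← real_inner_self_eq_norm_sq, inner_L2Vec_eq]
  simp only [real_inner_self_eq_norm_sq]

end Basic

/-- The Sobolev embedding `H¹(D) ⊆ L⁴(D)` with constant `C`. -/
structure EmbedsL4 (D : Set Plane) (C : ℝ) : Prop where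
  nonneg : 0 ≤ C
  memLp : ∀ u : H1 D, MemLp u.fn 4 (volume.restrict D)
  integral_le : ∀ u : H1 D, ∫ x in D, u.fn x ^ 4 ≤ C * ‖u‖ ^ 4

theorem memLp_four_iff {α : Type*} [MeasurableSpace α] {μ : Measure α} {f : α → ℝ}
    (hf : AEStronglyMeasurable f μ) : MemLp f 4 μ ↔ Integrable (fun x => f x ^ 4) μ := by
  have h := integrable_norm_rpow_iff (p := 4) hf (by norm_num) (by norm_num)
  rw [← h]
  refine integrable_congr (Eventually.of_forall fun x => ?_)
  have h4 : (4 : ℝ≥0∞).toReal = ((4 : ℕ) : ℝ) := by norm_num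
  simp only [h4, Real.rpow_natCast, Real.norm_eq_abs]
  exact Even.pow_abs (by decide) _

theorem IsConvexPolygonalDomain.exists_embedsL4 {D : Set Plane} (hD : IsConvexPolygonalDomain D) :
    ∃ C, EmbedsL4 D C := by
  obtain ⟨C, hC⟩ := lintegral_pow_four_le hD.isOpen hD.convex hD.isBounded hD.1
  have key : ∀ u : H1 D, ∫⁻ x in D, ENNReal.ofReal (u.fn x ^ 4) ≤ ENNReal.ofReal (C * ‖u‖ ^ 4) := by
    intro u
    refine (hC u.fn u.grad u.isWeakGradient).trans (le_of_eq ?_)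
    have hi1 : Integrable (fun x => u.fn x ^ 2) (volume.restrict D) := (Lp.memLp u.fn).integrable_sq
    have hi2 : Integrable (fun x => ‖u.grad x‖ ^ 2) (volume.restrict D) :=
      (Lp.memLp u.grad).integrable_norm_pow (by norm_num)
    have hi : Integrable (fun x => u.fn x ^ 2 + ‖u.grad x‖ ^ 2) (volume.restrict D) := hi1.add hi2
    rw [← ofReal_integral_eq_lintegral_ofReal hi
      (Eventually.of_forall fun x => add_nonneg (sq_nonneg _) (sq_nonneg _))]
    have : ∫ x in D, (u.fn x ^ 2 + ‖u.grad x‖ ^ 2) = ‖u‖ ^ 2 := by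
      rw [integral_add hi1 hi2, ← norm_sq_L2_eq, ← norm_sq_L2Vec_eq, H1.norm_sq]
    rw [this, ← ENNReal.ofReal_pow (by positivity), ENNReal.ofReal_mul (by positivity),
      ENNReal.ofReal_coe_nnreal]
    ring_nf
  have hm : ∀ u : H1 D, AEStronglyMeasurable u.fn (volume.restrict D) := fun u =>
    Lp.aestronglyMeasurable u.fn
  have hint : ∀ u : H1 D, Integrable (fun x => u.fn x ^ 4) (volume.restrict D) := fun u => by
    refine ⟨(hm u).pow 4, ?_⟩
    rw [hasFiniteIntegral_iff_ofReal (Eventually.of_forall fun x => by positivity)]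
    exact (key u).trans_lt ENNReal.ofReal_lt_top
  refine ⟨C, C.2, fun u => (memLp_four_iff (hm u)).2 (hint u), fun u => ?_⟩
  have h := key u
  rw [← ofReal_integral_eq_lintegral_ofReal (hint u)
    (Eventually.of_forall fun x => by positivity)] at h
  exact (ENNReal.ofReal_le_ofReal_iff (by positivity)).1 h

theorem IsConvexPolygonalDomain.isFiniteMeasure {D : Set Plane} (hD : IsConvexPolygonalDomain D) :
    IsFiniteMeasure (volume.restrict D) :=
  ⟨by rw [Measure.restrict_apply_univ]; exact hD.isBounded.measure_lt_top⟩

/-! ### Products of functions in `L⁴` -/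

section Products

variable {α : Type*} [MeasurableSpace α] {μ : Measure α}

theorem memLp_two_mul_of_memLp_four {f g : α → ℝ} (hf : MemLp f 4 μ) (hg : MemLp g 4 μ) :
    MemLp (fun x => f x * g x) 2 μ := by
  have : ENNReal.HolderTriple 4 4 2 := ⟨by
    rw [← two_mul, show (4 : ℝ≥0∞) = 2 * 2 by norm_num,
      ENNReal.mul_inv (by simp) (by simp), ← mul_assoc,
      ENNReal.mul_inv_cancel (by simp) (by simp), one_mul]⟩
  exact hg.mul hf

theorem integrable_mul_four {f₁ f₂ f₃ f₄ : α → ℝ} (h₁ : MemLp f₁ 4 μ) (h₂ : MemLp f₂ 4 μ)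
    (h₃ : MemLp f₃ 4 μ) (h₄ : MemLp f₄ 4 μ) :
    Integrable (fun x => f₁ x * f₂ x * (f₃ x * f₄ x)) μ :=
  (memLp_two_mul_of_memLp_four h₁ h₂).integrable_mul (memLp_two_mul_of_memLp_four h₃ h₄)

end Products

/-! ### Smooth functions as elements of `H¹(D)` -/

/-- The classical gradient is a weak gradient, by integration by parts. It supplies the noise
profile and the constant function as elements of `H¹(D)`. -/
theorem H1.exists_of_contDiffOn {D : Set Plane} (hDo : IsOpen D)
    [IsFiniteMeasure (volume.restrict D)] {f : Plane → ℝ} (hf : ContDiffOn ℝ 1 f D) {M : ℝ}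
    (hM : ∀ x ∈ D, |f x| ≤ M) (hM' : ∀ x ∈ D, ‖fderiv ℝ f x‖ ≤ M) :
    ∃ u : H1 D, u.fn =ᵐ[volume.restrict D] f ∧
      u.grad =ᵐ[volume.restrict D] fun x => WithLp.toLp 2 fun i => partialDeriv i f x := by
  have hDm : MeasurableSet D := hDo.measurableSet
  have hfm : AEStronglyMeasurable f (volume.restrict D) :=
    hf.continuousOn.aestronglyMeasurable hDm
  have hdc : ContinuousOn (fderiv ℝ f) D := hf.continuousOn_fderiv_of_isOpen hDo le_rfl
  have hfL : MemLp f 2 (volume.restrict D) := MemLp.of_bound hfm M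
    ((ae_restrict_iff' hDm).2 (Eventually.of_forall fun x hx => hM x hx))
  have hpc : ∀ i, ContinuousOn (partialDeriv i f) D := fun i =>
    hdc.clm_apply continuousOn_const
  have hpb : ∀ i, ∀ x ∈ D, ‖partialDeriv i f x‖ ≤ M := by
    intro i x hx
    refine ((fderiv ℝ f x).le_opNorm _).trans ?_
    simpa using hM' x hx
  have hpL : ∀ i, MemLp (partialDeriv i f) 2 (volume.restrict D) := fun i =>
    MemLp.of_bound ((hpc i).aestronglyMeasurable hDm) M
      ((ae_restrict_iff' hDm).2 (Eventually.of_forall (hpb i)))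
  have hgc : ContinuousOn (fun x => (WithLp.toLp 2 fun i => partialDeriv i f x : Plane)) D :=
    (PiLp.continuous_toLp 2 _).comp_continuousOn (continuousOn_pi.2 hpc)
  have hgL : MemLp (fun x => (WithLp.toLp 2 fun i => partialDeriv i f x : Plane)) 2
      (volume.restrict D) := by
    refine MemLp.of_bound (hgc.aestronglyMeasurable hDm) (√(M ^ 2 + M ^ 2))
      ((ae_restrict_iff' hDm).2 (Eventually.of_forall fun x hx => ?_))
    rw [EuclideanSpace.norm_eq]
    apply Real.sqrt_le_sqrt
    simp only [Fin.sum_univ_two]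
    exact add_le_add (pow_le_pow_left₀ (norm_nonneg _) (hpb 0 x hx) 2)
      (pow_le_pow_left₀ (norm_nonneg _) (hpb 1 x hx) 2)
  refine ⟨⟨WithLp.toLp 2 (hfL.toLp f, hgL.toLp _), ?_⟩, hfL.coeFn_toLp,
    hgL.coeFn_toLp⟩
  intro φ hφ i
  change ∫ x in D, hfL.toLp f x * partialDeriv i φ x = - ∫ x in D, (hgL.toLp _ x) i * φ x
  have e1 : ∫ x in D, hfL.toLp f x * partialDeriv i φ x = ∫ x in D, f x * partialDeriv i φ x :=
    integral_congr_ae (by filter_upwards [hfL.coeFn_toLp] with x hx; rw [hx])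
  have e2 : ∫ x in D, (hgL.toLp _ x) i * φ x = ∫ x in D, partialDeriv i f x * φ x :=
    integral_congr_ae (by filter_upwards [hgL.coeFn_toLp] with x hx; rw [hx])
  have z1 : ∀ x, x ∉ D → φ x = 0 := fun x hx =>
    image_eq_zero_of_notMem_tsupport fun h => hx (hφ.supp h)
  have z2 : ∀ x, x ∉ D → partialDeriv i φ x = 0 := fun x hx => by
    have : x ∉ tsupport (fderiv ℝ φ) := fun h => hx (hφ.supp (tsupport_fderiv_subset ℝ h))
    simp [partialDeriv, image_eq_zero_of_notMem_tsupport this]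
  have w1 : ∀ h : Plane → ℝ, ∀ x, x ∉ D → h x * φ x = 0 := fun h x hx => by rw [z1 x hx, mul_zero]
  have w2 : ∀ x, x ∉ D → f x * partialDeriv i φ x = 0 := fun x hx => by rw [z2 x hx, mul_zero]
  have supp : ∀ {h : Plane → ℝ}, (∀ x, x ∉ D → h x = 0) → Function.support h ⊆ D := fun hh x hx => by
    by_contra hxD; exact hx (hh x hxD)
  -- The test function and its derivative vanish off `D`, so both integrals extend to the plane;
  -- there `f` has to be differentiable only on the support of `φ`.
  rw [e1, e2, setIntegral_eq_integral_of_forall_compl_eq_zero w2,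
    setIntegral_eq_integral_of_forall_compl_eq_zero (w1 _)]
  apply integral_mul_fderiv_eq_neg_fderiv_mul_of_integrable
  · exact (integrableOn_iff_integrable_of_support_subset (supp (w1 _))).1
      ((hpL i).integrable_mul hφ.memLp)
  · exact (integrableOn_iff_integrable_of_support_subset (supp w2)).1
      (hfL.integrable_mul (hφ.memLp_partialDeriv i))
  · exact (integrableOn_iff_integrable_of_support_subset (supp (w1 _))).1
      (hfL.integrable_mul hφ.memLp)
  · intro x hx
    exact (hf.differentiableOn (by simp) x (hφ.supp hx)).differentiableAt
      (hDo.mem_nhds (hφ.supp hx))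
  · exact fun x _ => hφ.smooth.differentiable (by simp) x

theorem IsNoiseProfile.exists_H1 {D : Set Plane} (hD : IsConvexPolygonalDomain D) {g : Plane → ℝ}
    (hg : IsNoiseProfile D g) :
    ∃ (G : ℝ) (gH : H1 D), 0 ≤ G ∧ gH.fn =ᵐ[volume.restrict D] g ∧
      ∀ᵐ x ∂(volume.restrict D), |gH.fn x| ≤ G := by
  have := hD.isFiniteMeasure
  have hcomp : IsCompact (closure D) := hD.isBounded.isCompact_closure
  have hsm : ContDiffOn ℝ 1 g (closure D) := hg.smooth.of_le (by exact_mod_cast le_top)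
  have hu : UniqueDiffOn ℝ (closure D) := uniqueDiffOn_convex hD.convex.closure
    (hD.1.mono (interior_maximal subset_closure hD.isOpen))
  obtain ⟨M₁, hM₁⟩ := hcomp.exists_bound_of_continuousOn hsm.continuousOn
  obtain ⟨M₂, hM₂⟩ := hcomp.exists_bound_of_continuousOn
    (hsm.continuousOn_fderivWithin hu le_rfl)
  have hb : ∀ x ∈ D, |g x| ≤ max M₁ M₂ := fun x hx =>
    (hM₁ x (subset_closure hx)).trans (le_max_left _ _)
  obtain ⟨gH, hgH, -⟩ := H1.exists_of_contDiffOn hD.isOpen (hsm.mono subset_closure) hb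
    fun x hx => by
      rw [← fderivWithin_of_mem_nhds (mem_of_superset (hD.isOpen.mem_nhds hx) subset_closure)]
      exact (hM₂ x (subset_closure hx)).trans (le_max_right _ _)
  refine ⟨max M₁ M₂, gH, ?_, hgH, ?_⟩
  · obtain ⟨x, hx⟩ := hD.1
    exact (abs_nonneg _).trans (hb x hx)
  · filter_upwards [hgH, ae_restrict_mem hD.isOpen.measurableSet] with x h1 h2
    rw [h1]; exact hb x h2

theorem IsConvexPolygonalDomain.exists_one {D : Set Plane} (hD : IsConvexPolygonalDomain D) :
    ∃ o : H1 D, o.fn =ᵐ[volume.restrict D] (fun _ => 1) ∧ o.grad = 0 := by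
  have := hD.isFiniteMeasure
  obtain ⟨o, h1, h2⟩ := H1.exists_of_contDiffOn (f := fun _ => 1) (M := 1) hD.isOpen
    contDiffOn_const (by simp) (by simp)
  refine ⟨o, h1, Lp.ext ?_⟩
  filter_upwards [h2, Lp.coeFn_zero Plane 2 (volume.restrict D)] with x hx hx0
  rw [hx, hx0]
  ext i
  simp [partialDeriv]

/-- Test the first equation with the constant `1`: the diffusion term has zero gradient and the
noise profile has zero mean. -/
theorem SolvesSchemeAlong.mass_eq {D : Set Plane} (hD : IsConvexPolygonalDomain D)
    {g : Plane → ℝ} (hg : IsNoiseProfile D g) {s ε k : ℝ} {J : ℕ} {u₀ : H1 D} {ΔW : ℕ → ℝ}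
    {X w : ℕ → H1 D} (h : SolvesSchemeAlong g s ε k J u₀ ΔW X w) :
    ∀ j ≤ J, (X j).mass = u₀.mass := by
  have := hD.isFiniteMeasure
  obtain ⟨o, ho, hgrad⟩ := hD.exists_one
  intro j
  induction j with
  | zero => intro _; rw [h.1]
  | succ j ih =>
    intro hj
    rw [← ih (by omega)]
    have h1 := (h.2 j hj).1 o
    have e1 : ∫ x in D, ((X (j + 1)).fn x - (X j).fn x) * o.fn x
        = (X (j + 1)).mass - (X j).mass := by
      rw [H1.mass, H1.mass, ← integral_sub ((Lp.memLp _).integrable (by norm_num))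
        ((Lp.memLp _).integrable (by norm_num))]
      exact integral_congr_ae (by filter_upwards [ho] with x hx; rw [hx, mul_one])
    have e2 : ∫ x in D, g x * o.fn x = 0 := by
      rw [← hg.mean_zero]
      exact integral_congr_ae (by filter_upwards [ho] with x hx; rw [hx, mul_one])
    rw [e1, e2, ← inner_L2Vec_eq, hgrad, inner_zero_right] at h1
    linarith

/-! ### The energy functional -/

section Quartic

variable {α : Type*} [MeasurableSpace α] {μ : Measure α} [IsFiniteMeasure μ]

theorem integrable_monomials {f g : α → ℝ} (hf : MemLp f 4 μ) (hg : MemLp g 4 μ) :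
    Integrable (fun x => f x ^ 4) μ ∧ Integrable (fun x => f x ^ 3 * g x) μ ∧
      Integrable (fun x => f x ^ 2 * g x ^ 2) μ ∧ Integrable (fun x => f x * g x ^ 3) μ ∧
      Integrable (fun x => f x ^ 2) μ ∧ Integrable (fun x => f x * g x) μ ∧ Integrable f μ := by
  have h1 : MemLp (fun _ : α => (1 : ℝ)) 4 μ := memLp_const 1
  refine ⟨?_, ?_, ?_, ?_, ?_, ?_, hf.integrable (by norm_num)⟩
  · convert integrable_mul_four hf hf hf hf using 2; ring
  · convert integrable_mul_four hf hf hf hg using 2; ring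
  · convert integrable_mul_four hf hf hg hg using 2; ring
  · convert integrable_mul_four hf hg hg hg using 2; ring
  · convert integrable_mul_four hf hf h1 h1 using 2; ring
  · convert integrable_mul_four hf hg h1 h1 using 2; ring

theorem integrable_doubleWell {f : α → ℝ} (hf : MemLp f 4 μ) :
    Integrable (fun x => doubleWell (f x)) μ := by
  obtain ⟨h4, -, -, -, h2, -, -⟩ := integrable_monomials hf hf
  have := ((h4.sub (h2.const_mul 2)).add (integrable_const (1 : ℝ))).const_mul (1 / 4)
  refine this.congr (Eventually.of_forall fun x => ?_)
  simp [doubleWell]; ring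

theorem integrable_nonlin_mul {f g : α → ℝ} (hf : MemLp f 4 μ) (hg : MemLp g 4 μ) :
    Integrable (fun x => nonlin (f x) * g x) μ := by
  obtain ⟨-, h3, -, -, -, h1, -⟩ := integrable_monomials hf hg
  refine (h3.sub h1).congr (Eventually.of_forall fun x => ?_)
  simp [nonlin]; ring

/-- The Taylor expansion of a quartic is exact, so the energy change under noise has no remainder;
`L⁴` is precisely what makes each coefficient integrable. -/
theorem integral_doubleWell_add {f g : α → ℝ} (hf : MemLp f 4 μ) (hg : MemLp g 4 μ) (c : ℝ) :
    ∫ x, doubleWell (f x + c * g x) ∂μ = (∫ x, doubleWell (f x) ∂μ)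
      + c * (∫ x, nonlin (f x) * g x ∂μ) + c ^ 2 * (∫ x, (3 * f x ^ 2 - 1) / 2 * g x ^ 2 ∂μ)
      + c ^ 3 * (∫ x, f x * g x ^ 3 ∂μ) + c ^ 4 * (∫ x, 1 / 4 * g x ^ 4 ∂μ) := by
  obtain ⟨-, -, h22, h13, -, -, -⟩ := integrable_monomials hf hg
  obtain ⟨g4, -, -, -, g2, -, -⟩ := integrable_monomials hg hg
  have i0 := integrable_doubleWell hf
  have i1 := (integrable_nonlin_mul hf hg).const_mul c
  have i2 : Integrable (fun x => c ^ 2 * ((3 * f x ^ 2 - 1) / 2 * g x ^ 2)) μ := by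
    refine Integrable.const_mul ?_ _
    refine ((h22.const_mul (3 / 2)).sub (g2.const_mul (1 / 2))).congr
      (Eventually.of_forall fun x => ?_)
    simp; ring
  have i3 := h13.const_mul (c ^ 3)
  have i4 := (g4.const_mul (1 / 4)).const_mul (c ^ 4)
  rw [← integral_const_mul, ← integral_const_mul, ← integral_const_mul, ← integral_const_mul,
    ← integral_add i0 i1, ← integral_add (by exact i0.add i1) i2,
    ← integral_add (by exact (i0.add i1).add i2) i3,
    ← integral_add (by exact ((i0.add i1).add i2).add i3) i4]
  refine integral_congr_ae (Eventually.of_forall fun x => ?_)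
  simp only [doubleWell, nonlin]; ring

end Quartic

/-! ### Pointwise control by the double well -/

theorem doubleWell_nonneg (s : ℝ) : 0 ≤ doubleWell s := by unfold doubleWell; positivity

theorem abs_nonlin_le (a : ℝ) : |nonlin a| ≤ 1 + 4 * doubleWell a := by
  unfold nonlin doubleWell
  rw [abs_le]; constructor <;>
  nlinarith [sq_nonneg (a ^ 2 - 1 - 1 / 2 * a), sq_nonneg (a ^ 2 - 1 + 1 / 2 * a), sq_nonneg a,
    sq_nonneg (a ^ 2 - 1 - 1), sq_nonneg (a ^ 2 - 1 + 1), sq_nonneg (a ^ 2 - 1 - a),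
    sq_nonneg (a ^ 2 - 1 + a)]

theorem abs_le_doubleWell (a : ℝ) : |a| ≤ 2 * (1 + 4 * doubleWell a) := by
  unfold doubleWell
  rw [abs_le]; constructor <;>
  nlinarith [sq_nonneg (a - 1), sq_nonneg (a + 1), sq_nonneg (a ^ 2 - 1 - 1)]

theorem abs_second_deriv_le (a : ℝ) : |(3 * a ^ 2 - 1) / 2| ≤ 2 * (1 + 4 * doubleWell a) := by
  unfold doubleWell
  rw [abs_le]; constructor <;>
  nlinarith [sq_nonneg (a ^ 2 - 1 - 1), sq_nonneg (a ^ 2 - 1 + 1)]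

theorem pow_four_le_doubleWell (a : ℝ) : a ^ 4 ≤ 8 * doubleWell a + 2 := by
  unfold doubleWell
  nlinarith [sq_nonneg (a ^ 2 - 1 - 1)]

instance fact_one_le_four : Fact ((1 : ℝ≥0∞) ≤ 4) := ⟨by norm_num⟩

theorem norm_toLp_pow_four {α : Type*} [MeasurableSpace α] {μ : Measure α} {f : α → ℝ}
    (hf : MemLp f 4 μ) : ‖hf.toLp f‖ ^ 4 = ∫ x, f x ^ 4 ∂μ := by
  have h4 : (4 : ℝ≥0∞).toReal = ((4 : ℕ) : ℝ) := by norm_num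
  have hnn : 0 ≤ ∫ x, f x ^ 4 ∂μ := integral_nonneg fun x => by positivity
  rw [Lp.norm_toLp, hf.eLpNorm_eq_integral_rpow_norm (by norm_num) (by norm_num), h4]
  simp only [Real.rpow_natCast, Real.norm_eq_abs]
  have : ∀ x, |f x| ^ 4 = f x ^ 4 := fun x => Even.pow_abs (by decide) _
  simp only [this]
  rw [ENNReal.toReal_ofReal (Real.rpow_nonneg hnn _)]
  exact Real.rpow_inv_natCast_pow hnn (by norm_num)

section Nonneg

variable {D : Set Plane}

theorem energy_nonneg {ε : ℝ} (hε : 0 < ε) (u : H1 D) : 0 ≤ energy ε u :=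
  integral_nonneg fun x => add_nonneg (by positivity)
    (mul_nonneg (by positivity) (doubleWell_nonneg _))

theorem integral_doubleWell_nonneg (u : H1 D) : 0 ≤ ∫ x in D, doubleWell (u.fn x) :=
  integral_nonneg fun _ => doubleWell_nonneg _

/-- The embedding `H¹(D) → L⁴(D)` as a continuous linear map. -/
noncomputable def EmbedsL4.toL4 {C₄ : ℝ} (hS : EmbedsL4 D C₄) :
    H1 D →L[ℝ] Lp ℝ 4 (volume.restrict D) :=
  LinearMap.mkContinuous
    { toFun := fun u => (hS.memLp u).toLp u.fn
      map_add' := fun u v =>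
        (MemLp.toLp_congr _ ((hS.memLp u).add (hS.memLp v)) (Lp.coeFn_add u.fn v.fn)).trans
          (MemLp.toLp_add _ _)
      map_smul' := fun c u =>
        (MemLp.toLp_congr _ ((hS.memLp u).const_smul c) (Lp.coeFn_smul c u.fn)).trans
          (MemLp.toLp_const_smul _ _) }
    -- Any number at least `1` and at least `C₄` has fourth power at least `C₄`, which avoids taking
    -- a fourth root.
    (max 1 C₄) fun u => by
      have h1 := norm_toLp_pow_four (hS.memLp u)
      have h2 := hS.integral_le u
      have h3 : C₄ ≤ max 1 C₄ ^ 4 :=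
        (le_max_right 1 C₄).trans (le_self_pow₀ (le_max_left _ _) (by norm_num))
      refine (pow_le_pow_iff_left₀ (norm_nonneg _) (by positivity) (four_ne_zero)).1 ?_
      rw [mul_pow]
      change ‖(hS.memLp u).toLp u.fn‖ ^ 4 ≤ _
      rw [h1]
      exact h2.trans (by gcongr)

theorem EmbedsL4.continuous_integral_pow_four {C₄ : ℝ} (hS : EmbedsL4 D C₄) :
    Continuous fun u : H1 D => ∫ x in D, u.fn x ^ 4 := by
  have : (fun u : H1 D => ∫ x in D, u.fn x ^ 4) = fun u => ‖hS.toL4 u‖ ^ 4 := by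
    ext u; exact (norm_toLp_pow_four (hS.memLp u)).symm
  rw [this]
  fun_prop

theorem H1.continuous_fn : Continuous (H1.fn : H1 D → L2 D) :=
  (WithLp.continuous_fst 2 _ _).comp continuous_subtype_val

end Nonneg

theorem abs_integral_mul_le {D : Set Plane} {f F : Plane → ℝ} {g : Plane → ℝ} {G : ℝ}
    (hF : Integrable F (volume.restrict D)) (hfF : ∀ x, |f x| ≤ F x)
    (hg : ∀ᵐ x ∂(volume.restrict D), |g x| ≤ G) :
    |∫ x in D, f x * g x| ≤ G * ∫ x in D, F x := by
  rw [← integral_const_mul, ← Real.norm_eq_abs]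
  refine norm_integral_le_of_norm_le (hF.const_mul G) ?_
  filter_upwards [hg] with x hx
  rw [Real.norm_eq_abs, abs_mul, mul_comm]
  exact mul_le_mul hx (hfF x) (abs_nonneg _) ((abs_nonneg _).trans hx)

/-- Growth constant for the perturbation of the energy by the noise, in terms of the size `V` of
the domain, a bound `G` on the noise profile, and the norm `A` of its gradient. -/
noncomputable def growthConst (V G A : ℝ) : ℝ :=
  1 + A ^ 2 + (1 + G + 2 * G ^ 2 + 2 * G ^ 3 + G ^ 4) * (V + 4)

theorem growthConst_pos {V G A : ℝ} (hV : 0 ≤ V) (hG : 0 ≤ G) : 0 < growthConst V G A := by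
  unfold growthConst; positivity

theorem le_growthConst_mul {V G A E a b t : ℝ} (hV : 0 ≤ V) (hE : 0 ≤ E) (ha : a ≤ A ^ 2)
    (hb' : b ≤ 1 + G + 2 * G ^ 2 + 2 * G ^ 3 + G ^ 4)
    (hG : 0 ≤ G) (ht : t ≤ E + a + b * (V + 4 * E)) : t ≤ growthConst V G A * (E + 1) := by
  unfold growthConst
  have h1 : V + 4 * E ≤ (V + 4) * (E + 1) := by nlinarith
  have h2 : b * (V + 4 * E)
      ≤ (1 + G + 2 * G ^ 2 + 2 * G ^ 3 + G ^ 4) * ((V + 4) * (E + 1)) := by gcongr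
  have h3 : E + a ≤ (1 + A ^ 2) * (E + 1) := by nlinarith [sq_nonneg A]
  linarith

/-- The bounds on the coefficients of the noise expansion, reduced to real numbers. -/
theorem noise_coefficients_le_of_bounds {ε s G V A E i a₁ a₂ a₃ a₄ : ℝ} (hε : 0 < ε) (hε1 : ε ≤ 1)
    (hs : 0 < s) (hsε : s ≤ ε) (hG : 0 ≤ G) (hV : 0 ≤ V) (hE : 0 ≤ E)
    (bi : |i| * ε ≤ E + A ^ 2 / 2) (b1 : |a₁| ≤ G * (V + 4 * E))
    (b2 : |a₂| ≤ G ^ 2 * (2 * (V + 4 * E))) (b3 : |a₃| ≤ G ^ 3 * (2 * (V + 4 * E)))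
    (b4 : |a₄| ≤ G ^ 4 * V) :
    |s * (ε * i + 1 / ε * a₁)| ≤ growthConst V G A * (E + 1) ∧
      s ^ 2 * (ε / 2 * A ^ 2 + 1 / ε * a₂) ≤ growthConst V G A * (E + 1) ∧
      |s ^ 3 * (1 / ε * a₃)| ≤ growthConst V G A * (E + 1) ∧
      s ^ 4 * (1 / ε * a₄) ≤ growthConst V G A * (E + 1) := by
  have hs1 : s ≤ 1 := hsε.trans hε1
  -- Every noise coefficient carries at least one factor `s ≤ ε`, which cancels the `1 / ε` of the
  -- potential; this makes the growth constant free of `ε`.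
  have hdiv : ∀ n : ℕ, 1 ≤ n → s ^ n * (1 / ε) ≤ 1 := by
    intro n hn
    rw [mul_one_div, div_le_one hε]
    exact (pow_le_of_le_one hs.le hs1 (by omega)).trans hsε
  have hfrac : ∀ (n : ℕ) (a b : ℝ), 1 ≤ n → |a| ≤ b → |s ^ n * (1 / ε * a)| ≤ b := by
    intro n a b hn hab
    rw [← mul_assoc, abs_mul, abs_of_nonneg (by positivity)]
    calc s ^ n * (1 / ε) * |a| ≤ 1 * |a| := by gcongr; exact hdiv n hn
      _ ≤ b := by rw [one_mul]; exact hab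
  have c1 := hfrac 1 _ _ le_rfl b1
  have c2 := hfrac 2 _ _ (by norm_num) b2
  have c3 := hfrac 3 _ _ (by norm_num) b3
  have c4 := hfrac 4 _ _ (by norm_num) b4
  rw [pow_one] at c1
  have hG2 : 0 ≤ G ^ 2 := by positivity
  have hG3 : 0 ≤ G ^ 3 := by positivity
  have hG4 : 0 ≤ G ^ 4 := by positivity
  have hA := sq_nonneg A
  refine ⟨?_, ?_, ?_, ?_⟩
  · refine le_growthConst_mul (a := A ^ 2 / 2) (b := G) hV hE (by linarith) (by linarith) hG ?_
    rw [mul_add]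
    refine (abs_add_le _ _).trans (add_le_add ?_ c1)
    rw [abs_mul, abs_mul, abs_of_pos hs, abs_of_pos hε]
    have : s * (ε * |i|) ≤ 1 * (ε * |i|) := by gcongr
    linarith
  · refine le_growthConst_mul (a := A ^ 2) (b := 2 * G ^ 2) hV hE le_rfl (by linarith) hG ?_
    have h1 : s ^ 2 * (ε / 2 * A ^ 2) ≤ 1 * (1 * A ^ 2) := by
      gcongr
      · exact pow_le_one₀ hs.le hs1
      · linarith
    have h2 := le_of_abs_le c2
    linarith
  · exact le_growthConst_mul (a := 0) (b := 2 * G ^ 3) hV hE hA (by linarith) hG (by linarith)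
  · refine le_growthConst_mul (a := 0) (b := G ^ 4) hV hE hA (by linarith) hG ?_
    have h2 := le_of_abs_le c4
    have : 0 ≤ G ^ 4 * E := by positivity
    linarith

/-! ### Expansion of the energy in the noise direction -/

section Energy

variable {D : Set Plane} [IsFiniteMeasure (volume.restrict D)] {C₄ : ℝ}

theorem EmbedsL4.energy_eq (hS : EmbedsL4 D C₄) (ε : ℝ) (u : H1 D) :
    energy ε u = ε / 2 * ‖u.grad‖ ^ 2 + 1 / ε * ∫ x in D, doubleWell (u.fn x) := by
  have hi2 : Integrable (fun x => ‖u.grad x‖ ^ 2) (volume.restrict D) :=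
    (Lp.memLp u.grad).integrable_norm_pow (by norm_num)
  rw [energy, integral_add (hi2.const_mul _) ((integrable_doubleWell (hS.memLp u)).const_mul _),
    integral_const_mul, integral_const_mul, norm_sq_L2Vec_eq]

theorem EmbedsL4.continuous_energy (hS : EmbedsL4 D C₄) (ε : ℝ) :
    Continuous (energy ε : H1 D → ℝ) := by
  have h : (energy ε : H1 D → ℝ) = fun u => ε / 2 * ‖u.grad‖ ^ 2 + 1 / ε *
      (1 / 4 * ((∫ x in D, u.fn x ^ 4) - 2 * ‖u.fn‖ ^ 2 + ∫ _ in D, (1 : ℝ))) := by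
    ext u
    rw [hS.energy_eq, norm_sq_L2_eq]
    congr 2
    obtain ⟨h4, -, -, -, h2, -, -⟩ := integrable_monomials (hS.memLp u) (hS.memLp u)
    rw [← integral_const_mul, ← integral_sub h4 (h2.const_mul 2),
      ← integral_add (by exact h4.sub (h2.const_mul 2)) (integrable_const _), ← integral_const_mul]
    refine integral_congr_ae (Eventually.of_forall fun x => ?_)
    simp only [doubleWell]; ring
  rw [h]
  have h4 := hS.continuous_integral_pow_four
  have h1 := H1.continuous_fn (D := D)
  have h2 := H1.continuous_grad (D := D)
  fun_prop

/-- The potential part of the energy alone controls the fourth power. This turns energy decay into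
the `L⁴` bound that the Lipschitz estimate for the step requires. -/
theorem EmbedsL4.integral_pow_four_le_energy (hS : EmbedsL4 D C₄) {ε : ℝ} (hε : 0 < ε) (u : H1 D) :
    ∫ x in D, u.fn x ^ 4 ≤ 8 * ε * energy ε u + 2 * (volume.restrict D).real Set.univ := by
  have i4 := (integrable_monomials (hS.memLp u) (hS.memLp u)).1
  have iF := integrable_doubleWell (hS.memLp u)
  have h : ∫ x in D, u.fn x ^ 4 ≤ ∫ x in D, (8 * doubleWell (u.fn x) + 2) :=
    integral_mono i4 ((iF.const_mul 8).add (integrable_const 2)) fun x => pow_four_le_doubleWell _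
  rw [integral_add (iF.const_mul 8) (integrable_const 2), integral_const_mul, integral_const,
    smul_eq_mul] at h
  have h2 := hS.energy_eq ε u
  have h3 : ∫ x in D, doubleWell (u.fn x) ≤ ε * energy ε u := by
    rw [h2, mul_add, ← mul_assoc ε (1 / ε), mul_one_div_cancel hε.ne', one_mul]
    have : 0 ≤ ε * (ε / 2 * ‖u.grad‖ ^ 2) := by positivity
    linarith
  linarith

theorem EmbedsL4.energy_add_smul (hS : EmbedsL4 D C₄) (ε : ℝ) (u v : H1 D) (c : ℝ) :
    energy ε (u + c • v) = energy ε u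
      + c * (ε * inner ℝ u.grad v.grad + 1 / ε * ∫ x in D, nonlin (u.fn x) * v.fn x)
      + c ^ 2 * (ε / 2 * ‖v.grad‖ ^ 2
        + 1 / ε * ∫ x in D, (3 * u.fn x ^ 2 - 1) / 2 * v.fn x ^ 2)
      + c ^ 3 * (1 / ε * ∫ x in D, u.fn x * v.fn x ^ 3)
      + c ^ 4 * (1 / ε * ∫ x in D, 1 / 4 * v.fn x ^ 4) := by
  rw [hS.energy_eq, hS.energy_eq]
  have h1 : ‖(u + c • v).grad‖ ^ 2
      = ‖u.grad‖ ^ 2 + 2 * c * inner ℝ u.grad v.grad + c ^ 2 * ‖v.grad‖ ^ 2 := by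
    rw [H1.grad_add, H1.grad_smul, norm_add_sq_real, inner_smul_right, norm_smul, mul_pow,
      Real.norm_eq_abs, sq_abs]
    ring
  have h2 : ∫ x in D, doubleWell ((u + c • v).fn x)
      = ∫ x in D, doubleWell (u.fn x + c * v.fn x) := by
    refine integral_congr_ae ?_
    filter_upwards [Lp.coeFn_add u.fn (c • v.fn), Lp.coeFn_smul c v.fn] with x hx hx'
    rw [H1.fn_add, H1.fn_smul, hx, Pi.add_apply, hx', Pi.smul_apply, smul_eq_mul]
  rw [h1, h2, integral_doubleWell_add (hS.memLp u) (hS.memLp v)]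
  ring

/-- The derivative of the energy at `u` in direction `v`, written as a difference quotient which is
exact for polynomials of degree four. -/
noncomputable def energyDeriv (ε : ℝ) (v u : H1 D) : ℝ :=
  (8 * (energy ε (u + (1 : ℝ) • v) - energy ε (u + (-1 : ℝ) • v))
    - (energy ε (u + (2 : ℝ) • v) - energy ε (u + (-2 : ℝ) • v))) / 12

theorem EmbedsL4.energyDeriv_eq (hS : EmbedsL4 D C₄) (ε : ℝ) (v u : H1 D) :
    energyDeriv ε v u
      = ε * inner ℝ u.grad v.grad + 1 / ε * ∫ x in D, nonlin (u.fn x) * v.fn x := by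
  simp only [energyDeriv, hS.energy_add_smul]
  ring

/-- The difference-quotient form pays off here: continuity is inherited from the energy, without a
separate argument for the cubic integral. It gives the measurability of the drift coefficient `μ`.
-/
theorem EmbedsL4.continuous_energyDeriv (hS : EmbedsL4 D C₄) (ε : ℝ) (v : H1 D) :
    Continuous (energyDeriv ε v) := by
  have h := hS.continuous_energy ε
  unfold energyDeriv
  fun_prop

theorem EmbedsL4.noise_coefficients_le (hS : EmbedsL4 D C₄) {ε s G : ℝ} (hε : 0 < ε) (hε1 : ε ≤ 1)
    (hs : 0 < s) (hsε : s ≤ ε) (hG : 0 ≤ G) {v : H1 D}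
    (hv : ∀ᵐ x ∂(volume.restrict D), |v.fn x| ≤ G) (u : H1 D) :
    |s * (ε * inner ℝ u.grad v.grad + 1 / ε * ∫ x in D, nonlin (u.fn x) * v.fn x)|
        ≤ growthConst ((volume.restrict D).real Set.univ) G ‖v.grad‖ * (energy ε u + 1) ∧
      s ^ 2 * (ε / 2 * ‖v.grad‖ ^ 2 + 1 / ε * ∫ x in D, (3 * u.fn x ^ 2 - 1) / 2 * v.fn x ^ 2)
        ≤ growthConst ((volume.restrict D).real Set.univ) G ‖v.grad‖ * (energy ε u + 1) ∧
      |s ^ 3 * (1 / ε * ∫ x in D, u.fn x * v.fn x ^ 3)|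
        ≤ growthConst ((volume.restrict D).real Set.univ) G ‖v.grad‖ * (energy ε u + 1) ∧
      s ^ 4 * (1 / ε * ∫ x in D, 1 / 4 * v.fn x ^ 4)
        ≤ growthConst ((volume.restrict D).real Set.univ) G ‖v.grad‖ * (energy ε u + 1) := by
  set V := (volume.restrict D).real Set.univ with hV
  have hV0 : 0 ≤ V := measureReal_nonneg
  have iF := integrable_doubleWell (hS.memLp u)
  set I := ∫ x in D, doubleWell (u.fn x) with hI
  have hI0 : 0 ≤ I := integral_doubleWell_nonneg u
  have iB : Integrable (fun x => 1 + 4 * doubleWell (u.fn x)) (volume.restrict D) :=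
    (integrable_const 1).add (iF.const_mul 4)
  have hB : ∫ x in D, (1 + 4 * doubleWell (u.fn x)) = V + 4 * I := by
    rw [integral_add (integrable_const 1) (iF.const_mul 4), integral_const_mul, integral_const]
    simp [hV, hI]
  set E := energy ε u with hE
  have hE0 : 0 ≤ E := energy_nonneg hε u
  have hEeq : E = ε / 2 * ‖u.grad‖ ^ 2 + 1 / ε * I := hS.energy_eq ε u
  have hgr : 0 ≤ ε / 2 * ‖u.grad‖ ^ 2 := by positivity
  have hIE : I ≤ E := by
    have h1 : I ≤ 1 / ε * I := le_mul_of_one_le_left hI0 (by rw [le_div_iff₀ hε]; linarith)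
    linarith
  have hpow : ∀ n : ℕ, ∀ᵐ x ∂(volume.restrict D), |v.fn x ^ n| ≤ G ^ n := fun n => by
    filter_upwards [hv] with x hx
    rw [abs_pow]; exact pow_le_pow_left₀ (abs_nonneg _) hx n
  have b1 : |∫ x in D, nonlin (u.fn x) * v.fn x| ≤ G * (V + 4 * E) := by
    have h := abs_integral_mul_le iB (fun x => abs_nonlin_le (u.fn x)) hv
    rw [hB] at h
    exact h.trans (by gcongr)
  have i2B := iB.const_mul 2
  have b2 : |∫ x in D, (3 * u.fn x ^ 2 - 1) / 2 * v.fn x ^ 2| ≤ G ^ 2 * (2 * (V + 4 * E)) := by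
    have h := abs_integral_mul_le i2B (fun x => abs_second_deriv_le (u.fn x)) (hpow 2)
    rw [integral_const_mul, hB] at h
    exact h.trans (by gcongr)
  have b3 : |∫ x in D, u.fn x * v.fn x ^ 3| ≤ G ^ 3 * (2 * (V + 4 * E)) := by
    have h := abs_integral_mul_le i2B (fun x => abs_le_doubleWell (u.fn x)) (hpow 3)
    rw [integral_const_mul, hB] at h
    exact h.trans (by gcongr)
  have b4 : |∫ x in D, 1 / 4 * v.fn x ^ 4| ≤ G ^ 4 * V := by
    have h := abs_integral_mul_le (f := fun _ => 1 / 4) (F := fun _ => 1)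
      (integrable_const (1 : ℝ)) (fun x => by norm_num [abs_of_pos]) (hpow 4)
    rw [integral_const] at h
    simpa [hV] using h
  have bi : |inner ℝ u.grad v.grad| * ε ≤ E + ‖v.grad‖ ^ 2 / 2 := by
    have h1 := abs_real_inner_le_norm u.grad v.grad
    have h2 : 2 * (‖u.grad‖ * ‖v.grad‖) ≤ ‖u.grad‖ ^ 2 + ‖v.grad‖ ^ 2 := by
      nlinarith [sq_nonneg (‖u.grad‖ - ‖v.grad‖)]
    have h3 : |inner ℝ u.grad v.grad| * ε ≤ (‖u.grad‖ ^ 2 + ‖v.grad‖ ^ 2) / 2 * ε := by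
      gcongr; linarith
    have h4 : ‖v.grad‖ ^ 2 * ε ≤ ‖v.grad‖ ^ 2 := mul_le_of_le_one_right (sq_nonneg _) hε1
    have h5 : 0 ≤ 1 / ε * I := by positivity
    nlinarith
  exact noise_coefficients_le_of_bounds hε hε1 hs hsε hG hV0 hE0 bi b1 b2 b3 b4

/-- Factor `energy + 1` out of the exact expansion. The linear term stays untouched because its mean
will vanish; the cubic one is bounded via `|d³| ≤ d² + d⁴`, and this is why the constant is doubled.
-/
theorem EmbedsL4.energy_noise_le (hS : EmbedsL4 D C₄) {ε s G : ℝ} (hε : 0 < ε) (hε1 : ε ≤ 1)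
    (hs : 0 < s) (hsε : s ≤ ε) (hG : 0 ≤ G) {v : H1 D}
    (hv : ∀ᵐ x ∂(volume.restrict D), |v.fn x| ≤ G) (u : H1 D) (d : ℝ) :
    |s * energyDeriv ε v u / (energy ε u + 1)| ≤ growthConst ((volume.restrict D).real Set.univ) G ‖v.grad‖ ∧
      energy ε (u + (s * d) • v) + 1 ≤ (energy ε u + 1)
        * (1 + s * energyDeriv ε v u / (energy ε u + 1) * d
          + 2 * growthConst ((volume.restrict D).real Set.univ) G ‖v.grad‖ * (d ^ 2 + d ^ 4)) := by
  obtain ⟨h1, h2, h3, h4⟩ := hS.noise_coefficients_le hε hε1 hs hsε hG hv u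
  rw [← hS.energyDeriv_eq] at h1
  have hY : 0 < energy ε u + 1 := by linarith [energy_nonneg hε u]
  refine ⟨by rw [abs_div, abs_of_pos hY, div_le_iff₀ hY]; exact h1, ?_⟩
  rw [hS.energy_add_smul, ← hS.energyDeriv_eq]
  set K := growthConst ((volume.restrict D).real Set.univ) G ‖v.grad‖ * (energy ε u + 1) with hK
  set a₂ := ε / 2 * ‖v.grad‖ ^ 2 + 1 / ε * ∫ x in D, (3 * u.fn x ^ 2 - 1) / 2 * v.fn x ^ 2
  set a₃ := 1 / ε * ∫ x in D, u.fn x * v.fn x ^ 3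
  set a₄ := 1 / ε * ∫ x in D, 1 / 4 * v.fn x ^ 4
  have hR : (energy ε u + 1) * (1 + s * energyDeriv ε v u / (energy ε u + 1) * d
      + 2 * growthConst ((volume.restrict D).real Set.univ) G ‖v.grad‖ * (d ^ 2 + d ^ 4))
      = energy ε u + 1 + s * energyDeriv ε v u * d + 2 * K * (d ^ 2 + d ^ 4) := by
    rw [hK]; field_simp
  rw [hR]
  have hK0 : 0 ≤ K := (abs_nonneg _).trans h1
  have e2 : (s * d) ^ 2 * a₂ ≤ K * d ^ 2 := by
    have := mul_le_mul_of_nonneg_right h2 (sq_nonneg d)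
    linarith [mul_pow s d 2, this, show (s * d) ^ 2 * a₂ = s ^ 2 * a₂ * d ^ 2 by ring]
  have e4 : (s * d) ^ 4 * a₄ ≤ K * d ^ 4 := by
    have := mul_le_mul_of_nonneg_right h4 (by positivity : 0 ≤ d ^ 4)
    linarith [show (s * d) ^ 4 * a₄ = s ^ 4 * a₄ * d ^ 4 by ring]
  have e3 : (s * d) ^ 3 * a₃ ≤ K * (d ^ 2 + d ^ 4) := by
    have hd : |d ^ 3| ≤ d ^ 2 + d ^ 4 := by
      rw [abs_le]; constructor <;> nlinarith [sq_nonneg (d * (d - 1)), sq_nonneg (d * (d + 1)),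
        sq_nonneg d, sq_nonneg (d ^ 2)]
    calc (s * d) ^ 3 * a₃ = s ^ 3 * a₃ * d ^ 3 := by ring
      _ ≤ |s ^ 3 * a₃| * |d ^ 3| := by rw [← abs_mul]; exact le_abs_self _
      _ ≤ K * (d ^ 2 + d ^ 4) := by gcongr
  linarith

end Energy

/-! ### One step of the implicit scheme -/

/-- `(X, w)` solves one step of the deterministic implicit scheme with step size `k`, starting
from `h`. -/
def SolvesStep {D : Set Plane} (ε k : ℝ) (h X w : H1 D) : Prop :=
  (∀ φ : H1 D, inner ℝ (X - h).fn φ.fn + k * inner ℝ w.grad φ.grad = 0) ∧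
  ∀ ψ : H1 D, ε * inner ℝ X.grad ψ.grad + 1 / ε * (∫ x in D, nonlin (X.fn x) * ψ.fn x)
    = inner ℝ w.fn ψ.fn

theorem inner_sub_L2_eq {D : Set Plane} (u v φ : L2 D) :
    inner ℝ (u - v) φ = ∫ x in D, (u x - v x) * φ x := by
  rw [inner_L2_eq]
  refine integral_congr_ae ?_
  filter_upwards [Lp.coeFn_sub u v] with x hx
  rw [hx, Pi.sub_apply]

/-- The noise can be absorbed into the initial value of the step. -/
theorem SolvesSchemeAlong.solvesStep {D : Set Plane} {g : Plane → ℝ} {s ε k : ℝ} {J : ℕ}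
    {u₀ gH : H1 D} (hg : gH.fn =ᵐ[volume.restrict D] g) {ΔW : ℕ → ℝ} {X w : ℕ → H1 D}
    (h : SolvesSchemeAlong g s ε k J u₀ ΔW X w) {j : ℕ} (hj : j < J) :
    SolvesStep ε k (X j + (s * ΔW j) • gH) (X (j + 1)) (w (j + 1)) := by
  obtain ⟨h1, h2⟩ := h.2 j hj
  refine ⟨fun φ => ?_, fun ψ => ?_⟩
  · have e := h1 φ
    have e1 : ∫ x in D, g x * φ.fn x = inner ℝ gH.fn φ.fn := by
      rw [inner_L2_eq]
      exact integral_congr_ae (by filter_upwards [hg] with x hx; rw [hx])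
    rw [← inner_sub_L2_eq, ← inner_L2Vec_eq, e1] at e
    rw [H1.fn_sub, H1.fn_add, H1.fn_smul, ← sub_sub, inner_sub_left, real_inner_smul_left]
    linarith
  · rw [inner_L2_eq, ← h2 ψ, inner_L2Vec_eq]

theorem fn_sub_ae {D : Set Plane} (u v : H1 D) :
    (u - v).fn =ᵐ[volume.restrict D] fun x => u.fn x - v.fn x :=
  Lp.coeFn_sub u.fn v.fn

/-- Each test function imposes a relation between continuous linear functionals, so the weak
gradient relation is closed. Completeness of `H¹(D)` is used to extend the solution map by limits.
-/
theorem isClosed_H1Submodule (D : Set Plane) :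
    IsClosed (H1Submodule D : Set (WithLp 2 (L2 D × L2Vec D))) := by
  have heq : (H1Submodule D : Set (WithLp 2 (L2 D × L2Vec D)))
      = ⋂ φ, ⋂ h : IsTestFunction D φ, ⋂ i : Fin 2,
        {p | inner ℝ p.fst ((h.memLp_partialDeriv i).toLp _)
          = - inner ℝ p.snd ((h.memLp.continuousLinearMap_comp
          (ContinuousLinearMap.toSpanSingleton ℝ (EuclideanSpace.single i (1 : ℝ)))).toLp _)} := by
    ext p
    simp only [Set.mem_iInter]
    refine forall_congr' fun φ => forall_congr' fun h => forall_congr' fun i => ?_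
    have e1 : inner ℝ p.fst ((h.memLp_partialDeriv i).toLp _)
        = ∫ x in D, p.fst x * partialDeriv i φ x := by
      rw [inner_L2_eq]
      exact integral_congr_ae
        (by filter_upwards [(h.memLp_partialDeriv i).coeFn_toLp] with x hx; rw [hx])
    have e2 : inner ℝ p.snd ((h.memLp.continuousLinearMap_comp
          (ContinuousLinearMap.toSpanSingleton ℝ (EuclideanSpace.single i (1 : ℝ)))).toLp _)
        = ∫ x in D, (p.snd x) i * φ x := by
      rw [inner_L2Vec_eq]
      refine integral_congr_ae ?_
      filter_upwards [(h.memLp.continuousLinearMap_comp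
          (ContinuousLinearMap.toSpanSingleton ℝ (EuclideanSpace.single i (1 : ℝ)))).coeFn_toLp] with x hx
      rw [hx, ContinuousLinearMap.toSpanSingleton_apply, real_inner_smul_right,
        EuclideanSpace.inner_single_right]
      simp [mul_comm]
    rw [Set.mem_ofPred_eq, e1, e2]
  rw [heq]
  refine isClosed_iInter fun φ => isClosed_iInter fun h => isClosed_iInter fun i => ?_
  have h1 : Continuous fun p : WithLp 2 (L2 D × L2Vec D) => p.fst := WithLp.continuous_fst 2 _ _
  have h2 : Continuous fun p : WithLp 2 (L2 D × L2Vec D) => p.snd := WithLp.continuous_snd 2 _ _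
  exact isClosed_eq (h1.inner continuous_const) (h2.inner continuous_const).neg

instance instCompleteSpaceH1 (D : Set Plane) : CompleteSpace (H1 D) :=
  (isClosed_H1Submodule D).completeSpace_coe

section Step

variable {D : Set Plane} [IsFiniteMeasure (volume.restrict D)] {C₄ : ℝ}

/-- Convexity of `F(s) + s²/2`, that is `F'' = 3s² - 1 ≥ -1`, in first-order form. -/
theorem nonlin_mul_sub_ge (a b : ℝ) :
    doubleWell a - doubleWell b - 1 / 2 * (a - b) ^ 2 ≤ nonlin a * (a - b) := by
  unfold doubleWell nonlin
  nlinarith [sq_nonneg ((a - b) * (a + b)), sq_nonneg ((a - b) * a)]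

/-- The implicit step decreases the energy. -/
theorem EmbedsL4.energy_step_le (hS : EmbedsL4 D C₄) {ε k : ℝ} (hε : 0 < ε) (hk : 0 < k)
    (hkε : k ≤ ε ^ 3) {h X w : H1 D} (hst : SolvesStep ε k h X w) :
    energy ε X + k / 2 * ‖w.grad‖ ^ 2 ≤ energy ε h := by
  obtain ⟨s1, s2⟩ := hst
  -- Testing with `w` and `X - h` gives the energy balance; the third test, `X - h` in the first
  -- equation, bounds `‖X - h‖²` by `k ‖∇w‖ ‖∇(X - h)‖`.
  have e1 := s1 w
  have e2 := s2 (X - h)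
  have e3 := s1 (X - h)
  rw [real_inner_self_eq_norm_sq] at e1
  rw [real_inner_comm (X - h).fn w.fn] at e2
  rw [real_inner_self_eq_norm_sq] at e3
  have hconv : (∫ x in D, doubleWell (X.fn x)) - (∫ x in D, doubleWell (h.fn x))
      - 1 / 2 * ‖(X - h).fn‖ ^ 2 ≤ ∫ x in D, nonlin (X.fn x) * (X - h).fn x := by
    have iX := integrable_doubleWell (hS.memLp X)
    have ih := integrable_doubleWell (hS.memLp h)
    have id := (integrable_monomials (hS.memLp (X - h)) (hS.memLp h)).2.2.2.2.1
    rw [norm_sq_L2_eq, ← integral_const_mul, ← integral_sub iX ih,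
      ← integral_sub (by exact iX.sub ih) (id.const_mul (1 / 2))]
    apply integral_mono_ae ((iX.sub ih).sub (id.const_mul (1 / 2)))
      (integrable_nonlin_mul (hS.memLp X) (hS.memLp (X - h)))
    filter_upwards [fn_sub_ae X h] with x hx
    simp only [hx, Pi.sub_apply]
    exact nonlin_mul_sub_ge _ _
  have hgrad : inner ℝ X.grad (X - h).grad
      = 1 / 2 * (‖X.grad‖ ^ 2 - ‖h.grad‖ ^ 2 + ‖(X - h).grad‖ ^ 2) := by
    rw [H1.grad_sub, inner_sub_right, norm_sub_sq_real, real_inner_self_eq_norm_sq]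
    ring
  have hcs : -(k * inner ℝ w.grad (X - h).grad) ≤ k * (‖w.grad‖ * ‖(X - h).grad‖) := by
    rw [← mul_neg]
    gcongr
    exact (neg_le_abs _).trans (abs_real_inner_le_norm _ _)
  rw [hS.energy_eq, hS.energy_eq]
  set IX := ∫ x in D, doubleWell (X.fn x)
  set Ih := ∫ x in D, doubleWell (h.fn x)
  set If := ∫ x in D, nonlin (X.fn x) * (X - h).fn x
  rw [hgrad] at e2
  set a := ‖(X - h).grad‖ with ha
  set b := ‖w.grad‖ with hb
  have hn : ‖(X - h).fn‖ ^ 2 ≤ k * (b * a) := by linarith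
  have hconv' : 1 / ε * (IX - Ih - 1 / 2 * (k * (b * a))) ≤ 1 / ε * If := by
    gcongr
    linarith
  -- The convexity defect is absorbed here. Young's inequality for `k b` and `ε² a`, together with
  -- `k² ≤ ε³ k`, leaves half of the dissipation `k b²`.
  have hab : 1 / ε * (1 / 2 * (k * (b * a))) ≤ ε / 2 * a ^ 2 + k / 2 * b ^ 2 := by
    have h1 : k ^ 2 * b ^ 2 ≤ ε ^ 3 * k * b ^ 2 := by
      rw [sq k]; gcongr
    have h2 : k * (b * a) ≤ ε * (ε * a ^ 2 + k * b ^ 2) := by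
      have h3 : 2 * (k * b) * (ε ^ 2 * a) ≤ (k * b) ^ 2 + (ε ^ 2 * a) ^ 2 :=
        two_mul_le_add_sq _ _
      have h4 : ε ^ 2 * (2 * (k * (b * a))) ≤ ε ^ 2 * (ε * (ε * a ^ 2 + k * b ^ 2)) + 0 := by
        nlinarith
      have h5 := le_of_mul_le_mul_left (by linarith) (by positivity : 0 < ε ^ 2)
      have : 0 ≤ b * a := by positivity
      nlinarith [mul_nonneg hk.le this]
    rw [one_div, inv_mul_le_iff₀ hε]
    linarith
  have hε' : 1 / ε * (IX - Ih - 1 / 2 * (k * (b * a)))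
      = 1 / ε * IX - 1 / ε * Ih - 1 / ε * (1 / 2 * (k * (b * a))) := by ring
  linarith

/-! ### Stability of the implicit step -/

/-- The cubic part of the difference is `q (a - b)` with `q = (a² + b² + (a + b)²) / 2 ≥ 0`. Its
contribution is at most `q h² / 2`, because `2 (a - b)(a - b - h) ≥ -h²`, and `q ≤ 3/2 (a² + b²)`.
-/
theorem nonlin_diff_mul_ge (a b h : ℝ) :
    -((nonlin a - nonlin b) * (a - b - h))
      ≤ 3 / 4 * (a ^ 2 * h ^ 2 + b ^ 2 * h ^ 2) + (a - b) ^ 2 - (a - b) * h := by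
  unfold nonlin
  nlinarith [mul_nonneg (add_nonneg (add_nonneg (sq_nonneg a) (sq_nonneg b)) (sq_nonneg (a + b)))
    (sq_nonneg (a - b - h)), mul_nonneg (add_nonneg (add_nonneg (sq_nonneg a) (sq_nonneg b))
    (sq_nonneg (a + b))) (sq_nonneg (a - b)), sq_nonneg ((a - b) * h)]

/-- The real-number core of the stability estimate for the implicit step. -/
theorem stability_of_bounds {ε k a b n H K : ℝ} (hε : 0 < ε) (hk : 0 < k) (hkε : k ≤ ε ^ 3)
    (h1 : ε * a ^ 2 + k * b ^ 2 ≤ ε * (a * H) + 1 / ε * (K * H ^ 2 + n ^ 2 + n * H))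
    (h2 : n ^ 2 ≤ H * n + k * (b * a)) :
    n ^ 2 + a ^ 2 ≤ (1 + (ε + 1 / ε) * (4 * (2 * ε + 1 / ε * (1 / 4 + 16 + 2 * K)))) * H ^ 2 := by
  set A := ε * a ^ 2 + k * b ^ 2 with hA
  have hA0 : 0 ≤ A := by positivity
  -- The same use of `k ≤ ε³` as in the energy decay. The factor `1 / 2` is essential: it lets the
  -- term `n² / ε` contribute only `A / 2` to the right-hand side of `h1`.
  have hab : k * (b * a) ≤ ε / 2 * A := by
    have h3 : k ^ 2 * b ^ 2 ≤ ε ^ 3 * k * b ^ 2 := by rw [sq k]; gcongr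
    have h4 : 2 * (k * b) * (ε ^ 2 * a) ≤ (k * b) ^ 2 + (ε ^ 2 * a) ^ 2 := two_mul_le_add_sq _ _
    have h5 : ε ^ 2 * (k * (b * a)) ≤ ε ^ 2 * (ε / 2 * A) := by rw [hA]; nlinarith
    exact le_of_mul_le_mul_left h5 (by positivity)
  have hn2 : n ^ 2 ≤ H ^ 2 + ε * A := by nlinarith [sq_nonneg (n - H)]
  have hn3 : 1 / ε * n ^ 2 ≤ 1 / ε * (H * n) + A / 2 := by
    have : 1 / ε * n ^ 2 ≤ 1 / ε * (H * n + ε / 2 * A) := by gcongr; linarith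
    refine this.trans (le_of_eq ?_)
    field_simp
  have h4 : 1 / ε * n ^ 2 ≤ 1 / ε * H ^ 2 + A := by
    have : 1 / ε * n ^ 2 ≤ 1 / ε * (H ^ 2 + ε * A) := by gcongr
    refine this.trans (le_of_eq ?_)
    field_simp
  have h5 : 1 / ε * (4 * (n * H)) ≤ 1 / ε * (n ^ 2 / 4 + 16 * H ^ 2) := by
    gcongr; nlinarith [sq_nonneg (n / 2 - 4 * H)]
  have h6 : ε * (2 * (a * H)) ≤ ε * (a ^ 2 / 2 + 2 * H ^ 2) := by
    gcongr; nlinarith [sq_nonneg (a / 2 - H)]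
  have h7 : ε * a ^ 2 ≤ A := by rw [hA]; have : 0 ≤ k * b ^ 2 := by positivity
                                linarith
  -- After doubling `h1`, the Young splittings `h5` and `h6` return `A / 4` and `A / 2`, so a
  -- quarter of `A` remains on the left; hence the factor `4`.
  have hAle : A ≤ 4 * (2 * ε + 1 / ε * (1 / 4 + 16 + 2 * K)) * H ^ 2 := by
    have e : 1 / ε * (K * H ^ 2 + n ^ 2 + n * H)
      = 1 / ε * (K * H ^ 2) + 1 / ε * n ^ 2 + 1 / ε * (n * H) := by ring
    linarith
  have ha2 : a ^ 2 ≤ 1 / ε * A := by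
    rw [one_div, ← div_eq_inv_mul, le_div_iff₀ hε]; linarith
  have : (ε + 1 / ε) * A
      ≤ (ε + 1 / ε) * (4 * (2 * ε + 1 / ε * (1 / 4 + 16 + 2 * K)) * H ^ 2) := by gcongr
  linarith

theorem EmbedsL4.integral_sq_mul_sq_le (hS : EmbedsL4 D C₄) (u h : H1 D) {Q : ℝ}
    (hQ : ∫ x in D, u.fn x ^ 4 ≤ Q) :
    ∫ x in D, u.fn x ^ 2 * h.fn x ^ 2 ≤ (Q + C₄) / 2 * ‖h‖ ^ 2 := by
  have i22 := (integrable_monomials (hS.memLp u) (hS.memLp h)).2.2.1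
  have iu := (integrable_monomials (hS.memLp u) (hS.memLp h)).1
  have ih := (integrable_monomials (hS.memLp h) (hS.memLp h)).1
  rcases eq_or_ne h 0 with rfl | hne
  · have : ∫ x in D, u.fn x ^ 2 * (0 : H1 D).fn x ^ 2 = ∫ _ in D, (0 : ℝ) := by
      refine integral_congr_ae ?_
      filter_upwards [Lp.coeFn_zero ℝ 2 (volume.restrict D)] with x hx
      change u.fn x ^ 2 * ((0 : L2 D) : Plane → ℝ) x ^ 2 = 0
      rw [hx]; simp
    rw [this]; simp
  · have hpos : 0 < ‖h‖ := norm_pos_iff.2 hne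
    -- The weight in Young's inequality, chosen so that the result is homogeneous of degree two in
    -- `h`; hence the separate case `h = 0`.
    set l := ‖h‖ ^ 2 with hl
    have hl0 : 0 < l := by positivity
    have hle : ∫ x in D, u.fn x ^ 2 * h.fn x ^ 2
        ≤ ∫ x in D, (l / 2 * u.fn x ^ 4 + 1 / (2 * l) * h.fn x ^ 4) := by
      apply integral_mono i22 ((iu.const_mul _).add (ih.const_mul _))
      intro x
      have h1 : 2 * (l * u.fn x ^ 2) * h.fn x ^ 2 ≤ (l * u.fn x ^ 2) ^ 2 + (h.fn x ^ 2) ^ 2 :=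
        two_mul_le_add_sq _ _
      have h2 : l / 2 * u.fn x ^ 4 + 1 / (2 * l) * h.fn x ^ 4
          = ((l * u.fn x ^ 2) ^ 2 + (h.fn x ^ 2) ^ 2) / (2 * l) := by field_simp
      change u.fn x ^ 2 * h.fn x ^ 2 ≤ l / 2 * u.fn x ^ 4 + 1 / (2 * l) * h.fn x ^ 4
      rw [h2, le_div_iff₀ (by positivity)]
      linarith
    rw [integral_add (iu.const_mul _) (ih.const_mul _), integral_const_mul,
      integral_const_mul] at hle
    have h3 : l / 2 * ∫ x in D, u.fn x ^ 4 ≤ l / 2 * Q := by gcongr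
    have h4 : 1 / (2 * l) * ∫ x in D, h.fn x ^ 4 ≤ C₄ / 2 * l := by
      have h5 : 1 / (2 * l) * ∫ x in D, h.fn x ^ 4 ≤ 1 / (2 * l) * (C₄ * ‖h‖ ^ 4) := by
        gcongr; exact hS.integral_le h
      refine h5.trans (le_of_eq ?_)
      have : ‖h‖ ^ 4 = l * l := by rw [hl]; ring
      rw [this]; field_simp
    linarith

theorem EmbedsL4.neg_integral_nonlin_diff_le (hS : EmbedsL4 D C₄) (X₁ X₂ h : H1 D) {Q : ℝ}
    (hQ₁ : ∫ x in D, X₁.fn x ^ 4 ≤ Q) (hQ₂ : ∫ x in D, X₂.fn x ^ 4 ≤ Q) :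
    -(∫ x in D, (nonlin (X₁.fn x) - nonlin (X₂.fn x)) * (X₁ - X₂ - h).fn x)
      ≤ 3 / 4 * (Q + C₄) * ‖h‖ ^ 2 + ‖(X₁ - X₂).fn‖ ^ 2 - inner ℝ (X₁ - X₂).fn h.fn := by
  have q₁ := hS.integral_sq_mul_sq_le X₁ h hQ₁
  have q₂ := hS.integral_sq_mul_sq_le X₂ h hQ₂
  have i1 := (integrable_monomials (hS.memLp X₁) (hS.memLp h)).2.2.1
  have i2 := (integrable_monomials (hS.memLp X₂) (hS.memLp h)).2.2.1
  obtain ⟨-, -, -, -, i3, i4, -⟩ := integrable_monomials (hS.memLp (X₁ - X₂)) (hS.memLp h)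
  have i0 : Integrable (fun x => (nonlin (X₁.fn x) - nonlin (X₂.fn x)) * (X₁ - X₂ - h).fn x)
      (volume.restrict D) := by
    simp only [sub_mul]
    exact (integrable_nonlin_mul (hS.memLp X₁) (hS.memLp _)).sub
      (integrable_nonlin_mul (hS.memLp X₂) (hS.memLp _))
  have i12 : Integrable (fun x => X₁.fn x ^ 2 * h.fn x ^ 2 + X₂.fn x ^ 2 * h.fn x ^ 2)
      (volume.restrict D) := i1.add i2
  have i123 : Integrable (fun x => 3 / 4 * (X₁.fn x ^ 2 * h.fn x ^ 2 + X₂.fn x ^ 2 * h.fn x ^ 2)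
      + (X₁ - X₂).fn x ^ 2) (volume.restrict D) := (i12.const_mul _).add i3
  have hle : ∫ x in D, -((nonlin (X₁.fn x) - nonlin (X₂.fn x)) * (X₁ - X₂ - h).fn x)
      ≤ ∫ x in D, (3 / 4 * (X₁.fn x ^ 2 * h.fn x ^ 2 + X₂.fn x ^ 2 * h.fn x ^ 2)
        + (X₁ - X₂).fn x ^ 2 - (X₁ - X₂).fn x * h.fn x) := by
    apply integral_mono_ae i0.neg (i123.sub i4)
    filter_upwards [fn_sub_ae (X₁ - X₂) h, fn_sub_ae X₁ X₂] with x hx hx'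
    have := nonlin_diff_mul_ge (X₁.fn x) (X₂.fn x) (h.fn x)
    rw [← hx', ← hx] at this
    exact this
  rw [integral_neg, integral_sub i123 i4, integral_add (i12.const_mul _) i3,
    integral_const_mul, integral_add i1 i2, ← norm_sq_L2_eq, ← inner_L2_eq] at hle
  linarith

/-- The stability constant of the implicit step, on the set of functions with `L⁴`-norm to the
fourth power at most `Q`. -/
noncomputable def stabilityConst (ε Q C₄ : ℝ) : ℝ :=
  1 + (ε + 1 / ε) * (4 * (2 * ε + 1 / ε * (1 / 4 + 16 + 2 * (3 / 4 * (Q + C₄)))))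

/-- Subtract the two steps and write `e`, `d`, `h` for the differences of `X`, `w` and the data.
Testing with `d` and with `e - h` makes the coupling `(d, e - h)` cancel; testing the first equation
with `e` controls the `L²` norm left by the nonconvex part. -/
theorem EmbedsL4.step_stability (hS : EmbedsL4 D C₄) {ε k : ℝ} (hε : 0 < ε) (hk : 0 < k)
    (hkε : k ≤ ε ^ 3) {h₁ h₂ X₁ X₂ w₁ w₂ : H1 D} {Q : ℝ} (st₁ : SolvesStep ε k h₁ X₁ w₁)
    (st₂ : SolvesStep ε k h₂ X₂ w₂) (hQ₁ : ∫ x in D, X₁.fn x ^ 4 ≤ Q)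
    (hQ₂ : ∫ x in D, X₂.fn x ^ 4 ≤ Q) :
    ‖X₁ - X₂‖ ^ 2 ≤ stabilityConst ε Q C₄ * ‖h₁ - h₂‖ ^ 2 := by
  have hmono := hS.neg_integral_nonlin_diff_le X₁ X₂ (h₁ - h₂) hQ₁ hQ₂
  have f1 : ∀ φ : H1 D, inner ℝ (X₁ - X₂ - (h₁ - h₂)).fn φ.fn
      + k * inner ℝ (w₁ - w₂).grad φ.grad = 0 := by
    intro φ
    have a1 := st₁.1 φ
    have a2 := st₂.1 φ
    simp only [H1.fn_sub, H1.grad_sub, inner_sub_left] at a1 a2 ⊢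
    linarith
  have f2 : ∀ ψ : H1 D, ε * inner ℝ (X₁ - X₂).grad ψ.grad
      + 1 / ε * (∫ x in D, (nonlin (X₁.fn x) - nonlin (X₂.fn x)) * ψ.fn x)
        = inner ℝ (w₁ - w₂).fn ψ.fn := by
    intro ψ
    have a1 := st₁.2 ψ
    have a2 := st₂.2 ψ
    have a3 : ∫ x in D, (nonlin (X₁.fn x) - nonlin (X₂.fn x)) * ψ.fn x
        = (∫ x in D, nonlin (X₁.fn x) * ψ.fn x) - ∫ x in D, nonlin (X₂.fn x) * ψ.fn x := by
      rw [← integral_sub (integrable_nonlin_mul (hS.memLp X₁) (hS.memLp ψ))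
        (integrable_nonlin_mul (hS.memLp X₂) (hS.memLp ψ))]
      simp only [sub_mul]
    rw [a3]
    simp only [H1.fn_sub, H1.grad_sub, inner_sub_left]
    linarith
  generalize X₁ - X₂ = e at *
  generalize w₁ - w₂ = d at *
  generalize h₁ - h₂ = h at *
  have g1 := f1 d
  have g2 := f2 (e - h)
  have g3 := f1 e
  rw [real_inner_self_eq_norm_sq] at g1
  rw [real_inner_comm (e - h).fn d.fn, H1.grad_sub e h, inner_sub_right,
    real_inner_self_eq_norm_sq] at g2
  rw [H1.fn_sub e h, inner_sub_left, real_inner_self_eq_norm_sq] at g3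
  have hH : ‖h.fn‖ ≤ ‖h‖ := h.norm_fn_le
  have hHg : ‖h.grad‖ ≤ ‖h‖ := h.norm_grad_le
  have c1 : inner ℝ e.grad h.grad ≤ ‖e.grad‖ * ‖h‖ :=
    (real_inner_le_norm _ _).trans (by gcongr)
  have c2 : -inner ℝ e.fn h.fn ≤ ‖e.fn‖ * ‖h‖ :=
    ((neg_le_abs _).trans (abs_real_inner_le_norm _ _)).trans (by gcongr)
  have c3 : inner ℝ h.fn e.fn ≤ ‖h‖ * ‖e.fn‖ :=
    (real_inner_le_norm _ _).trans (by gcongr)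
  have c4 : -inner ℝ d.grad e.grad ≤ ‖d.grad‖ * ‖e.grad‖ :=
    (neg_le_abs _).trans (abs_real_inner_le_norm _ _)
  have b1 : ε * ‖e.grad‖ ^ 2 + k * ‖d.grad‖ ^ 2 ≤ ε * (‖e.grad‖ * ‖h‖)
      + 1 / ε * (3 / 4 * (Q + C₄) * ‖h‖ ^ 2 + ‖e.fn‖ ^ 2 + ‖e.fn‖ * ‖h‖) := by
    have m1 : ε * inner ℝ e.grad h.grad ≤ ε * (‖e.grad‖ * ‖h‖) := by gcongr
    have m2 : 1 / ε * -(∫ x in D, (nonlin (X₁.fn x) - nonlin (X₂.fn x)) * (e - h).fn x)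
        ≤ 1 / ε * (3 / 4 * (Q + C₄) * ‖h‖ ^ 2 + ‖e.fn‖ ^ 2 + ‖e.fn‖ * ‖h‖) := by
      gcongr; linarith
    linarith
  have b2 : ‖e.fn‖ ^ 2 ≤ ‖h‖ * ‖e.fn‖ + k * (‖d.grad‖ * ‖e.grad‖) := by
    have m1 : k * -inner ℝ d.grad e.grad ≤ k * (‖d.grad‖ * ‖e.grad‖) := by gcongr
    linarith
  rw [H1.norm_sq e]
  exact stability_of_bounds hε hk hkε b1 b2

/-- Solutions of the implicit step depend Lipschitz continuously on the initial value, as long as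
the energy stays bounded. -/
theorem EmbedsL4.step_lipschitz (hS : EmbedsL4 D C₄) {ε k : ℝ} (hε : 0 < ε) (hk : 0 < k)
    (hkε : k ≤ ε ^ 3) (R : ℝ) :
    ∃ L : ℝ, 0 ≤ L ∧ ∀ h₁ h₂ X₁ X₂ w₁ w₂ : H1 D, SolvesStep ε k h₁ X₁ w₁ →
      SolvesStep ε k h₂ X₂ w₂ → energy ε h₁ ≤ R → energy ε h₂ ≤ R →
      ‖X₁ - X₂‖ ≤ L * ‖h₁ - h₂‖ := by
  set Q := 8 * ε * R + 2 * (volume.restrict D).real Set.univ with hQ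
  -- The maximum with `0` is needed because `R` is arbitrary and `Q` may be negative.
  refine ⟨√(max 0 (stabilityConst ε Q C₄)), Real.sqrt_nonneg _, ?_⟩
  intro h₁ h₂ X₁ X₂ w₁ w₂ st₁ st₂ hR₁ hR₂
  have hQX : ∀ h X w : H1 D, SolvesStep ε k h X w → energy ε h ≤ R →
      ∫ x in D, X.fn x ^ 4 ≤ Q := by
    intro h X w st hR
    have h1 := hS.energy_step_le hε hk hkε st
    have h2 := hS.integral_pow_four_le_energy hε X
    have h3 : 0 ≤ k / 2 * ‖w.grad‖ ^ 2 := by positivity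
    have h4 : 8 * ε * energy ε X ≤ 8 * ε * R := by gcongr; linarith
    linarith
  have hfin := hS.step_stability hε hk hkε st₁ st₂ (hQX _ _ _ st₁ hR₁) (hQX _ _ _ st₂ hR₂)
  calc ‖X₁ - X₂‖ = √(‖X₁ - X₂‖ ^ 2) := (Real.sqrt_sq (norm_nonneg _)).symm
    _ ≤ √(max 0 (stabilityConst ε Q C₄) * ‖h₁ - h₂‖ ^ 2) := by
      apply Real.sqrt_le_sqrt
      refine hfin.trans ?_
      gcongr
      exact le_max_right _ _
    _ = _ := by rw [Real.sqrt_mul (le_max_left _ _), Real.sqrt_sq (norm_nonneg _)]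

/-! ### Measurability of the solution map -/

/-- The solution map of the implicit step extends to a Borel map on `H¹(D)`. -/
theorem EmbedsL4.exists_measurable_solutionMap (hS : EmbedsL4 D C₄) {ε k : ℝ} (hε : 0 < ε)
    (hk : 0 < k) (hkε : k ≤ ε ^ 3) :
    ∃ Φ : H1 D → H1 D, Measurable[borel (H1 D), borel (H1 D)] Φ ∧
      ∀ h X w : H1 D, SolvesStep ε k h X w → Φ h = X := by
  classical
  let _ : MeasurableSpace (H1 D) := borel (H1 D)
  have : BorelSpace (H1 D) := ⟨rfl⟩
  set S : Set (H1 D) := {h | ∃ X w, SolvesStep ε k h X w} with hSdef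
  have hex : ∀ h : H1 D, ∃ X : H1 D, h ∈ S → ∃ w, SolvesStep ε k h X w := by
    intro h
    by_cases hh : h ∈ S
    · obtain ⟨X, w, hw⟩ := hh
      exact ⟨X, fun _ => ⟨w, hw⟩⟩
    · exact ⟨0, fun h' => absurd h' hh⟩
  choose f hf using hex
  have hE := hS.continuous_energy ε (D := D)
  -- The centre `x` ranges over all of `H¹(D)`, not just over solvable data: continuity of the
  -- energy bounds it near any point, which gives limits also on the boundary of `S`.
  have hlip : ∀ x : H1 D, ∃ L : ℝ, 0 ≤ L ∧ ∃ U ∈ 𝓝 x, ∀ h₁ ∈ S ∩ U, ∀ h₂ ∈ S ∩ U,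
      ‖f h₁ - f h₂‖ ≤ L * ‖h₁ - h₂‖ := by
    intro x
    obtain ⟨L, hL0, hL⟩ := hS.step_lipschitz hε hk hkε (energy ε x + 1)
    refine ⟨L, hL0, {h | energy ε h < energy ε x + 1},
      hE.continuousAt.eventually (gt_mem_nhds (by linarith)), ?_⟩
    rintro h₁ ⟨hs₁, hu₁⟩ h₂ ⟨hs₂, hu₂⟩
    obtain ⟨w₁, hw₁⟩ := hf h₁ hs₁
    obtain ⟨w₂, hw₂⟩ := hf h₂ hs₂
    exact hL _ _ _ _ _ _ hw₁ hw₂ (le_of_lt hu₁) (le_of_lt hu₂)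
  have hlim : ∀ x ∈ closure S, ∃ y, Tendsto f (𝓝[S] x) (𝓝 y) := by
    intro x hx
    have hne : (𝓝[S] x).NeBot := mem_closure_iff_nhdsWithin_neBot.1 hx
    refine cauchy_map_iff_exists_tendsto.1 (Metric.cauchy_iff.2 ⟨hne.map f, fun δ hδ => ?_⟩)
    obtain ⟨L, hL0, U, hU, hL⟩ := hlip x
    set ρ := δ / (2 * (L + 1)) with hρ
    have hρ0 : 0 < ρ := by positivity
    refine ⟨f '' (S ∩ U ∩ Metric.ball x ρ), image_mem_map ?_, ?_⟩
    · exact inter_mem (inter_mem self_mem_nhdsWithin (mem_nhdsWithin_of_mem_nhds hU))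
        (mem_nhdsWithin_of_mem_nhds (Metric.ball_mem_nhds x hρ0))
    · rintro _ ⟨h₁, ⟨m₁, b₁⟩, rfl⟩ _ ⟨h₂, ⟨m₂, b₂⟩, rfl⟩
      rw [dist_eq_norm]
      have hd : ‖h₁ - h₂‖ < 2 * ρ := by
        rw [← dist_eq_norm]
        have := dist_triangle_right h₁ h₂ x
        rw [Metric.mem_ball] at b₁ b₂
        linarith
      calc ‖f h₁ - f h₂‖ ≤ L * ‖h₁ - h₂‖ := hL _ m₁ _ m₂
        _ ≤ L * (2 * ρ) := by gcongr
        _ < (L + 1) * (2 * ρ) := by gcongr; linarith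
        _ = δ := by rw [hρ]; field_simp
  have hval : ∀ x ∈ S, extendFrom S f x = f x := by
    intro x hx
    refine extendFrom_eq (subset_closure hx) ?_
    obtain ⟨L, hL0, U, hU, hL⟩ := hlip x
    rw [tendsto_iff_norm_sub_tendsto_zero]
    have hz : Tendsto (fun h => L * ‖h - x‖) (𝓝[S] x) (𝓝 0) := by
      have : Tendsto (fun h => L * ‖h - x‖) (𝓝 x) (𝓝 (L * ‖x - x‖)) :=
        Continuous.tendsto (by fun_prop) x
      rw [sub_self, norm_zero, mul_zero] at this
      exact this.mono_left nhdsWithin_le_nhds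
    refine squeeze_zero' (Eventually.of_forall fun _ => norm_nonneg _) ?_ hz
    filter_upwards [self_mem_nhdsWithin, mem_nhdsWithin_of_mem_nhds hU] with h hs hu
    exact hL _ ⟨hs, hu⟩ _ ⟨hx, mem_of_mem_nhds hU⟩
  -- The set `S` is not known to be Borel, but its closure is, and `f` extends continuously to it;
  -- off the closure the value is irrelevant.
  refine ⟨(closure S).piecewise (extendFrom S f) 0, ?_, ?_⟩
  · exact ContinuousOn.measurable_piecewise (continuousOn_extendFrom subset_rfl hlim)
      continuousOn_const isClosed_closure.measurableSet
  · intro h X w hst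
    have hmem : h ∈ S := ⟨X, w, hst⟩
    rw [Set.piecewise_eq_of_mem _ _ _ (subset_closure hmem), hval h hmem]
    obtain ⟨w', hw'⟩ := hf h hmem
    -- Equal data on both sides: the Lipschitz bound becomes uniqueness of `X`.
    obtain ⟨L, -, hL⟩ := hS.step_lipschitz hε hk hkε (energy ε h)
    have := hL _ _ _ _ _ _ hw' hst le_rfl le_rfl
    rw [sub_self, norm_zero, mul_zero] at this
    exact sub_eq_zero.1 (norm_le_zero_iff.1 this)

end Step

/-! ### Gaussian increments -/

/-- The moment `E[Z² (1 + Z²)ⁿ]` of a standard Gaussian. -/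
noncomputable def gaussMoment (n : ℕ) : ℝ := ∫ x, x ^ 2 * (1 + x ^ 2) ^ n ∂gaussianReal 0 1

theorem gaussMoment_nonneg (n : ℕ) : 0 ≤ gaussMoment n :=
  integral_nonneg fun x => by positivity

theorem integrable_pow_gaussianReal (v : ℝ≥0) (n : ℕ) :
    Integrable (fun x : ℝ => x ^ n) (gaussianReal 0 v) := by
  have h := memLp_id_gaussianReal (μ := 0) (v := v) n
  rcases Nat.eq_zero_or_pos n with rfl | hn
  · simp
  · have h2 := (MemLp.integrable_norm_pow (p := n) (by exact_mod_cast h) hn.ne')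
    refine (integrable_norm_iff (by fun_prop)).1 (h2.congr (Eventually.of_forall fun x => ?_))
    simp

theorem integrable_sq_mul_gaussianReal (v : ℝ≥0) (n : ℕ) :
    Integrable (fun x : ℝ => x ^ 2 * (1 + x ^ 2) ^ n) (gaussianReal 0 v) := by
  have : (fun x : ℝ => x ^ 2 * (1 + x ^ 2) ^ n)
      = fun x => ∑ m ∈ Finset.range (n + 1), (n.choose m : ℝ) * x ^ (2 + 2 * (n - m)) := by
    ext x
    rw [add_pow, Finset.mul_sum]
    refine Finset.sum_congr rfl fun m _ => ?_
    rw [one_pow, pow_add, pow_mul]; ring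
  rw [this]
  exact integrable_finsetSum _ fun m _ => (integrable_pow_gaussianReal v _).const_mul _

/-- Scale to a standard Gaussian by `√k`: the square yields the factor `k`, and `k ≤ 1` lets it be
dropped from the other factors. This factor makes the sum of the remainders over all steps of order
`T`. -/
theorem integral_sq_mul_gaussianReal_le {k : ℝ} (hk : 0 < k) (hk1 : k ≤ 1) (n : ℕ) :
    ∫ x, x ^ 2 * (1 + x ^ 2) ^ n ∂gaussianReal 0 k.toNNReal ≤ k * gaussMoment n := by
  have hmap : gaussianReal 0 k.toNNReal = (gaussianReal 0 1).map (fun x => √k * x) := by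
    rw [gaussianReal_map_const_mul]
    congr 1
    · simp
    · ext; simp [Real.sq_sqrt hk.le, hk.le]
  rw [hmap, integral_map (by fun_prop) (by fun_prop), gaussMoment, ← integral_const_mul]
  apply integral_mono_of_nonneg (Eventually.of_forall fun x => by positivity)
    ((integrable_sq_mul_gaussianReal 1 n).const_mul k)
  refine Eventually.of_forall fun x => ?_
  change (√k * x) ^ 2 * (1 + (√k * x) ^ 2) ^ n ≤ k * (x ^ 2 * (1 + x ^ 2) ^ n)
  rw [mul_pow, Real.sq_sqrt hk.le, mul_assoc]
  gcongr
  nlinarith [sq_nonneg x]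

section Increment

variable {Ω : Type*} {m : MeasurableSpace Ω} {mΩ : MeasurableSpace Ω} {P : Measure Ω} {Δ : Ω → ℝ} {k : ℝ}

theorem integrable_comp_of_map_eq (hΔ : Measurable Δ)
    (hlaw : P.map Δ = gaussianReal 0 k.toNNReal) {φ : ℝ → ℝ}
    (hφ : Integrable φ (gaussianReal 0 k.toNNReal)) : Integrable (fun ω => φ (Δ ω)) P := by
  rw [← hlaw] at hφ
  exact hφ.comp_measurable hΔ

theorem integral_comp_of_map_eq (hΔ : Measurable Δ)
    (hlaw : P.map Δ = gaussianReal 0 k.toNNReal) {φ : ℝ → ℝ} (hφ : Continuous φ) :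
    ∫ ω, φ (Δ ω) ∂P = ∫ x, φ x ∂gaussianReal 0 k.toNNReal := by
  rw [← hlaw, integral_map hΔ.aemeasurable hφ.aestronglyMeasurable]

theorem indepFun_of_aestronglyMeasurable {f : Ω → ℝ} (hf : AEStronglyMeasurable[m] f P)
    (hind : Indep (MeasurableSpace.comap Δ (borel ℝ)) m P) : IndepFun f Δ P := by
  obtain ⟨g, hg, hfg⟩ := hf
  have h : IndepFun g Δ P := by
    rw [IndepFun_iff_Indep]
    have h1 := indep_of_indep_of_le_right hind hg.measurable.comap_le
    have hb : (borel ℝ) = (inferInstance : MeasurableSpace ℝ) := (BorelSpace.measurable_eq).symm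
    rw [hb] at h1
    exact h1.symm
  exact h.congr hfg.symm (ae_eq_refl _)

theorem integrable_mul_comp [IsFiniteMeasure P] (hΔ : Measurable Δ)
    (hlaw : P.map Δ = gaussianReal 0 k.toNNReal)
    (hind : Indep (MeasurableSpace.comap Δ (borel ℝ)) m P) {f : Ω → ℝ}
    (hf : AEStronglyMeasurable[m] f P) (hfi : Integrable f P) {φ : ℝ → ℝ} (hφ : Continuous φ)
    (hφi : Integrable φ (gaussianReal 0 k.toNNReal)) :
    Integrable (fun ω => f ω * φ (Δ ω)) P ∧
      ∫ ω, f ω * φ (Δ ω) ∂P = (∫ ω, f ω ∂P) * ∫ x, φ x ∂gaussianReal 0 k.toNNReal := by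
  have h1 : IndepFun f (φ ∘ Δ) P :=
    (indepFun_of_aestronglyMeasurable hf hind).comp measurable_id hφ.measurable
  have h2 := integrable_comp_of_map_eq hΔ hlaw hφi
  refine ⟨h1.integrable_mul hfi h2, ?_⟩
  rw [← integral_comp_of_map_eq hΔ hlaw hφ]
  exact h1.integral_mul_eq_mul_integral hfi.aestronglyMeasurable h2.aestronglyMeasurable

end Increment

/-- Powers of the one-step growth factor. -/
theorem exists_growth_factor_pow_bound {C : ℝ} (hC : 0 ≤ C) (p : ℕ) :
    ∃ A : ℝ, 0 ≤ A ∧ ∀ μ x : ℝ, |μ| ≤ C →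
      |(1 + μ * x + C * (x ^ 2 + x ^ 4)) ^ p - 1 - p * μ * x| ≤ A * (x ^ 2 * (1 + x ^ 2) ^ (2 * p)) := by
  induction p with
  | zero => exact ⟨0, le_rfl, fun μ x _ => by simp⟩
  | succ p ih =>
    obtain ⟨A, hA, h⟩ := ih
    -- The summands bound, in order, the four terms of the recursion `hid`. The growth factor is at
    -- most `(1 + 2 C) (1 + x²)²`, so each further power raises the exponent of `1 + x²` by two.
    refine ⟨p * C ^ 2 + C + p * C ^ 2 + A * (1 + 2 * C), by positivity, fun μ x hμ => ?_⟩
    set r := C * (x ^ 2 + x ^ 4) with hr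
    set R := (1 + μ * x + r) ^ p - 1 - p * μ * x with hR
    have hRle := h μ x hμ
    set q := 1 + x ^ 2 with hq
    have hq1 : 1 ≤ q := by rw [hq]; nlinarith [sq_nonneg x]
    have hx1 : |x| ≤ q := by
      rw [hq, abs_le]; constructor <;> nlinarith [sq_nonneg (x - 1), sq_nonneg (x + 1)]
    have hrq : r = C * (x ^ 2 * q) := by rw [hr, hq]; ring
    have hid : (1 + μ * x + r) ^ (p + 1) - 1 - ((p + 1 : ℕ) : ℝ) * μ * x
        = p * μ ^ 2 * x ^ 2 + r + p * μ * x * r + R * (1 + μ * x + r) := by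
      rw [hR]; push_cast; ring
    rw [hid]
    have hqp : ∀ i, i ≤ 2 * (p + 1) → q ^ i ≤ q ^ (2 * (p + 1)) := fun i hi =>
      pow_le_pow_right₀ hq1 hi
    have hμ2 : μ ^ 2 ≤ C ^ 2 := by rw [← sq_abs]; exact pow_le_pow_left₀ (abs_nonneg _) hμ 2
    have t1 : |p * μ ^ 2 * x ^ 2| ≤ p * C ^ 2 * (x ^ 2 * q ^ (2 * (p + 1))) := by
      rw [abs_of_nonneg (by positivity)]
      have : x ^ 2 * 1 ≤ x ^ 2 * q ^ (2 * (p + 1)) := by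
        gcongr; exact one_le_pow₀ hq1
      calc p * μ ^ 2 * x ^ 2 = p * μ ^ 2 * (x ^ 2 * 1) := by ring
        _ ≤ _ := by gcongr
    have hr0 : 0 ≤ r := by rw [hrq]; positivity
    have t2 : |r| ≤ C * (x ^ 2 * q ^ (2 * (p + 1))) := by
      rw [abs_of_nonneg hr0, hrq]
      gcongr
      exact le_self_pow₀ hq1 (by omega)
    have t3 : |p * μ * x * r| ≤ p * C ^ 2 * (x ^ 2 * q ^ (2 * (p + 1))) := by
      rw [abs_mul, abs_mul, abs_mul, abs_of_nonneg hr0, hrq, Nat.abs_cast]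
      calc (p : ℝ) * |μ| * |x| * (C * (x ^ 2 * q)) ≤ p * C * q * (C * (x ^ 2 * q)) := by gcongr
        _ = p * C ^ 2 * (x ^ 2 * q ^ 2) := by ring
        _ ≤ _ := by gcongr; omega
    have t4 : |R * (1 + μ * x + r)| ≤ A * (1 + 2 * C) * (x ^ 2 * q ^ (2 * (p + 1))) := by
      have hf : |1 + μ * x + r| ≤ (1 + 2 * C) * q ^ 2 := by
        have h1 : |μ * x| ≤ C * q := by rw [abs_mul]; gcongr
        have h2 : r ≤ C * (q * q) := by rw [hrq]; gcongr; rw [hq]; linarith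
        have h3 : C * q ≤ C * (q * q) := by gcongr; nlinarith
        have h4 : |1 + μ * x + r| ≤ 1 + |μ * x| + r := by
          refine (abs_add_le _ _).trans ?_
          rw [abs_of_nonneg hr0]
          have := abs_add_le 1 (μ * x)
          rw [abs_one] at this
          linarith
        nlinarith
      rw [abs_mul]
      calc |R| * |1 + μ * x + r| ≤ A * (x ^ 2 * q ^ (2 * p)) * ((1 + 2 * C) * q ^ 2) := by gcongr
        _ = _ := by ring
    have s1 := abs_add_le (p * μ ^ 2 * x ^ 2 + r + p * μ * x * r) (R * (1 + μ * x + r))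
    have s2 := abs_add_le (p * μ ^ 2 * x ^ 2 + r) (p * μ * x * r)
    have s3 := abs_add_le (p * μ ^ 2 * x ^ 2) r
    linarith

/-! ### Processes with multiplicative Gaussian growth -/

/-- A process `Y ≥ 1` which in each step grows at most by the factor `1 + μ Δ + C (Δ² + Δ⁴)`, with
adapted bounded `μ` and independent centred Gaussian increments `Δ` of variance `k`. -/
structure GaussianGrowth {Ω : Type*} [mΩ : MeasurableSpace Ω] (P : Measure Ω) (C T k : ℝ) (J : ℕ)
    (𝒢 : ℕ → MeasurableSpace Ω) (Y μ a Δ : ℕ → Ω → ℝ) (y₀ : ℝ) : Prop where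
  k_pos : 0 < k
  k_le : k ≤ 1
  time : k * J ≤ T
  le : ∀ j ≤ J, 𝒢 j ≤ mΩ
  mono : ∀ i j, i ≤ j → j ≤ J → 𝒢 i ≤ 𝒢 j
  meas_Y : ∀ j ≤ J, AEStronglyMeasurable[𝒢 j] (Y j) P
  meas_μ : ∀ j < J, AEStronglyMeasurable[𝒢 j] (μ j) P
  meas_Δ : ∀ j < J, Measurable[𝒢 (j + 1)] (Δ j)
  meas_a : ∀ j < J, AEStronglyMeasurable (a (j + 1)) P
  law : ∀ j < J, P.map (Δ j) = gaussianReal 0 k.toNNReal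
  indep : ∀ j < J, Indep (MeasurableSpace.comap (Δ j) (borel ℝ)) (𝒢 j) P
  start : ∀ᵐ ω ∂P, Y 0 ω = y₀
  one_le : ∀ᵐ ω ∂P, ∀ j ≤ J, 1 ≤ Y j ω
  bound_μ : ∀ᵐ ω ∂P, ∀ j < J, |μ j ω| ≤ C
  a_nonneg : ∀ᵐ ω ∂P, ∀ j < J, 0 ≤ a (j + 1) ω
  step : ∀ᵐ ω ∂P, ∀ j < J, Y (j + 1) ω + a (j + 1) ω
    ≤ Y j ω * (1 + μ j ω * Δ j ω + C * (Δ j ω ^ 2 + Δ j ω ^ 4))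

namespace GaussianGrowth

variable {Ω : Type*} [mΩ : MeasurableSpace Ω] {P : Measure Ω}
  {C T k : ℝ} {J : ℕ} {𝒢 : ℕ → MeasurableSpace Ω} {Y μ a Δ : ℕ → Ω → ℝ} {y₀ : ℝ}

theorem one_le_start [IsProbabilityMeasure P] (H : GaussianGrowth P C T k J 𝒢 Y μ a Δ y₀) : 1 ≤ y₀ := by
  obtain ⟨ω, h1, h2⟩ := (H.start.and H.one_le).exists
  exact h1 ▸ h2 0 (Nat.zero_le _)

theorem measurable_Δ (H : GaussianGrowth P C T k J 𝒢 Y μ a Δ y₀) {j : ℕ} (hj : j < J) :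
    Measurable (Δ j) :=
  (H.meas_Δ j hj).mono (H.le (j + 1) hj) le_rfl

theorem integral_mul_Δ [IsFiniteMeasure P] (H : GaussianGrowth P C T k J 𝒢 Y μ a Δ y₀) {j : ℕ} (hj : j < J)
    {f : Ω → ℝ} (hf : AEStronglyMeasurable[𝒢 j] f P) (hfi : Integrable f P) :
    Integrable (fun ω => f ω * Δ j ω) P ∧ ∫ ω, f ω * Δ j ω ∂P = 0 := by
  have h := integrable_mul_comp (H.measurable_Δ hj) (H.law j hj) (H.indep j hj) hf hfi
    (φ := fun x => x) continuous_id (by simpa using integrable_pow_gaussianReal k.toNNReal 1)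
  rw [integral_id_gaussianReal, mul_zero] at h
  exact h

theorem integral_mul_moment [IsFiniteMeasure P] (H : GaussianGrowth P C T k J 𝒢 Y μ a Δ y₀) {j : ℕ} (hj : j < J)
    {f : Ω → ℝ} (hf : AEStronglyMeasurable[𝒢 j] f P) (hfi : Integrable f P)
    (hf0 : 0 ≤ ∫ ω, f ω ∂P) (n : ℕ) :
    Integrable (fun ω => f ω * (Δ j ω ^ 2 * (1 + Δ j ω ^ 2) ^ n)) P ∧
      ∫ ω, f ω * (Δ j ω ^ 2 * (1 + Δ j ω ^ 2) ^ n) ∂P ≤ (∫ ω, f ω ∂P) * (k * gaussMoment n) := by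
  have h := integrable_mul_comp (H.measurable_Δ hj) (H.law j hj) (H.indep j hj) hf hfi
    (φ := fun x => x ^ 2 * (1 + x ^ 2) ^ n) (by fun_prop) (integrable_sq_mul_gaussianReal _ n)
  refine ⟨h.1, h.2.le.trans ?_⟩
  gcongr
  exact integral_sq_mul_gaussianReal_le H.k_pos H.k_le n

/-- The additive form needed for expectations: an adapted factor times a centred increment, plus a
remainder whose mean is `O(k)` times that of `Y ^ p`. -/
theorem pow_step (H : GaussianGrowth P C T k J 𝒢 Y μ a Δ y₀) {p : ℕ} {A : ℝ}
    (hA : ∀ μ x : ℝ, |μ| ≤ C → |(1 + μ * x + C * (x ^ 2 + x ^ 4)) ^ p - 1 - p * μ * x|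
      ≤ A * (x ^ 2 * (1 + x ^ 2) ^ (2 * p))) :
    ∀ᵐ ω ∂P, ∀ j < J, Y (j + 1) ω ^ p ≤ Y j ω ^ p + Y j ω ^ p * (p * μ j ω) * Δ j ω
      + A * (Y j ω ^ p * (Δ j ω ^ 2 * (1 + Δ j ω ^ 2) ^ (2 * p))) := by
  filter_upwards [H.one_le, H.bound_μ, H.a_nonneg, H.step] with ω h1 h2 h3 h4 j hj
  have hY := h1 j hj.le
  have hY' := h1 (j + 1) hj
  have h5 : Y (j + 1) ω ≤ Y j ω * (1 + μ j ω * Δ j ω + C * (Δ j ω ^ 2 + Δ j ω ^ 4)) := by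
    linarith [h4 j hj, h3 j hj]
  have h6 := pow_le_pow_left₀ (by linarith) h5 p
  rw [mul_pow] at h6
  have h7 := le_of_abs_le (hA (μ j ω) (Δ j ω) (h2 j hj))
  have h8 : Y j ω ^ p * (1 + μ j ω * Δ j ω + C * (Δ j ω ^ 2 + Δ j ω ^ 4)) ^ p
      ≤ Y j ω ^ p * (1 + p * μ j ω * Δ j ω
        + A * (Δ j ω ^ 2 * (1 + Δ j ω ^ 2) ^ (2 * p))) := by
    gcongr
    linarith
  calc _ ≤ _ := h6.trans h8
    _ = _ := by ring

theorem meas_pow (H : GaussianGrowth P C T k J 𝒢 Y μ a Δ y₀) {j : ℕ} (hj : j ≤ J) (p : ℕ) :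
    AEStronglyMeasurable[𝒢 j] (fun ω => Y j ω ^ p) P := (H.meas_Y j hj).pow p

theorem meas_coeff (H : GaussianGrowth P C T k J 𝒢 Y μ a Δ y₀) {j : ℕ} (hj : j < J) (p : ℕ) :
    AEStronglyMeasurable[𝒢 j] (fun ω => Y j ω ^ p * (p * μ j ω)) P :=
  (H.meas_pow hj.le p).mul ((H.meas_μ j hj).const_mul _)

theorem integrable_coeff (H : GaussianGrowth P C T k J 𝒢 Y μ a Δ y₀) {j : ℕ} (hj : j < J) (p : ℕ)
    (h : Integrable (fun ω => Y j ω ^ p) P) :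
    Integrable (fun ω => Y j ω ^ p * (p * μ j ω)) P := by
  refine h.mul_bdd (c := p * C)
    (((H.meas_μ j hj).mono (H.le j hj.le)).const_mul _) ?_
  filter_upwards [H.bound_μ] with ω hω
  rw [norm_mul, Real.norm_natCast, Real.norm_eq_abs]
  gcongr
  exact hω j hj

/-- Moments grow at most exponentially in time. -/
theorem integrable_pow [IsProbabilityMeasure P] (H : GaussianGrowth P C T k J 𝒢 Y μ a Δ y₀) {p : ℕ} {A : ℝ} (hA0 : 0 ≤ A)
    (hA : ∀ μ x : ℝ, |μ| ≤ C → |(1 + μ * x + C * (x ^ 2 + x ^ 4)) ^ p - 1 - p * μ * x|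
      ≤ A * (x ^ 2 * (1 + x ^ 2) ^ (2 * p))) {j : ℕ} (hj : j ≤ J) :
    Integrable (fun ω => Y j ω ^ p) P ∧
      ∫ ω, Y j ω ^ p ∂P ≤ Real.exp (A * gaussMoment (2 * p) * T) * y₀ ^ p := by
  have hm := gaussMoment_nonneg (2 * p)
  have hy0 := H.one_le_start
  have hk := H.k_pos
  -- Discrete Gronwall: each step multiplies the moment by at most `1 + c k ≤ exp (c k)`, and the
  -- total time is at most `T`.
  suffices h : Integrable (fun ω => Y j ω ^ p) P ∧
      ∫ ω, Y j ω ^ p ∂P ≤ (1 + A * gaussMoment (2 * p) * k) ^ j * y₀ ^ p by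
    refine ⟨h.1, h.2.trans ?_⟩
    gcongr
    have h1 : 1 + A * gaussMoment (2 * p) * k ≤ Real.exp (A * gaussMoment (2 * p) * k) := by
      linarith [Real.add_one_le_exp (A * gaussMoment (2 * p) * k)]
    calc (1 + A * gaussMoment (2 * p) * k) ^ j ≤ Real.exp (A * gaussMoment (2 * p) * k) ^ j := by
          gcongr
      _ = Real.exp (A * gaussMoment (2 * p) * (k * j)) := by
          rw [← Real.exp_nat_mul]; congr 1; ring
      _ ≤ _ := by
          gcongr
          refine le_trans ?_ H.time
          gcongr
  induction j with
  | zero =>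
    have h0 : (fun ω => Y 0 ω ^ p) =ᵐ[P] fun _ => y₀ ^ p := by
      filter_upwards [H.start] with ω hω; rw [hω]
    refine ⟨(integrable_const _).congr h0.symm, ?_⟩
    rw [integral_congr_ae h0]; simp
  | succ j ih =>
    have hjJ : j < J := hj
    obtain ⟨ihi, ihb⟩ := ih hjJ.le
    have hnn : 0 ≤ ∫ ω, Y j ω ^ p ∂P := by
      apply integral_nonneg_of_ae
      filter_upwards [H.one_le] with ω hω
      have := hω j hjJ.le
      change 0 ≤ Y j ω ^ p
      positivity
    obtain ⟨m1, m2⟩ := H.integral_mul_Δ hjJ (H.meas_coeff hjJ p) (H.integrable_coeff hjJ p ihi)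
    obtain ⟨r1, r2⟩ := H.integral_mul_moment hjJ (H.meas_pow hjJ.le p) ihi hnn (2 * p)
    have hi : Integrable (fun ω => Y j ω ^ p + Y j ω ^ p * (p * μ j ω) * Δ j ω) P := ihi.add m1
    have hi2 : Integrable (fun ω => Y j ω ^ p + Y j ω ^ p * (p * μ j ω) * Δ j ω
        + A * (Y j ω ^ p * (Δ j ω ^ 2 * (1 + Δ j ω ^ 2) ^ (2 * p)))) P :=
      hi.add (r1.const_mul A)
    have hstep : ∀ᵐ ω ∂P, 0 ≤ Y (j + 1) ω ^ p ∧ Y (j + 1) ω ^ p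
        ≤ Y j ω ^ p + Y j ω ^ p * (p * μ j ω) * Δ j ω
          + A * (Y j ω ^ p * (Δ j ω ^ 2 * (1 + Δ j ω ^ 2) ^ (2 * p))) := by
      filter_upwards [H.pow_step hA, H.one_le] with ω h1 h2
      have := h2 (j + 1) hj
      exact ⟨by positivity, h1 j hjJ⟩
    have hint : Integrable (fun ω => Y (j + 1) ω ^ p) P := by
      refine hi2.mono' ((H.meas_pow hj p).mono (H.le _ hj)) ?_
      filter_upwards [hstep] with ω hω
      rw [Real.norm_of_nonneg hω.1]
      exact hω.2
    refine ⟨hint, ?_⟩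
    have h1 := integral_mono_ae hint hi2 (hstep.mono fun ω hω => hω.2)
    rw [integral_add hi (r1.const_mul A), integral_add ihi m1, m2, add_zero,
      integral_const_mul] at h1
    have h3 : A * ∫ ω, Y j ω ^ p * (Δ j ω ^ 2 * (1 + Δ j ω ^ 2) ^ (2 * p)) ∂P
        ≤ A * ((∫ ω, Y j ω ^ p ∂P) * (k * gaussMoment (2 * p))) := by gcongr
    calc ∫ ω, Y (j + 1) ω ^ p ∂P
        ≤ (1 + A * gaussMoment (2 * p) * k) * ∫ ω, Y j ω ^ p ∂P := by linarith
      _ ≤ (1 + A * gaussMoment (2 * p) * k)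
          * ((1 + A * gaussMoment (2 * p) * k) ^ j * y₀ ^ p) := by gcongr
      _ = _ := by ring

end GaussianGrowth

/-! ### A maximal inequality -/

/-- The running maximum of the sequence `s`, started at `0`. -/
noncomputable def runMax (s : ℕ → ℝ) : ℕ → ℝ
  | 0 => 0
  | j + 1 => max (runMax s j) (s (j + 1))

theorem runMax_mono (s : ℕ → ℝ) : Monotone (runMax s) :=
  monotone_nat_of_le_succ fun _ => le_max_left _ _

theorem le_runMax (s : ℕ → ℝ) {i j : ℕ} (hi : 1 ≤ i) (hij : i ≤ j) : s i ≤ runMax s j := by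
  obtain ⟨i, rfl⟩ : ∃ l, i = l + 1 := ⟨i - 1, by omega⟩
  exact (le_max_right _ _).trans (runMax_mono s hij)

/-- Doob's `L²` inequality in pathwise form. -/
theorem sq_runMax_le (z : ℕ → ℝ) (j : ℕ) :
    runMax (fun j => ∑ i ∈ Finset.range j, z i) j ^ 2
      ≤ 4 * (∑ i ∈ Finset.range j, z i) ^ 2
        - 4 * ∑ i ∈ Finset.range j, runMax (fun j => ∑ i ∈ Finset.range j, z i) i * z i := by
  set S : ℕ → ℝ := fun j => ∑ i ∈ Finset.range j, z i with hS
  -- Summation by parts: the running maximum increases only at times when it equals the sum itself.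
  -- Young's inequality for `runMax S j * S j` finishes.
  have key : 1 / 2 * runMax S j ^ 2
      ≤ runMax S j * S j - ∑ i ∈ Finset.range j, runMax S i * z i := by
    induction j with
    | zero => simp [runMax]
    | succ j ih =>
      have hz : S (j + 1) = S j + z j := Finset.sum_range_succ _ _
      have hz' : z j = S (j + 1) - S j := by linarith
      rw [Finset.sum_range_succ, hz']
      have hrec : runMax S (j + 1) = max (runMax S j) (S (j + 1)) := rfl
      rcases le_total (runMax S j) (S (j + 1)) with h | h
      · rw [hrec, max_eq_right h]
        nlinarith [sq_nonneg (S (j + 1) - runMax S j)]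
      · rw [hrec, max_eq_left h]
        nlinarith
  nlinarith [sq_nonneg (runMax S j / 2 - S j)]

theorem integrable_finset_sup' {Ω : Type*} [MeasurableSpace Ω] {P : Measure Ω}
    {ι : Type*} {s : Finset ι} (hs : s.Nonempty) {f : ι → Ω → ℝ}
    (hf : ∀ i ∈ s, Integrable (f i) P) : Integrable (fun ω => s.sup' hs fun i => f i ω) P := by
  have h : Integrable (s.sup' hs f) P :=
    Finset.sup'_induction hs f (p := fun g => Integrable g P) (fun _ h1 _ h2 => h1.sup h2) hf
  refine h.congr (Eventually.of_forall fun ω => ?_)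
  exact Finset.sup'_apply hs f ω

namespace GaussianGrowth

variable {Ω : Type*} [mΩ : MeasurableSpace Ω] {P : Measure Ω} [IsProbabilityMeasure P]
  {C T k : ℝ} {J : ℕ} {𝒢 : ℕ → MeasurableSpace Ω} {Y μ a Δ : ℕ → Ω → ℝ} {y₀ : ℝ}

/-- In the pathwise inequality the running maximum at time `i` multiplies the increment after time
`i`, so that sum has mean zero. Orthogonality of the increments gives the second moment of the final
sum. -/
theorem integral_runMax_sq_le (H : GaussianGrowth P C T k J 𝒢 Y μ a Δ y₀) {Z : ℕ → Ω → ℝ}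
    (hZ : ∀ j < J, AEStronglyMeasurable[𝒢 j] (Z j) P) {V : ℝ}
    (hZi : ∀ j < J, Integrable (fun ω => Z j ω ^ 2) P) (hV : ∀ j < J, ∫ ω, Z j ω ^ 2 ∂P ≤ V)
    (hV0 : 0 ≤ V) :
    MemLp (fun ω => runMax (fun j => ∑ i ∈ Finset.range j, Z i ω * Δ i ω) J) 2 P ∧
      ∫ ω, runMax (fun j => ∑ i ∈ Finset.range j, Z i ω * Δ i ω) J ^ 2 ∂P
        ≤ 4 * (gaussMoment 0 * T * V) := by
  set S : ℕ → Ω → ℝ := fun j ω => ∑ i ∈ Finset.range j, Z i ω * Δ i ω with hS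
  set B : ℕ → Ω → ℝ := fun j ω => runMax (fun j => S j ω) j with hB
  have hm0 := gaussMoment_nonneg 0
  have hk := H.k_pos
  have hSsucc : ∀ j, S (j + 1) = fun ω => S j ω + Z j ω * Δ j ω := fun j => by
    ext ω; exact Finset.sum_range_succ _ _
  have hinc : ∀ j < J, AEStronglyMeasurable[𝒢 (j + 1)] (fun ω => Z j ω * Δ j ω) P := fun j hj =>
    ((hZ j hj).mono (H.mono j (j + 1) (by omega) hj)).mul
      (H.meas_Δ j hj).stronglyMeasurable.aestronglyMeasurable
  have hSm : ∀ j ≤ J, AEStronglyMeasurable[𝒢 j] (S j) P := by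
    intro j
    induction j with
    | zero => intro _; simp only [hS, Finset.range_zero, Finset.sum_empty]
              exact stronglyMeasurable_const.aestronglyMeasurable
    | succ j ih =>
      intro hj
      rw [hSsucc]
      exact ((ih (by omega)).mono (H.mono j (j + 1) (by omega) hj)).add (hinc j hj)
  have hBm : ∀ j ≤ J, AEStronglyMeasurable[𝒢 j] (B j) P := by
    intro j
    induction j with
    | zero => intro _; exact stronglyMeasurable_const.aestronglyMeasurable
    | succ j ih =>
      intro hj
      exact continuous_max.comp_aestronglyMeasurable₂
        ((ih (by omega)).mono (H.mono j (j + 1) (by omega) hj)) (hSm (j + 1) hj)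
  have hZ2 : ∀ j < J, AEStronglyMeasurable[𝒢 j] (fun ω => Z j ω ^ 2) P := fun j hj => (hZ j hj).pow 2
  have hincsq : ∀ j < J, Integrable (fun ω => (Z j ω * Δ j ω) ^ 2) P ∧
      ∫ ω, (Z j ω * Δ j ω) ^ 2 ∂P ≤ k * gaussMoment 0 * V := by
    intro j hj
    have hnn : 0 ≤ ∫ ω, Z j ω ^ 2 ∂P := integral_nonneg fun ω => sq_nonneg _
    have h := H.integral_mul_moment hj (hZ2 j hj) (hZi j hj) hnn 0
    simp only [pow_zero, mul_one, ← mul_pow] at h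
    refine ⟨h.1, h.2.trans ?_⟩
    rw [mul_comm]
    gcongr
    exact hV j hj
  have hle : ∀ j ≤ J, 𝒢 j ≤ mΩ := H.le
  have hincL : ∀ j < J, MemLp (fun ω => Z j ω * Δ j ω) 2 P := fun j hj =>
    (memLp_two_iff_integrable_sq ((hinc j hj).mono (hle _ hj))).2 (hincsq j hj).1
  have hZL : ∀ j < J, MemLp (Z j) 2 P := fun j hj =>
    (memLp_two_iff_integrable_sq ((hZ j hj).mono (hle _ hj.le))).2 (hZi j hj)
  have hSL : ∀ j ≤ J, MemLp (S j) 2 P := by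
    intro j
    induction j with
    | zero => intro _; simp [hS]
    | succ j ih =>
      intro hj
      rw [hSsucc]
      exact (ih (by omega)).add (hincL j hj)
  have hBL : ∀ j ≤ J, MemLp (B j) 2 P := by
    intro j
    induction j with
    | zero => intro _; exact memLp_const (0 : ℝ)
    | succ j ih =>
      intro hj
      exact (ih (by omega)).sup (hSL (j + 1) hj)
  -- products of adapted square integrable functions with the increments have mean zero
  have hmean : ∀ j < J, ∀ f : Ω → ℝ, AEStronglyMeasurable[𝒢 j] f P → MemLp f 2 P →
      Integrable (fun ω => f ω * (Z j ω * Δ j ω)) P ∧ ∫ ω, f ω * (Z j ω * Δ j ω) ∂P = 0 := by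
    intro j hj f hf hfL
    have h := H.integral_mul_Δ hj (hf.mul (hZ j hj)) (hfL.integrable_mul (hZL j hj))
    simpa only [Pi.mul_apply, mul_assoc] using h
  have hSsq : ∀ j ≤ J, ∫ ω, S j ω ^ 2 ∂P ≤ j * (k * gaussMoment 0 * V) := by
    intro j
    induction j with
    | zero => intro _; simp [hS]
    | succ j ih =>
      intro hj
      have hjJ : j < J := hj
      obtain ⟨c1, c2⟩ := hmean j hjJ (S j) (hSm j hjJ.le) (hSL j hjJ.le)
      obtain ⟨d1, d2⟩ := hincsq j hjJ
      have e1 := (hSL j hjJ.le).integrable_sq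
      have hexp : ∀ ω, S (j + 1) ω ^ 2
          = S j ω ^ 2 + 2 * (S j ω * (Z j ω * Δ j ω)) + (Z j ω * Δ j ω) ^ 2 := fun ω => by
        rw [hSsucc]; ring
      simp only [hexp]
      rw [integral_add (by exact e1.add (c1.const_mul 2)) d1, integral_add e1 (c1.const_mul 2),
        integral_const_mul, c2]
      have := ih hjJ.le
      push_cast
      linarith
  refine ⟨hBL J le_rfl, ?_⟩
  have hsum : ∀ i ∈ Finset.range J, Integrable (fun ω => B i ω * (Z i ω * Δ i ω)) P := by
    intro i hi
    have hiJ := Finset.mem_range.1 hi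
    exact (hmean i hiJ (B i) (hBm i hiJ.le) (hBL i hiJ.le)).1
  have hpath : ∀ ω, B J ω ^ 2
      ≤ 4 * S J ω ^ 2 - 4 * ∑ i ∈ Finset.range J, B i ω * (Z i ω * Δ i ω) := fun ω =>
    sq_runMax_le (fun i => Z i ω * Δ i ω) J
  have i1 := ((hSL J le_rfl).integrable_sq).const_mul 4
  have i2 := (integrable_finsetSum _ hsum).const_mul 4
  have hI := integral_mono (hBL J le_rfl).integrable_sq (i1.sub i2) hpath
  have hI2 : ∫ ω, (4 * S J ω ^ 2 - 4 * ∑ i ∈ Finset.range J, B i ω * (Z i ω * Δ i ω)) ∂P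
      = 4 * ∫ ω, S J ω ^ 2 ∂P := by
    rw [integral_sub i1 i2, integral_const_mul, integral_const_mul, integral_finsetSum _ hsum,
      Finset.sum_eq_zero, mul_zero, sub_zero]
    intro i hi
    have hiJ := Finset.mem_range.1 hi
    exact (hmean i hiJ (B i) (hBm i hiJ.le) (hBL i hiJ.le)).2
  have hI3 : ∫ ω, B J ω ^ 2 ∂P ≤ 4 * ∫ ω, S J ω ^ 2 ∂P := hI.trans hI2.le
  refine hI3.trans ?_
  gcongr
  calc ∫ ω, S J ω ^ 2 ∂P ≤ J * (k * gaussMoment 0 * V) := hSsq J le_rfl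
    _ = gaussMoment 0 * (k * J) * V := by ring
    _ ≤ _ := by gcongr; exact H.time

/-- Moments of the maximum of a process with multiplicative Gaussian growth. -/
theorem exists_moment_bounds {C T : ℝ} (hC : 0 ≤ C) (hT : 0 ≤ T) (p : ℕ) :
    ∃ M : ℝ, 0 ≤ M ∧ ∀ {Ω : Type u} [MeasurableSpace Ω] {P : Measure Ω}
      [IsProbabilityMeasure P] {k : ℝ} {J : ℕ} (hJ : 1 ≤ J) {𝒢 : ℕ → MeasurableSpace Ω}
      {Y μ a Δ : ℕ → Ω → ℝ} {y₀ : ℝ}, GaussianGrowth P C T k J 𝒢 Y μ a Δ y₀ →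
      (∀ j ≤ J, Integrable (fun ω => Y j ω ^ p) P ∧ ∫ ω, Y j ω ^ p ∂P ≤ M * y₀ ^ p) ∧
      ∫ ω, (Finset.Icc 1 J).sup' (Finset.nonempty_Icc.mpr hJ) (fun j => Y j ω ^ p) ∂P
        ≤ M * y₀ ^ p := by
  obtain ⟨A, hA0, hA⟩ := exists_growth_factor_pow_bound hC p
  -- The martingale has coefficients of size `Y ^ p`, so its second moment involves moments of order
  -- `2p`.
  obtain ⟨A', hA0', hA'⟩ := exists_growth_factor_pow_bound hC (p * 2)
  set m := gaussMoment (2 * p) with hm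
  have hm0 : 0 ≤ m := gaussMoment_nonneg _
  set M₁ := Real.exp (A * m * T) with hM₁
  set M₂ := Real.exp (A' * gaussMoment (2 * (p * 2)) * T) with hM₂
  set Q := 4 * (gaussMoment 0 * T * ((p * C) ^ 2 * M₂)) with hQ
  have hg0 := gaussMoment_nonneg 0
  have hM₁0 : 0 ≤ M₁ := (Real.exp_pos _).le
  have hM₂0 : 0 ≤ M₂ := (Real.exp_pos _).le
  have hQ0 : 0 ≤ Q := by positivity
  refine ⟨M₁ + (1 + (1 + Q) / 2 + A * T * m * M₁), by positivity, ?_⟩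
  intro Ω mΩ P _ k J hJ 𝒢 Y μ a Δ y₀ H
  have hy0 := H.one_le_start
  have hyp : 0 < y₀ ^ p := by positivity
  have hk := H.k_pos
  have hmom : ∀ j ≤ J, Integrable (fun ω => Y j ω ^ p) P ∧ ∫ ω, Y j ω ^ p ∂P ≤ M₁ * y₀ ^ p :=
    fun j hj => H.integrable_pow hA0 hA hj
  have hmom2 : ∀ j ≤ J, Integrable (fun ω => (Y j ω ^ p) ^ 2) P ∧
      ∫ ω, (Y j ω ^ p) ^ 2 ∂P ≤ M₂ * (y₀ ^ p) ^ 2 := fun j hj => by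
    have h := H.integrable_pow hA0' hA' hj
    simpa only [pow_mul] using h
  have hrest : 0 ≤ (1 + (1 + Q) / 2 + A * T * m * M₁) * y₀ ^ p := by positivity
  refine ⟨fun j hj => ⟨(hmom j hj).1, (hmom j hj).2.trans ?_⟩, ?_⟩
  · rw [add_mul]; linarith
  set Z : ℕ → Ω → ℝ := fun j ω => Y j ω ^ p * (p * μ j ω) with hZ
  have hZsq : ∀ j < J, ∀ᵐ ω ∂P, Z j ω ^ 2 ≤ (p * C) ^ 2 * (Y j ω ^ p) ^ 2 := by
    intro j hj
    filter_upwards [H.bound_μ] with ω hω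
    have h1 : (p * μ j ω) ^ 2 ≤ (p * C) ^ 2 := by
      rw [mul_pow, mul_pow]
      gcongr ?_ * ?_
      rw [← sq_abs (μ j ω)]
      exact pow_le_pow_left₀ (abs_nonneg _) (hω j hj) 2
    simp only [hZ]
    rw [mul_pow, mul_comm]
    gcongr
  have hZm : ∀ j < J, AEStronglyMeasurable[𝒢 j] (Z j) P := fun j hj => H.meas_coeff hj p
  have hZi : ∀ j < J, Integrable (fun ω => Z j ω ^ 2) P := fun j hj => by
    refine ((hmom2 j hj.le).1.const_mul ((p * C) ^ 2)).mono'
      (((hZm j hj).mono (H.le j hj.le)).pow 2) ?_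
    filter_upwards [hZsq j hj] with ω hω
    rwa [Real.norm_of_nonneg (sq_nonneg _)]
  have hV : ∀ j < J, ∫ ω, Z j ω ^ 2 ∂P ≤ (p * C) ^ 2 * M₂ * (y₀ ^ p) ^ 2 := fun j hj => by
    have h1 := integral_mono_ae (hZi j hj) ((hmom2 j hj.le).1.const_mul ((p * C) ^ 2)) (hZsq j hj)
    rw [integral_const_mul] at h1
    refine h1.trans ?_
    rw [mul_assoc]
    gcongr
    exact (hmom2 j hj.le).2
  obtain ⟨bL, bE⟩ := H.integral_runMax_sq_le hZm hZi hV (by positivity)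
  set B : Ω → ℝ := fun ω => runMax (fun j => ∑ i ∈ Finset.range j, Z i ω * Δ i ω) J with hB
  have bE' : ∫ ω, B ω ^ 2 ∂P ≤ Q * (y₀ ^ p) ^ 2 := bE.trans (le_of_eq (by rw [hQ]; ring))
  have hBint : Integrable B P := bL.integrable (by norm_num)
  have hBmean : ∫ ω, B ω ∂P ≤ (1 + Q) / 2 * y₀ ^ p := by
    -- Young's inequality with weight `y₀ ^ p`, matching the size of the second moment, so that the
    -- result is linear in `y₀ ^ p`.
    have h1 : ∫ ω, B ω ∂P ≤ ∫ ω, (1 / (2 * y₀ ^ p) * B ω ^ 2 + y₀ ^ p / 2) ∂P := by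
      apply integral_mono hBint ((bL.integrable_sq.const_mul _).add (integrable_const _))
      intro ω
      change B ω ≤ 1 / (2 * y₀ ^ p) * B ω ^ 2 + y₀ ^ p / 2
      have h2 : 1 / (2 * y₀ ^ p) * B ω ^ 2 + y₀ ^ p / 2 = (B ω ^ 2 + (y₀ ^ p) ^ 2) / (2 * y₀ ^ p) := by
        field_simp
      rw [h2, le_div_iff₀ (by positivity)]
      nlinarith [sq_nonneg (B ω - y₀ ^ p)]
    rw [integral_add (bL.integrable_sq.const_mul _) (integrable_const _), integral_const_mul] at h1
    have h3 : 1 / (2 * y₀ ^ p) * ∫ ω, B ω ^ 2 ∂P ≤ 1 / (2 * y₀ ^ p) * (Q * (y₀ ^ p) ^ 2) := by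
      gcongr
    have h4 : 1 / (2 * y₀ ^ p) * (Q * (y₀ ^ p) ^ 2) = Q / 2 * y₀ ^ p := by field_simp
    simp only [integral_const, probReal_univ, one_smul] at h1
    linarith
  have hR : ∀ i ∈ Finset.range J, Integrable
      (fun ω => A * (Y i ω ^ p * (Δ i ω ^ 2 * (1 + Δ i ω ^ 2) ^ (2 * p)))) P ∧
      ∫ ω, A * (Y i ω ^ p * (Δ i ω ^ 2 * (1 + Δ i ω ^ 2) ^ (2 * p))) ∂P
        ≤ A * (M₁ * y₀ ^ p * (k * m)) := by
    intro i hi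
    have hiJ := Finset.mem_range.1 hi
    have hnn : 0 ≤ ∫ ω, Y i ω ^ p ∂P := by
      apply integral_nonneg_of_ae
      filter_upwards [H.one_le] with ω hω
      have := hω i hiJ.le
      change 0 ≤ Y i ω ^ p
      positivity
    obtain ⟨r1, r2⟩ := H.integral_mul_moment hiJ (H.meas_pow hiJ.le p) (hmom i hiJ.le).1 hnn (2 * p)
    refine ⟨r1.const_mul A, ?_⟩
    rw [integral_const_mul]
    gcongr
    refine r2.trans ?_
    gcongr
    exact (hmom i hiJ.le).2
  set RR : Ω → ℝ := fun ω => ∑ i ∈ Finset.range J,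
    A * (Y i ω ^ p * (Δ i ω ^ 2 * (1 + Δ i ω ^ 2) ^ (2 * p))) with hRR
  have hRRi : Integrable RR P := integrable_finsetSum _ fun i hi => (hR i hi).1
  have hRRm : ∫ ω, RR ω ∂P ≤ A * T * m * M₁ * y₀ ^ p := by
    rw [hRR, integral_finsetSum _ fun i hi => (hR i hi).1]
    calc ∑ i ∈ Finset.range J, ∫ ω, A * (Y i ω ^ p * (Δ i ω ^ 2 * (1 + Δ i ω ^ 2) ^ (2 * p))) ∂P
        ≤ ∑ i ∈ Finset.range J, A * (M₁ * y₀ ^ p * (k * m)) :=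
          Finset.sum_le_sum fun i hi => (hR i hi).2
      _ = A * (k * J) * m * M₁ * y₀ ^ p := by
          rw [Finset.sum_const, Finset.card_range, nsmul_eq_mul]; ring
      _ ≤ _ := by gcongr; exact H.time
  have hpath : ∀ᵐ ω ∂P, (Finset.Icc 1 J).sup' (Finset.nonempty_Icc.mpr hJ) (fun j => Y j ω ^ p)
      ≤ y₀ ^ p + B ω + RR ω := by
    filter_upwards [H.pow_step hA, H.start, H.one_le] with ω h1 h2 h3
    have hRnn : ∀ i ∈ Finset.range J,
        0 ≤ A * (Y i ω ^ p * (Δ i ω ^ 2 * (1 + Δ i ω ^ 2) ^ (2 * p))) := by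
      intro i hi
      have := h3 i (Finset.mem_range.1 hi).le
      positivity
    -- Summing the one-step bounds gives initial value, martingale and nonnegative remainders. The
    -- maximum over `j` is taken by Doob for the second and by summing to `J` for the third.
    have hind : ∀ j ≤ J, Y j ω ^ p ≤ y₀ ^ p + ∑ i ∈ Finset.range j, Z i ω * Δ i ω
        + ∑ i ∈ Finset.range j, A * (Y i ω ^ p * (Δ i ω ^ 2 * (1 + Δ i ω ^ 2) ^ (2 * p))) := by
      intro j
      induction j with
      | zero => intro _; simp [h2]
      | succ j ih =>
        intro hj
        rw [Finset.sum_range_succ, Finset.sum_range_succ]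
        have h4 := h1 j hj
        have h5 := ih (by omega)
        simp only [hZ] at h5 ⊢
        linarith
    refine Finset.sup'_le _ _ fun j hj => ?_
    obtain ⟨hj1, hj2⟩ := Finset.mem_Icc.1 hj
    refine (hind j hj2).trans ?_
    have h4 : ∑ i ∈ Finset.range j, Z i ω * Δ i ω ≤ B ω :=
      le_runMax (fun j => ∑ i ∈ Finset.range j, Z i ω * Δ i ω) hj1 hj2
    have h5 : ∑ i ∈ Finset.range j, A * (Y i ω ^ p * (Δ i ω ^ 2 * (1 + Δ i ω ^ 2) ^ (2 * p)))
        ≤ RR ω := Finset.sum_le_sum_of_subset_of_nonneg (Finset.range_mono hj2)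
          fun i hi _ => hRnn i hi
    linarith
  have hsup := integrable_finset_sup' (P := P) (Finset.nonempty_Icc.mpr hJ) (f := fun j ω => Y j ω ^ p)
    fun j hj => (hmom j (Finset.mem_Icc.1 hj).2).1
  have hcB : Integrable (fun ω => y₀ ^ p + B ω) P := (integrable_const _).add hBint
  have hfin := integral_mono_ae hsup (by exact hcB.add hRRi) hpath
  have hfin2 : ∫ ω, (y₀ ^ p + B ω + RR ω) ∂P
      = y₀ ^ p + ∫ ω, B ω ∂P + ∫ ω, RR ω ∂P := by
    rw [integral_add hcB hRRi, integral_add (integrable_const _) hBint]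
    simp
  have hfin3 : ∫ ω, (Finset.Icc 1 J).sup' (Finset.nonempty_Icc.mpr hJ) (fun j => Y j ω ^ p) ∂P
      ≤ y₀ ^ p + ∫ ω, B ω ∂P + ∫ ω, RR ω ∂P := hfin.trans hfin2.le
  have : 0 ≤ M₁ * y₀ ^ p := by positivity
  linarith

/-- The dissipation terms are summable in mean. -/
theorem exists_dissipation_bound {C T : ℝ} (hC : 0 ≤ C) (hT : 0 ≤ T) :
    ∃ M : ℝ, 0 ≤ M ∧ ∀ {Ω : Type u} [MeasurableSpace Ω] {P : Measure Ω}
      [IsProbabilityMeasure P] {k : ℝ} {J : ℕ} {𝒢 : ℕ → MeasurableSpace Ω}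
      {Y μ a Δ : ℕ → Ω → ℝ} {y₀ : ℝ}, GaussianGrowth P C T k J 𝒢 Y μ a Δ y₀ →
      (∀ j ∈ Finset.Icc 1 J, Integrable (a j) P) ∧
      ∑ j ∈ Finset.Icc 1 J, ∫ ω, a j ω ∂P ≤ M * y₀ := by
  obtain ⟨A, hA0, hA⟩ := exists_growth_factor_pow_bound hC 1
  set M₁ := Real.exp (A * gaussMoment (2 * 1) * T) with hM₁
  have hg1 := gaussMoment_nonneg 1
  have hM₁0 : 0 ≤ M₁ := (Real.exp_pos _).le
  refine ⟨1 + C * T * gaussMoment 1 * M₁, by positivity, ?_⟩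
  intro Ω mΩ P _ k J 𝒢 Y μ a Δ y₀ H
  have hk := H.k_pos
  have hy0 := H.one_le_start
  have hmom : ∀ j ≤ J, Integrable (Y j) P ∧ ∫ ω, Y j ω ∂P ≤ M₁ * y₀ := fun j hj => by
    have h := H.integrable_pow hA0 hA hj
    simpa only [pow_one] using h
  have hYm : ∀ j ≤ J, AEStronglyMeasurable[𝒢 j] (Y j) P := H.meas_Y
  have hnn : ∀ j ≤ J, 0 ≤ ∫ ω, Y j ω ∂P := fun j hj => by
    apply integral_nonneg_of_ae
    filter_upwards [H.one_le] with ω hω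
    exact zero_le_one.trans (hω j hj)
  -- Moving `Y (j + 1)` to the right leaves a telescoping difference of means, a mean-zero term and
  -- an `O(k)` remainder.
  have hdecomp : ∀ j < J, Integrable (a (j + 1)) P ∧ ∫ ω, a (j + 1) ω ∂P
      ≤ ∫ ω, Y j ω ∂P - ∫ ω, Y (j + 1) ω ∂P + C * (M₁ * y₀ * (k * gaussMoment 1)) := by
    intro j hj
    have hc := H.integrable_coeff hj 1 (by simpa using (hmom j hj.le).1)
    have hcm := H.meas_coeff hj 1
    simp only [pow_one, Nat.cast_one, one_mul] at hc hcm
    obtain ⟨m1, m2⟩ := H.integral_mul_Δ hj hcm hc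
    obtain ⟨r1, r2⟩ := H.integral_mul_moment hj (hYm j hj.le) (hmom j hj.le).1 (hnn j hj.le) 1
    have hstep : ∀ᵐ ω ∂P, 0 ≤ a (j + 1) ω ∧ a (j + 1) ω ≤ Y j ω - Y (j + 1) ω
        + Y j ω * μ j ω * Δ j ω + C * (Y j ω * (Δ j ω ^ 2 * (1 + Δ j ω ^ 2) ^ 1)) := by
      filter_upwards [H.step, H.a_nonneg] with ω h1 h2
      refine ⟨h2 j hj, ?_⟩
      have h3 : Y j ω * (1 + μ j ω * Δ j ω + C * (Δ j ω ^ 2 + Δ j ω ^ 4))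
          = Y j ω + Y j ω * μ j ω * Δ j ω
            + C * (Y j ω * (Δ j ω ^ 2 * (1 + Δ j ω ^ 2) ^ 1)) := by ring
      have := h1 j hj
      rw [h3] at this
      linarith
    have i1 : Integrable (fun ω => Y j ω - Y (j + 1) ω) P := (hmom j hj.le).1.sub (hmom (j + 1) hj).1
    have i2 : Integrable (fun ω => Y j ω - Y (j + 1) ω + Y j ω * μ j ω * Δ j ω) P := i1.add m1
    have i3 : Integrable (fun ω => Y j ω - Y (j + 1) ω + Y j ω * μ j ω * Δ j ω
        + C * (Y j ω * (Δ j ω ^ 2 * (1 + Δ j ω ^ 2) ^ 1))) P := i2.add (r1.const_mul C)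
    have hai : Integrable (a (j + 1)) P := i3.mono' (H.meas_a j hj) (by
      filter_upwards [hstep] with ω hω
      rw [Real.norm_of_nonneg hω.1]; exact hω.2)
    refine ⟨hai, ?_⟩
    have h1 := integral_mono_ae hai i3 (hstep.mono fun ω h => h.2)
    rw [integral_add i2 (r1.const_mul C), integral_add i1 m1, m2, integral_const_mul,
      integral_sub (hmom j hj.le).1 (hmom (j + 1) hj).1, add_zero] at h1
    refine h1.trans ?_
    gcongr
    refine r2.trans ?_
    gcongr
    exact (hmom j hj.le).2
  refine ⟨fun j hj => ?_, ?_⟩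
  · obtain ⟨h1, h2⟩ := Finset.mem_Icc.1 hj
    obtain ⟨i, rfl⟩ : ∃ i, j = i + 1 := ⟨j - 1, by omega⟩
    exact (hdecomp i h2).1
  · have hreindex : ∑ j ∈ Finset.Icc 1 J, ∫ ω, a j ω ∂P
        = ∑ i ∈ Finset.range J, ∫ ω, a (i + 1) ω ∂P := by
      rw [Finset.range_eq_Ico, Finset.sum_Ico_add' (fun j => ∫ ω, a j ω ∂P) 0 J 1]
      rfl
    rw [hreindex]
    calc ∑ i ∈ Finset.range J, ∫ ω, a (i + 1) ω ∂P
        ≤ ∑ i ∈ Finset.range J, (∫ ω, Y i ω ∂P - ∫ ω, Y (i + 1) ω ∂P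
          + C * (M₁ * y₀ * (k * gaussMoment 1))) :=
          Finset.sum_le_sum fun i hi => (hdecomp i (Finset.mem_range.1 hi)).2
      _ = ∫ ω, Y 0 ω ∂P - ∫ ω, Y J ω ∂P + C * (k * J) * gaussMoment 1 * M₁ * y₀ := by
          rw [Finset.sum_add_distrib, Finset.sum_range_sub', Finset.sum_const, Finset.card_range,
            nsmul_eq_mul]
          ring
      _ ≤ y₀ - 0 + C * T * gaussMoment 1 * M₁ * y₀ := by
          gcongr
          · rw [integral_congr_ae H.start]; simp
          · exact hnn J le_rfl
          · exact H.time
      _ = _ := by ring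

end GaussianGrowth

/-! ### Energy estimates for the scheme -/

section Scheme

variable {Ω : Type*} [mΩ : MeasurableSpace Ω] {P : Measure Ω} {D : Set Plane} {C₄ : ℝ}
  {g : Plane → ℝ} {T γ ε k : ℝ} {J : ℕ} {u₀ gH : H1 D} {W : ℝ → Ω → ℝ} {X w : ℕ → Ω → H1 D}

theorem grid_mem_Icc (hk : 0 < k) (hkJ : k * J = T) {j : ℕ} (hj : j ≤ J) :
    (j : ℝ) * k ∈ Set.Icc 0 T := by
  refine ⟨by positivity, ?_⟩
  rw [← hkJ, mul_comm]
  gcongr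

theorem IsWienerProcess.measurable_increment {𝓕 : Filtration ℝ mΩ} (hW : IsWienerProcess T 𝓕 P W)
    (hk : 0 < k) (hkJ : k * J = T) {j : ℕ} (hj : j < J) :
    Measurable[𝓕 (((j + 1 : ℕ) : ℝ) * k)] fun ω => increment W k ω j := by
  have h1 := hW.adapted _ (grid_mem_Icc hk hkJ (Nat.succ_le_of_lt hj))
  have h2 := hW.adapted _ (grid_mem_Icc hk hkJ hj.le)
  exact h1.sub (h2.mono (𝓕.mono (by push_cast; nlinarith)) le_rfl)

/-- The iterates are adapted to the filtration, up to null sets. -/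
theorem EmbedsL4.exists_adapted_modification (hS : EmbedsL4 D C₄)
    [IsFiniteMeasure (volume.restrict D)]
    (hg : gH.fn =ᵐ[volume.restrict D] g) (hε : 0 < ε) (hk : 0 < k) (hkε : k ≤ ε ^ 3)
    (hkJ : k * J = T) {𝓕 : Filtration ℝ mΩ} (hW : IsWienerProcess T 𝓕 P W) {s : ℝ}
    (hX : ∀ᵐ ω ∂P, SolvesSchemeAlong g s ε k J u₀ (increment W k ω)
      (fun j => X j ω) (fun j => w j ω)) :
    ∀ j ≤ J, ∃ X' : Ω → H1 D, Measurable[𝓕 ((j : ℝ) * k), borel (H1 D)] X' ∧ X j =ᵐ[P] X' := by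
  let _ : MeasurableSpace (H1 D) := borel (H1 D)
  have : BorelSpace (H1 D) := ⟨rfl⟩
  obtain ⟨Φ, hΦm, hΦ⟩ := hS.exists_measurable_solutionMap hε hk hkε
  intro j
  induction j with
  | zero =>
    intro _
    exact ⟨fun _ => u₀, @measurable_const _ _ _ (𝓕 _) _, hX.mono fun ω h => h.1⟩
  | succ j ih =>
    intro hj
    obtain ⟨X', hm, he⟩ := ih (by omega)
    obtain ⟨A, hA, hAeq⟩ : ∃ A : H1 D × ℝ → H1 D, Measurable A ∧
        ∀ u d, A (u, d) = u + (s * d) • gH :=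
      ⟨fun q => q.1 + (s * q.2) • gH, Continuous.measurable (by fun_prop), fun _ _ => rfl⟩
    have hm' : Measurable[𝓕 (((j + 1 : ℕ) : ℝ) * k)] X' :=
      hm.mono (𝓕.mono (by push_cast; nlinarith)) le_rfl
    have hm2 : Measurable[𝓕 (((j + 1 : ℕ) : ℝ) * k)] fun ω => increment W k ω j :=
      hW.measurable_increment hk hkJ hj
    have hpair : Measurable[𝓕 (((j + 1 : ℕ) : ℝ) * k)] fun ω => (X' ω, increment W k ω j) :=
      hm'.prodMk hm2
    -- The next iterate is a Borel function of the adapted current one and the increment; uniqueness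
    -- of the step identifies it almost surely with the given solution.
    refine ⟨fun ω => Φ (A (X' ω, increment W k ω j)),
      Measurable.comp hΦm (Measurable.comp hA hpair), ?_⟩
    filter_upwards [hX, he] with ω h1 h2
    rw [hAeq, ← h2]
    exact (hΦ _ _ _ (h1.solvesStep hg hj)).symm

/-- Where analysis meets probability: the noise shift gives the random growth factor and the
implicit step the dissipation. Adding `1` to the energy keeps `Y` away from zero, so the relative
drift `μ` is bounded. -/
theorem EmbedsL4.gaussianGrowth (hS : EmbedsL4 D C₄) [IsFiniteMeasure (volume.restrict D)]
    (hg : gH.fn =ᵐ[volume.restrict D] g)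
    {G : ℝ} (hG : 0 ≤ G) (hgG : ∀ᵐ x ∂(volume.restrict D), |gH.fn x| ≤ G)
    (hT : 0 < T) (hJ : 1 ≤ J) (hγ : 3 / 2 < γ) (hε : 0 < ε) (hε1 : ε ≤ 1) (hkε : T / J ≤ ε ^ 3)
    {𝓕 : Filtration ℝ mΩ} (hW : IsWienerProcess T 𝓕 P W) (hX : IsSchemeSolution P g T γ ε J u₀ W X w) :
    GaussianGrowth P (2 * growthConst ((volume.restrict D).real Set.univ) G ‖gH.grad‖) T (T / J) J
      (fun j => 𝓕 ((j : ℝ) * (T / J))) (fun j ω => energy ε (X j ω) + 1)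
      (fun j ω => ε ^ γ * energyDeriv ε gH (X j ω) / (energy ε (X j ω) + 1))
      (fun j ω => T / J / 2 * ‖(w j ω).grad‖ ^ 2) (fun j ω => increment W (T / J) ω j)
      (energy ε u₀ + 1) := by
  let _ : MeasurableSpace (H1 D) := borel (H1 D)
  have : BorelSpace (H1 D) := ⟨rfl⟩
  have hJ0 : (0 : ℝ) < J := by exact_mod_cast hJ
  have hk : 0 < T / J := by positivity
  have hkJ : T / J * J = T := by field_simp
  have hs : 0 < ε ^ γ := Real.rpow_pos_of_pos hε _
  have hsε : ε ^ γ ≤ ε := by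
    simpa using Real.rpow_le_rpow_of_exponent_ge hε hε1 (show (1 : ℝ) ≤ γ by linarith)
  have hgrid : ∀ j ≤ J, (j : ℝ) * (T / J) ∈ Set.Icc 0 T := fun j hj => grid_mem_Icc hk hkJ hj
  have hdiff : ∀ j : ℕ, ((j + 1 : ℕ) : ℝ) * (T / J) - j * (T / J) = T / J := fun j => by
    push_cast; ring
  have hle : ∀ j : ℕ, (j : ℝ) * (T / J) ≤ ((j + 1 : ℕ) : ℝ) * (T / J) := fun j => by
    linarith [hdiff j]
  have hE : ∀ u : H1 D, 0 ≤ energy ε u := energy_nonneg hε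
  have hadapt := hS.exists_adapted_modification hg hε hk hkε hkJ hW hX.solves
  have hcont : ∀ φ : H1 D → ℝ, Continuous φ → ∀ j ≤ J,
      AEStronglyMeasurable[𝓕 ((j : ℝ) * (T / J))] (fun ω => φ (X j ω)) P := by
    intro φ hφ j hj
    obtain ⟨X', hm, he⟩ := hadapt j hj
    refine ⟨fun ω => φ (X' ω), (hφ.measurable.comp hm).stronglyMeasurable, ?_⟩
    filter_upwards [he] with ω hω
    rw [hω]
  have hcE := hS.continuous_energy (ε := ε)
  have hnoise := fun u d => hS.energy_noise_le hε hε1 hs hsε hG hgG u d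
  exact
    { k_pos := hk
      k_le := hkε.trans (pow_le_one₀ hε.le hε1)
      time := hkJ.le
      le := fun j _ => 𝓕.le _
      mono := fun i j hij _ => 𝓕.mono (by gcongr)
      meas_Y := hcont (fun u => energy ε u + 1) (by fun_prop)
      meas_μ := fun j hj => hcont (fun u => ε ^ γ * energyDeriv ε gH u / (energy ε u + 1))
        ((continuous_const.mul (hS.continuous_energyDeriv ε gH)).div (by fun_prop)
          fun u => by linarith [hE u]) j hj.le
      meas_Δ := fun j hj => hW.measurable_increment hk hkJ hj
      meas_a := fun j hj => by
        have hw : Measurable (w (j + 1)) := hX.measurable_w _ (by simp; omega)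
        have hc : Continuous fun u : H1 D => T / J / 2 * ‖u.grad‖ ^ 2 :=
          continuous_const.mul (H1.continuous_grad.norm.pow 2)
        exact (hc.measurable.comp hw).aestronglyMeasurable
      law := fun j hj => by
        have h := hW.gaussian _ _ (hgrid j hj.le).1 (hle j) (hgrid (j + 1) hj).2
        rwa [hdiff] at h
      indep := fun j hj => hW.indep _ _ (hgrid j hj.le).1 (hle j) (hgrid (j + 1) hj).2
      start := hX.solves.mono fun ω h => by
        have h0 : X 0 ω = u₀ := h.1
        rw [h0]
      one_le := Eventually.of_forall fun ω j _ => by linarith [hE (X j ω)]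
      bound_μ := Eventually.of_forall fun ω j _ => by
        have h1 := (hnoise (X j ω) 0).1
        have h2 := (abs_nonneg _).trans h1
        linarith
      a_nonneg := Eventually.of_forall fun ω j _ => by positivity
      step := hX.solves.mono fun ω h j hj => by
        have h1 := hS.energy_step_le hε hk hkε (h.solvesStep hg hj)
        have h2 := (hnoise (X j ω) (increment W (T / J) ω j)).2
        linarith }

end Scheme

end StochCH

/-! ### Assembly of the estimates -/

open StochCH in
theorem lemma3 {T : ℝ} (hT : 0 < T) {D : Set Plane} (hD : IsConvexPolygonalDomain D)
    {g : Plane → ℝ} (hg : IsNoiseProfile D g) {ε₀ : ℝ} (hε₀ : 0 < ε₀) (hε₀' : ε₀ ≤ 1) :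
    ∃ C : ℝ, 0 < C ∧ ∃ Cp : ℕ → ℝ, (∀ p, 0 < Cp p) ∧
      ∀ (γ ε : ℝ) (J : ℕ) (hJ : 1 ≤ J), 3 / 2 < γ → ε ∈ Set.Ioo 0 ε₀ → T / J ≤ ε ^ 3 →
      ∀ (u₀ : H1 D), u₀.mass = 0 →
      ∀ (Ω : Type u) [mΩ : MeasurableSpace Ω] (P : Measure Ω) [IsProbabilityMeasure P]
        (𝓕 : Filtration ℝ mΩ) (W : ℝ → Ω → ℝ), IsWienerProcess T 𝓕 P W →
      ∀ (X w : ℕ → Ω → H1 D), IsSchemeSolution P g T γ ε J u₀ W X w →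
        -- conservation of mass, almost surely and on every path that solves the scheme
        (∀ᵐ ω ∂P, ∀ j ≤ J, (X j ω).mass = u₀.mass) ∧
        (∀ ω, SolvesSchemeAlong g (ε ^ γ) ε (T / J) J u₀ (increment W (T / J) ω)
            (fun j => X j ω) (fun j => w j ω) → ∀ j ≤ J, (X j ω).mass = u₀.mass) ∧
        -- integrability of all the quantities in i) and ii)
        (∀ j ∈ Finset.Icc 1 J, Integrable (fun ω => energy ε (X j ω)) P) ∧
        (∀ i ∈ Finset.Icc 1 J, Integrable (fun ω => ‖(w i ω).grad‖ ^ 2) P) ∧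
        Integrable (fun ω => (Finset.Icc 1 J).sup' (Finset.nonempty_Icc.mpr hJ)
          (fun j => energy ε (X j ω))) P ∧
        -- i)
        (Finset.Icc 1 J).sup' (Finset.nonempty_Icc.mpr hJ) (fun j => ∫ ω, energy ε (X j ω) ∂P)
            + (T / J) / 2 * ∑ i ∈ Finset.Icc 1 J, ∫ ω, ‖(w i ω).grad‖ ^ 2 ∂P
          ≤ C * (energy ε u₀ + 1) ∧
        -- ii)
        ∫ ω, (Finset.Icc 1 J).sup' (Finset.nonempty_Icc.mpr hJ)
            (fun j => energy ε (X j ω)) ∂P ≤ C * (energy ε u₀ + 1) ∧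
        -- iii) and iv)
        ∀ r : ℕ, ∀ p : ℕ, p = 2 ^ r →
          (∀ j ∈ Finset.Icc 1 J, Integrable (fun ω => |energy ε (X j ω)| ^ p) P) ∧
          Integrable (fun ω => (Finset.Icc 1 J).sup' (Finset.nonempty_Icc.mpr hJ)
            (fun j => |energy ε (X j ω)| ^ p)) P ∧
          (Finset.Icc 1 J).sup' (Finset.nonempty_Icc.mpr hJ)
              (fun j => ∫ ω, |energy ε (X j ω)| ^ p ∂P) ≤ Cp p * (|energy ε u₀| ^ p + 1) ∧
          ∫ ω, (Finset.Icc 1 J).sup' (Finset.nonempty_Icc.mpr hJ)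
              (fun j => |energy ε (X j ω)| ^ p) ∂P ≤ Cp p * (|energy ε u₀| ^ p + 1) := by
  have : IsFiniteMeasure (volume.restrict D) := hD.isFiniteMeasure
  obtain ⟨C₄, hS⟩ := hD.exists_embedsL4
  obtain ⟨G, gH, hG, hgH, hgG⟩ := hg.exists_H1 hD
  set K := 2 * growthConst ((volume.restrict D).real Set.univ) G ‖gH.grad‖ with hK
  have hK0 : 0 ≤ K := by
    have := growthConst_pos (V := (volume.restrict D).real Set.univ) (A := ‖gH.grad‖)
      measureReal_nonneg hG
    positivity
  choose M hM0 hM using fun p => GaussianGrowth.exists_moment_bounds.{u} hK0 hT.le p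
  obtain ⟨M', hM'0, hM'⟩ := GaussianGrowth.exists_dissipation_bound.{u} hK0 hT.le
  have hM1 := hM0 1
  -- `M 1` bounds the energies and `M'` the dissipation; `2 ^ p` converts `(energy + 1) ^ p` into
  -- `energy ^ p + 1`. The summand `1` ensures strict positivity.
  refine ⟨M 1 + M' + 1, by positivity, fun p => 2 ^ p * M p + 1, fun p => ?_, ?_⟩
  · have := hM0 p
    positivity
  intro γ ε J hJ hγ hε hkε u₀ _ Ω mΩ P _ 𝓕 W hW X w hX
  have hε0 : 0 < ε := hε.1
  have hJ0 : (0 : ℝ) < J := by exact_mod_cast hJ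
  have hk : 0 < T / J := by positivity
  have H := hS.gaussianGrowth hgH hG hgG hT hJ hγ hε0 (hε.2.le.trans hε₀') hkε hW hX
  have hE : ∀ u : H1 D, 0 ≤ energy ε u := energy_nonneg hε0
  have hE₀ := hE u₀
  have hY := fun p => hM p hJ H
  have hEm : ∀ j ∈ Finset.Icc 1 J, AEStronglyMeasurable (fun ω => energy ε (X j ω)) P := by
    let _ : MeasurableSpace (H1 D) := borel (H1 D)
    have : BorelSpace (H1 D) := ⟨rfl⟩
    intro j hj
    have hXm : Measurable (X j) := hX.measurable_X j hj
    exact ((hS.continuous_energy ε).measurable.comp hXm).aestronglyMeasurable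
  have hpow : ∀ (p j : ℕ) (ω : Ω), energy ε (X j ω) ^ p ≤ (energy ε (X j ω) + 1) ^ p :=
    fun p j ω => pow_le_pow_left₀ (hE _) (by linarith) p
  have hEi : ∀ p, ∀ j ∈ Finset.Icc 1 J, Integrable (fun ω => energy ε (X j ω) ^ p) P := by
    intro p j hj
    refine ((hY p).1 j (Finset.mem_Icc.1 hj).2).1.mono' ((hEm j hj).pow p)
      (Filter.Eventually.of_forall fun ω => ?_)
    rw [Real.norm_of_nonneg (pow_nonneg (hE _) p)]
    exact hpow p j ω
  have hEs : ∀ p, Integrable (fun ω => (Finset.Icc 1 J).sup' (Finset.nonempty_Icc.mpr hJ)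
      (fun j => energy ε (X j ω) ^ p)) P := fun p => integrable_finset_sup' _ (hEi p)
  have hmax : ∀ p, (Finset.Icc 1 J).sup' (Finset.nonempty_Icc.mpr hJ)
      (fun j => ∫ ω, energy ε (X j ω) ^ p ∂P) ≤ M p * (energy ε u₀ + 1) ^ p := fun p => by
    refine Finset.sup'_le _ _ fun j hj => ?_
    obtain ⟨h1, h2⟩ := (hY p).1 j (Finset.mem_Icc.1 hj).2
    exact (integral_mono (hEi p j hj) h1 (hpow p j)).trans h2
  have hsup : ∀ p, ∫ ω, (Finset.Icc 1 J).sup' (Finset.nonempty_Icc.mpr hJ)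
      (fun j => energy ε (X j ω) ^ p) ∂P ≤ M p * (energy ε u₀ + 1) ^ p := fun p => by
    refine le_trans (integral_mono (hEs p) ?_ fun ω => ?_) (hY p).2
    · exact integrable_finset_sup' _ fun j hj => ((hY p).1 j (Finset.mem_Icc.1 hj).2).1
    · exact Finset.sup'_mono_fun fun j _ => hpow p j ω
  have hEi1 := hEi 1
  have hEs1 := hEs 1
  have hmax1 := hmax 1
  have hsup1 := hsup 1
  simp only [pow_one] at hEi1 hEs1 hmax1 hsup1
  obtain ⟨hai, has⟩ := hM' H
  refine ⟨hX.solves.mono fun ω h => h.mass_eq hD hg, fun ω h => h.mass_eq hD hg, hEi1,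
    fun i hi => ?_, hEs1, ?_, ?_, ?_⟩
  · refine ((hai i hi).const_mul (T / J / 2)⁻¹).congr (Filter.Eventually.of_forall fun ω => ?_)
    exact inv_mul_cancel_left₀ (by positivity) _
  · simp only [integral_const_mul] at has
    rw [← Finset.mul_sum] at has
    calc _ ≤ M 1 * (energy ε u₀ + 1) + M' * (energy ε u₀ + 1) := add_le_add hmax1 has
      _ ≤ _ := by nlinarith
  · refine hsup1.trans ?_
    gcongr
    linarith
  · intro r p _
    have habs : ∀ u : H1 D, |energy ε u| = energy ε u := fun u => abs_of_nonneg (hE u)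
    simp only [habs]
    have hfin : M p * (energy ε u₀ + 1) ^ p ≤ (2 ^ p * M p + 1) * (energy ε u₀ ^ p + 1) := by
      have h1 : (energy ε u₀ + 1) ^ p ≤ 2 ^ p * (energy ε u₀ ^ p + 1) := by
        refine (add_pow_le hE₀ zero_le_one p).trans ?_
        rw [one_pow]
        gcongr
        · norm_num
        · omega
      have h2 := mul_le_mul_of_nonneg_left h1 (hM0 p)
      have h3 : 0 ≤ energy ε u₀ ^ p := by positivity
      linarith
    exact ⟨hEi p, hEs p, (hmax p).trans hfin, (hsup p).trans hfin⟩
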